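/- Let $m\ge 1$ and $k\ge 0$ be integers with $m+k=5$, and consider the fifth-order nonlinear dispersion equation $$u_t=-\partial_x^{k}\bigl(u\,\partial_x^{m}u\bigr).$$ Let $g\in C^5(\mathbb R)$ be a shock similarity profile of this equation, that is, a solution of $$\bigl(g\,g^{(m)}\bigr)^{(k)}(z)=-\tfrac15\,g'(z)\,z\quad (z\in\mathbb R),\qquad g(-\infty)=1,\quad g(+\infty)=-1,\qquad g(0)=g''(0)=g^{(4)}(0)=0.$$ Put $u_-(x,t)=g\bigl(x/(-t)^{1/5}\bigr)$ for $x\in\mathbb R$, $t<0$, and $S_-(x)=-\operatorname{sign}x$. Then, as $t\to0^-$: (i) $u_-(\cdot,t)$ does not converge to $S_-$ in $L^1(\mathbb R)$; (ii) $u_-(\cdot,t)$ converges to $S_-$ in $L^1_{\rm loc}(\mathbb R)$, that is, in $L^1(K)$ for every compact $K\subset\mathbb R$; moreover, for every fixed finite $l>0$, $$\|u_-(\cdot,t)-S_-\|_{L^1(-l,l)}=O\bigl((-t)^{1/8}\bigr)\to0 .$$ -/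

import Mathlib

open Filter Topology MeasureTheory Set
open scoped ENNReal

/-- The standing shock `S₋(x) = -sign x`. -/
noncomputable def shockMinus (x : ℝ) : ℝ := -Real.sign x

/-- `g` is a shock similarity profile of the equation NDE-`(m,k)`, that is of
`u_t = -(u ∂ₓᵐ u)_{x…x}` with `m` derivatives inside and `k` outside (`m + k = 5`, `m ≥ 1`):
a classical solution on `ℝ` of `(g g⁽ᵐ⁾)⁽ᵏ⁾ = -(1/5) g' z` with `g(∓∞) = ±1` and with the
anti-symmetry conditions `g(0) = g''(0) = g⁗(0) = 0`. -/
structure IsShockProfile (m k : ℕ) (g : ℝ → ℝ) : Prop where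
  contDiff : ContDiff ℝ 5 g
  ode : ∀ z : ℝ, iteratedDeriv k (fun y => g y * iteratedDeriv m g y) z
    = -(1 / 5 : ℝ) * deriv g z * z
  tendsto_atBot : Tendsto g atBot (𝓝 1)
  tendsto_atTop : Tendsto g atTop (𝓝 (-1))
  zero : g 0 = 0
  second_zero : iteratedDeriv 2 g 0 = 0
  fourth_zero : iteratedDeriv 4 g 0 = 0

/-- The similarity solution `u₋(x,t) = g(x / (-t)^{1/5})`, used for `t < 0`. -/
noncomputable def uMinus (g : ℝ → ℝ) (x t : ℝ) : ℝ := g (x / (-t) ^ (1 / 5 : ℝ))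

/-- The distance `‖u₋(·,t) - S₋‖_{L¹(A)}`, with value `∞` if the difference is not in `L¹(A)`. -/
noncomputable def l1Error (g : ℝ → ℝ) (A : Set ℝ) (t : ℝ) : ℝ≥0∞ :=
  eLpNorm (fun x => uMinus g x t - shockMinus x) 1 (volume.restrict A)

/-! ### Differential inequalities on intervals -/

/-! Everything reduces to the behaviour at infinity of a function `h` with `h → 1` that solves `(h
h⁽ᵐ⁾)⁽ᵏ⁾ = (z/5) h'`; both `-g` and `g(-·)` are such functions. The key facts are that `h - 1 =
O(z^(-5/8))` and that `h - 1` is nevertheless not integrable on the half line. Scaling turns the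
decay rate into the factor `(-t)^(1/8)` on bounded intervals, and non-integrability makes the error
over all of `ℝ` infinite at every time.

Linearized at `1`, the equation is `h⁽⁵⁾ = (z/5) h'`, with local wave number `ω = (z/5)^(1/4)` and
accumulated phase `s = 4ω⁵`. In the variables `x_{j-1} = h⁽ʲ⁾/ωʲ` it becomes the system
`ReducedFlow`: eigenvalues `1, -1, ±i` for `x`, damping `j/(5s)` on the derivative of order `j`, and
a quadratic nonlinearity. That all `x_j` tend to zero is not assumed; it follows from `h → 1` by
mean value arguments and by integrating the equation (`rescale_deriv_unifSmall`).

Since the growing component tends to zero, a cone argument leaves two cases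
(`ReducedFlow.dichotomy`). In the first, the decaying component dominates, so `h'` decays
exponentially and has a fixed sign or vanishes. Integrating the signs back from infinity contradicts
`h(0) = h''(0) = 0` (`not_eventually_sign`), and the vanishing case contradicts uniqueness for the
equation (`not_eventually_const`). So the rotation of the eigenvalues `±i` dominates, and the
profile oscillates forever.

The amplitude of that rotation has the adiabatic invariant `adiab ≈ s · amp²`. Its only dangerous
variation is a nonlinear term multiplied by `s`. The undamped system is reversible, and about a zero
of `x₀ - x₂` the flow agrees with its reflection up to `O(amp/s)` (`reflect_le`); this gains the
missing factor `1/s` over symmetric intervals (`adiab_reflect_le`). A crude use of this gives `c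
s^(-5/8) ≤ amp ≤ C s^(-3/8)`. Inserting the upper bound makes the remaining variation summable and
yields `amp = O(s^(-1/2))` and `H - 1 = O(s^(-1/2))`, which is `z^(-5/8)` because `s` is
proportional to `z^(5/4)`. The crude lower bound already suffices for divergence, since `dz` is
proportional to `s^(-1/5) ds` and `1/5 + 5/8 = 33/40 < 1` (`OscillatoryFlow.not_integrableOn`). -/

theorem le_of_hasDerivAt_nonneg {f f' : ℝ → ℝ} {a b : ℝ} (hab : a ≤ b)
    (hd : ∀ x ∈ Icc a b, HasDerivAt f (f' x) x) (h0 : ∀ x ∈ Icc a b, 0 ≤ f' x) : f a ≤ f b := by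
  have hm : MonotoneOn f (Icc a b) := by
    apply monotoneOn_of_deriv_nonneg (convex_Icc a b)
    · exact fun x hx => (hd x hx).continuousAt.continuousWithinAt
    · exact fun x hx => (hd x (interior_subset hx)).differentiableAt.differentiableWithinAt
    · intro x hx
      rw [(hd x (interior_subset hx)).deriv]
      exact h0 x (interior_subset hx)
  exact hm (left_mem_Icc.2 hab) (right_mem_Icc.2 hab) hab

theorem abs_sub_le_of_hasDerivAt {f f' : ℝ → ℝ} {a b M : ℝ} (hab : a ≤ b)
    (hd : ∀ x ∈ Icc a b, HasDerivAt f (f' x) x) (hM : ∀ x ∈ Icc a b, |f' x| ≤ M) :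
    |f b - f a| ≤ M * (b - a) := by
  rw [abs_le]
  constructor
  · have := le_of_hasDerivAt_nonneg (f := fun x => f x + M * x) (f' := fun x => f' x + M * 1) hab
      (fun x hx => (hd x hx).add ((hasDerivAt_id x).const_mul M))
      (fun x hx => by have := (abs_le.1 (hM x hx)).1; linarith)
    linarith
  · have := le_of_hasDerivAt_nonneg (f := fun x => M * x - f x) (f' := fun x => M * 1 - f' x) hab
      (fun x hx => ((hasDerivAt_id x).const_mul M).sub (hd x hx))
      (fun x hx => by have := (abs_le.1 (hM x hx)).2; linarith)
    linarith

/-- Grönwall's inequality by the integrating factor `exp (-K x)`; no sign of `f` is needed. -/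
theorem le_mul_exp_of_hasDerivAt_le {f f' : ℝ → ℝ} {a b K : ℝ} (hab : a ≤ b)
    (hd : ∀ x ∈ Icc a b, HasDerivAt f (f' x) x) (h : ∀ x ∈ Icc a b, f' x ≤ K * f x) :
    f b ≤ f a * Real.exp (K * (b - a)) := by
  have := le_of_hasDerivAt_nonneg (f := fun x => -(f x * Real.exp (-K * x)))
    (f' := fun x => -(f' x * Real.exp (-K * x) + f x * (Real.exp (-K * x) * (-K * 1)))) hab
    (fun x hx => ((hd x hx).mul (((hasDerivAt_id x).const_mul (-K)).exp)).neg)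
    (fun x hx => by
      have h1 := h x hx
      have h2 := Real.exp_pos (-K * x)
      nlinarith)
  have e : Real.exp (K * (b - a)) = Real.exp (-K * a) * Real.exp (K * b) := by
    rw [← Real.exp_add]; ring_nf
  have e2 : Real.exp (-K * b) * Real.exp (K * b) = 1 := by
    rw [← Real.exp_add]; ring_nf; simp
  rw [e]
  have h3 := Real.exp_pos (K * b)
  calc f b = (f b * Real.exp (-K * b)) * Real.exp (K * b) := by rw [mul_assoc, e2, mul_one]
    _ ≤ (f a * Real.exp (-K * a)) * Real.exp (K * b) :=
      mul_le_mul_of_nonneg_right (by linarith) h3.le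
    _ = _ := by ring

theorem mul_exp_le_of_le_hasDerivAt {f f' : ℝ → ℝ} {a b K : ℝ} (hab : a ≤ b)
    (hd : ∀ x ∈ Icc a b, HasDerivAt f (f' x) x) (h : ∀ x ∈ Icc a b, K * f x ≤ f' x) :
    f a * Real.exp (K * (b - a)) ≤ f b := by
  have := le_mul_exp_of_hasDerivAt_le (f := fun x => -f x) (f' := fun x => -f' x) (K := K) hab
    (fun x hx => (hd x hx).neg) (fun x hx => by have := h x hx; linarith)
  linarith

/-- A function that is nondecreasing as long as it is positive stays above its initial value. -/
theorem le_of_pos_imp_hasDerivAt_nonneg {f f' : ℝ → ℝ} {a b : ℝ} (hab : a ≤ b)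
    (hd : ∀ x ∈ Icc a b, HasDerivAt f (f' x) x) (ha : 0 < f a)
    (h : ∀ x ∈ Icc a b, 0 < f x → 0 ≤ f' x) : f a ≤ f b := by
  have hc : ContinuousOn f (Icc a b) := fun x hx => (hd x hx).continuousAt.continuousWithinAt
  by_cases hT : ∀ x ∈ Icc a b, 0 < f x
  · exact le_of_hasDerivAt_nonneg hab hd fun x hx => h x hx (hT x hx)
  exfalso
  push Not at hT
  obtain ⟨y, hy, hy0⟩ := hT
  have hcl : IsCompact (Icc a b ∩ f ⁻¹' Iic 0) :=
    isCompact_Icc.of_isClosed_subset (hc.preimage_isClosed_of_isClosed isClosed_Icc isClosed_Iic)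
      inter_subset_left
  -- Take the first point with `f ≤ 0`. Before it `f` is positive, hence monotone, so its value
  -- there is at least `f a > 0`.
  obtain ⟨x, ⟨hx, hx0⟩, hmin⟩ := hcl.exists_isLeast ⟨y, hy, hy0⟩
  have hpos : ∀ t ∈ Ico a x, 0 < f t := by
    intro t ht
    by_contra hn
    exact absurd (hmin ⟨⟨ht.1, ht.2.le.trans hx.2⟩, not_lt.1 hn⟩) (not_le.2 ht.2)
  have hmono : MonotoneOn f (Icc a x) := by
    apply monotoneOn_of_deriv_nonneg (convex_Icc a x)
    · exact hc.mono (Icc_subset_Icc_right hx.2)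
    · intro t ht
      rw [interior_Icc] at ht
      exact (hd t ⟨ht.1.le, ht.2.le.trans hx.2⟩).differentiableAt.differentiableWithinAt
    · intro t ht
      rw [interior_Icc] at ht
      have ht' : t ∈ Icc a b := ⟨ht.1.le, ht.2.le.trans hx.2⟩
      rw [(hd t ht').deriv]
      exact h t ht' (hpos t ⟨ht.1.le, ht.2⟩)
  have h1 := hmono (left_mem_Icc.2 hx.1) (right_mem_Icc.2 hx.1) hx.1
  have h2 : f x ≤ 0 := hx0
  linarith

/-- A function whose derivative is positive at each of its zeros stays positive. -/
theorem pos_of_zero_imp_hasDerivAt_pos {f f' : ℝ → ℝ} {a b : ℝ} (hab : a ≤ b)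
    (hd : ∀ x ∈ Icc a b, HasDerivAt f (f' x) x) (ha : 0 < f a)
    (h : ∀ x ∈ Icc a b, f x = 0 → 0 < f' x) : 0 < f b := by
  have hc : ContinuousOn f (Icc a b) := fun x hx => (hd x hx).continuousAt.continuousWithinAt
  by_contra hb
  have hcl : IsCompact (Icc a b ∩ f ⁻¹' Iic 0) :=
    isCompact_Icc.of_isClosed_subset (hc.preimage_isClosed_of_isClosed isClosed_Icc isClosed_Iic)
      inter_subset_left
  obtain ⟨x, ⟨hx, hx0⟩, hmin⟩ := hcl.exists_isLeast ⟨b, right_mem_Icc.2 hab, not_lt.1 hb⟩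
  have hpos : ∀ t ∈ Ico a x, 0 < f t := by
    intro t ht
    by_contra hn
    exact absurd (hmin ⟨⟨ht.1, ht.2.le.trans hx.2⟩, not_lt.1 hn⟩) (not_le.2 ht.2)
  have hax : a < x := lt_of_le_of_ne hx.1 (by rintro rfl; exact absurd ha (not_lt.2 hx0))
  have hfx : f x = 0 := by
    refine le_antisymm hx0 ?_
    have hct : Tendsto f (𝓝[<] x) (𝓝 (f x)) := (hd x hx).continuousAt.tendsto.mono_left inf_le_left
    refine ge_of_tendsto hct ?_
    filter_upwards [Ico_mem_nhdsLT hax] with t ht using (hpos t ht).le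
  have hslope := (hasDerivAt_iff_tendsto_slope_left_right.1 (hd x hx)).1
  have h1 : f' x ≤ 0 := by
    refine le_of_tendsto hslope ?_
    filter_upwards [Ico_mem_nhdsLT hax] with t ht
    rw [slope_def_field, hfx]
    have := hpos t ht
    exact div_nonpos_of_nonneg_of_nonpos (by linarith) (by linarith [ht.2]) |>.trans le_rfl
  exact absurd (h x hx hfx) (not_lt.2 h1)

theorem abs_mul_le_mul {a b A B : ℝ} (ha : |a| ≤ A) (hb : |b| ≤ B) : |a * b| ≤ A * B := by
  rw [abs_mul]
  exact mul_le_mul ha hb (abs_nonneg _) ((abs_nonneg _).trans ha)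

/-! ### Small perturbations of a linear system with eigenvalues `1, -1, ±i` -/

/-- On `[S, ∞)` the functions `p, q, c₁, c₂` satisfy `p' = p`, `q' = -q`, `c₁' = c₂`, `c₂' = -c₁` up
to errors of relative size `σ`. -/
structure NearLinearFlow (σ S : ℝ) (p q c₁ c₂ ep eq e₁ e₂ : ℝ → ℝ) : Prop where
  hasDerivAt_p : ∀ s, S ≤ s → HasDerivAt p (p s + ep s) s
  hasDerivAt_q : ∀ s, S ≤ s → HasDerivAt q (-q s + eq s) s
  hasDerivAt_c₁ : ∀ s, S ≤ s → HasDerivAt c₁ (c₂ s + e₁ s) s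
  hasDerivAt_c₂ : ∀ s, S ≤ s → HasDerivAt c₂ (-c₁ s + e₂ s) s
  ep_le : ∀ s, S ≤ s → |ep s| ≤ σ * (|p s| + |q s| + |c₁ s| + |c₂ s|)
  eq_le : ∀ s, S ≤ s → |eq s| ≤ σ * (|p s| + |q s| + |c₁ s| + |c₂ s|)
  e₁_le : ∀ s, S ≤ s → |e₁ s| ≤ σ * (|p s| + |q s| + |c₁ s| + |c₂ s|)
  e₂_le : ∀ s, S ≤ s → |e₂ s| ≤ σ * (|p s| + |q s| + |c₁ s| + |c₂ s|)

theorem abs_le_mul_of_sq_le {a b k : ℝ} (hk : 0 ≤ k) (h : a ^ 2 ≤ k ^ 2 * b ^ 2) :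
    |a| ≤ k * |b| := by
  rw [← abs_of_nonneg hk, ← abs_mul]
  exact sq_le_sq.1 (by rw [mul_pow]; exact h)

namespace NearLinearFlow

variable {σ S : ℝ} {p q c₁ c₂ ep eq e₁ e₂ : ℝ → ℝ}

/-- If the growing component tends to zero, it is dominated by the other components. -/
theorem sq_p_le (h : NearLinearFlow σ S p q c₁ c₂ ep eq e₁ e₂) (hσ0 : 0 ≤ σ) (hσ : σ ≤ 1 / 100)
    (hp : Tendsto p atTop (𝓝 0)) {s : ℝ} (hs : S ≤ s) :
    p s ^ 2 ≤ (q s ^ 2 + c₁ s ^ 2 + c₂ s ^ 2) / 100 := by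
  by_contra hcon
  rw [not_le] at hcon
  -- Cone argument. Where this quadratic form is positive, the other components are at most `10
  -- |p|`, and the term `2 p²` in its derivative beats all the errors. Once positive, the form never
  -- falls below its current value, so `p²` stays bounded away from zero.
  have key : ∀ t, S ≤ t → 0 < p t ^ 2 - (q t ^ 2 + c₁ t ^ 2 + c₂ t ^ 2) / 100 →
      0 ≤ 2 * p t * (p t + ep t) - (2 * q t * (-q t + eq t) + 2 * c₁ t * (c₂ t + e₁ t)
        + 2 * c₂ t * (-c₁ t + e₂ t)) / 100 := by
    intro t ht hV
    have hq : |q t| ≤ 10 * |p t| := abs_le_mul_of_sq_le (by norm_num) (by nlinarith)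
    have h1 : |c₁ t| ≤ 10 * |p t| := abs_le_mul_of_sq_le (by norm_num) (by nlinarith)
    have h2 : |c₂ t| ≤ 10 * |p t| := abs_le_mul_of_sq_le (by norm_num) (by nlinarith)
    have hn : σ * (|p t| + |q t| + |c₁ t| + |c₂ t|) ≤ 31 / 100 * |p t| := by
      nlinarith [abs_nonneg (p t)]
    have a0 := (abs_le.1 (abs_mul_le_mul (le_refl |p t|) ((h.ep_le t ht).trans hn))).1
    have a1 := (abs_le.1 (abs_mul_le_mul hq ((h.eq_le t ht).trans hn))).2
    have a2 := (abs_le.1 (abs_mul_le_mul h1 ((h.e₁_le t ht).trans hn))).2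
    have a3 := (abs_le.1 (abs_mul_le_mul h2 ((h.e₂_le t ht).trans hn))).2
    have a4 : |p t| * |p t| = p t ^ 2 := by rw [← sq, sq_abs]
    nlinarith [sq_nonneg (q t), sq_nonneg (p t)]
  have mono : ∀ t, s ≤ t → p s ^ 2 - (q s ^ 2 + c₁ s ^ 2 + c₂ s ^ 2) / 100
      ≤ p t ^ 2 - (q t ^ 2 + c₁ t ^ 2 + c₂ t ^ 2) / 100 := by
    intro t ht
    refine le_of_pos_imp_hasDerivAt_nonneg
      (f := fun t => p t ^ 2 - (q t ^ 2 + c₁ t ^ 2 + c₂ t ^ 2) / 100)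
      (f' := fun t => 2 * p t * (p t + ep t) - (2 * q t * (-q t + eq t)
        + 2 * c₁ t * (c₂ t + e₁ t) + 2 * c₂ t * (-c₁ t + e₂ t)) / 100) ht ?_ (by linarith)
        (fun x hx => key x (hs.trans hx.1))
    intro x hx
    have hx' := hs.trans hx.1
    have := ((h.1 x hx').pow 2).sub (((((h.2 x hx').pow 2).add ((h.3 x hx').pow 2)).add
      ((h.4 x hx').pow 2)).div_const 100)
    refine this.congr_deriv ?_
    push_cast
    ring
  have hlim : Tendsto (fun t => p t ^ 2) atTop (𝓝 0) := by simpa using hp.pow 2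
  have : p s ^ 2 - (q s ^ 2 + c₁ s ^ 2 + c₂ s ^ 2) / 100 ≤ 0 := by
    refine ge_of_tendsto hlim ?_
    filter_upwards [eventually_ge_atTop s] with t ht
    have := mono t ht
    nlinarith [sq_nonneg (q t), sq_nonneg (c₁ t), sq_nonneg (c₂ t)]
  linarith

/-- The rotation preserves `c₁² + c₂²`, so only the error terms survive in the derivative. -/
theorem hasDerivAt_center (h : NearLinearFlow σ S p q c₁ c₂ ep eq e₁ e₂) {s : ℝ} (hs : S ≤ s) :
    HasDerivAt (fun s => c₁ s ^ 2 + c₂ s ^ 2) (2 * (c₁ s * e₁ s) + 2 * (c₂ s * e₂ s)) s := by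
  have := ((h.3 s hs).pow 2).add ((h.4 s hs).pow 2)
  refine this.congr_deriv ?_
  push_cast
  ring

theorem hasDerivAt_sq_q (h : NearLinearFlow σ S p q c₁ c₂ ep eq e₁ e₂) {s : ℝ} (hs : S ≤ s) :
    HasDerivAt (fun s => q s ^ 2) (-2 * q s ^ 2 + 2 * (q s * eq s)) s := by
  have := (h.2 s hs).pow 2
  refine this.congr_deriv ?_
  push_cast
  ring

/-- The centre part is dominated by the decaying component for all large times as soon as it is
never larger than ten times the latter. -/
theorem center_le_of_forall_le (h : NearLinearFlow σ S p q c₁ c₂ ep eq e₁ e₂) (hσ0 : 0 ≤ σ)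
    (hσ : σ ≤ 1 / 10000) (hp : Tendsto p atTop (𝓝 0)) (hc₁ : Tendsto c₁ atTop (𝓝 0))
    (hc₂ : Tendsto c₂ atTop (𝓝 0))
    (hle : ∀ s, S ≤ s → c₁ s ^ 2 + c₂ s ^ 2 ≤ 100 * q s ^ 2) {s : ℝ} (hs : S ≤ s) :
    c₁ s ^ 2 + c₂ s ^ 2 ≤ q s ^ 2 / 16 := by
  by_contra hcon
  rw [not_le] at hcon
  -- Everything is bounded by a multiple of `|q|`, while the decay of `q²/16` contributes `q²/8`,
  -- more than the errors. The form is therefore nondecreasing. It is at most `c₁² + c₂² → 0`, so it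
  -- can never be positive.
  have key : ∀ t, S ≤ t → 0 ≤ (2 * (c₁ t * e₁ t) + 2 * (c₂ t * e₂ t))
      - (-2 * q t ^ 2 + 2 * (q t * eq t)) / 16 := by
    intro t ht
    have hQ := hle t ht
    have hP := h.sq_p_le hσ0 (hσ.trans (by norm_num)) hp ht
    have h0 : |p t| ≤ 2 * |q t| := abs_le_mul_of_sq_le (by norm_num) (by nlinarith)
    have h1 : |c₁ t| ≤ 10 * |q t| := abs_le_mul_of_sq_le (by norm_num) (by nlinarith)
    have h2 : |c₂ t| ≤ 10 * |q t| := abs_le_mul_of_sq_le (by norm_num) (by nlinarith)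
    have hn : σ * (|p t| + |q t| + |c₁ t| + |c₂ t|) ≤ 23 / 10000 * |q t| := by
      nlinarith [abs_nonneg (q t)]
    have a1 := (abs_le.1 (abs_mul_le_mul (le_refl |q t|) ((h.eq_le t ht).trans hn))).2
    have a2 := (abs_le.1 (abs_mul_le_mul h1 ((h.e₁_le t ht).trans hn))).1
    have a3 := (abs_le.1 (abs_mul_le_mul h2 ((h.e₂_le t ht).trans hn))).1
    have a4 : |q t| * |q t| = q t ^ 2 := by rw [← sq, sq_abs]
    nlinarith [sq_nonneg (q t)]
  have mono : ∀ t, s ≤ t → (c₁ s ^ 2 + c₂ s ^ 2) - q s ^ 2 / 16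
      ≤ (c₁ t ^ 2 + c₂ t ^ 2) - q t ^ 2 / 16 := by
    intro t ht
    exact le_of_hasDerivAt_nonneg (f := fun t => (c₁ t ^ 2 + c₂ t ^ 2) - q t ^ 2 / 16) ht
      (fun x hx => (h.hasDerivAt_center (hs.trans hx.1)).sub
        ((h.hasDerivAt_sq_q (hs.trans hx.1)).div_const 16))
      (fun x hx => key x (hs.trans hx.1))
  have hlim : Tendsto (fun t => c₁ t ^ 2 + c₂ t ^ 2) atTop (𝓝 0) := by
    simpa using (hc₁.pow 2).add (hc₂.pow 2)
  have : (c₁ s ^ 2 + c₂ s ^ 2) - q s ^ 2 / 16 ≤ 0 := by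
    refine ge_of_tendsto hlim ?_
    filter_upwards [eventually_ge_atTop s] with t ht
    have := mono t ht
    nlinarith [sq_nonneg (q t)]
  linarith

/-- The regime in which the centre part dominates the decaying component is forward invariant. -/
theorem sq_q_lt_of_sq_q_lt (h : NearLinearFlow σ S p q c₁ c₂ ep eq e₁ e₂) (hσ0 : 0 ≤ σ)
    (hσ : σ ≤ 1 / 10000) (hp : Tendsto p atTop (𝓝 0)) {a b : ℝ} (ha : S ≤ a) (hab : a ≤ b)
    (hlt : 100 * q a ^ 2 < c₁ a ^ 2 + c₂ a ^ 2) : 100 * q b ^ 2 < c₁ b ^ 2 + c₂ b ^ 2 := by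
  -- the squared norm never vanishes
  have hN : ∀ t, a ≤ t → 0 < q t ^ 2 + (c₁ t ^ 2 + c₂ t ^ 2) := by
    intro t ht
    have := mul_exp_le_of_le_hasDerivAt (f := fun t => q t ^ 2 + (c₁ t ^ 2 + c₂ t ^ 2)) (K := -3)
      ht (fun x hx => (h.hasDerivAt_sq_q (ha.trans hx.1)).add
        (h.hasDerivAt_center (ha.trans hx.1))) (fun x hx => by
        have hx' := ha.trans hx.1
        have hP := h.sq_p_le hσ0 (hσ.trans (by norm_num)) hp hx'
        set n := |p x| + |q x| + |c₁ x| + |c₂ x|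
        have hn0 : 0 ≤ n := by positivity
        have hn : n ^ 2 ≤ 5 * (q x ^ 2 + (c₁ x ^ 2 + c₂ x ^ 2)) := by
          rw [← sq_abs (p x), ← sq_abs (q x), ← sq_abs (c₁ x), ← sq_abs (c₂ x)] at hP
          rw [← sq_abs (q x), ← sq_abs (c₁ x), ← sq_abs (c₂ x)]
          simp only [n]
          nlinarith [sq_nonneg (|p x| - |q x|), sq_nonneg (|p x| - |c₁ x|),
            sq_nonneg (|p x| - |c₂ x|), sq_nonneg (|q x| - |c₁ x|), sq_nonneg (|q x| - |c₂ x|),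
            sq_nonneg (|c₁ x| - |c₂ x|)]
        have hqn : |q x| ≤ n := by
          simp only [n]; linarith [abs_nonneg (p x), abs_nonneg (c₁ x), abs_nonneg (c₂ x)]
        have h1n : |c₁ x| ≤ n := by
          simp only [n]; linarith [abs_nonneg (p x), abs_nonneg (q x), abs_nonneg (c₂ x)]
        have h2n : |c₂ x| ≤ n := by
          simp only [n]; linarith [abs_nonneg (p x), abs_nonneg (c₁ x), abs_nonneg (q x)]
        have hσn : σ * n ≤ 1 / 10000 * n := by gcongr
        have a1 := (abs_le.1 (abs_mul_le_mul hqn ((h.eq_le x hx').trans hσn))).1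
        have a2 := (abs_le.1 (abs_mul_le_mul h1n ((h.e₁_le x hx').trans hσn))).1
        have a3 := (abs_le.1 (abs_mul_le_mul h2n ((h.e₂_le x hx').trans hσn))).1
        nlinarith [sq_nonneg (q x), sq_nonneg (c₁ x), sq_nonneg (c₂ x)])
    refine lt_of_lt_of_le ?_ this
    have : 0 < q a ^ 2 + (c₁ a ^ 2 + c₂ a ^ 2) := by nlinarith [sq_nonneg (q a)]
    positivity
  -- On the boundary of the cone the decay of `100 q²` contributes `200 q²` to the derivative and
  -- dominates the errors. This is strict because `q ≠ 0` there: otherwise the squared norm bounded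
  -- below by `hN` would vanish.
  have := pos_of_zero_imp_hasDerivAt_pos (f := fun t => (c₁ t ^ 2 + c₂ t ^ 2) - 100 * q t ^ 2) hab
    (fun x hx => (h.hasDerivAt_center (ha.trans hx.1)).sub
        ((h.hasDerivAt_sq_q (ha.trans hx.1)).const_mul 100)) (by linarith) (fun x hx h0 => by
      have hx' := ha.trans hx.1
      have hP := h.sq_p_le hσ0 (hσ.trans (by norm_num)) hp hx'
      have hQ : c₁ x ^ 2 + c₂ x ^ 2 = 100 * q x ^ 2 := by linarith
      have hq : 0 < q x ^ 2 := by have := hN x hx.1; nlinarith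
      have h0 : |p x| ≤ 2 * |q x| := abs_le_mul_of_sq_le (by norm_num) (by nlinarith)
      have h1 : |c₁ x| ≤ 10 * |q x| :=
        abs_le_mul_of_sq_le (by norm_num) (by nlinarith [sq_nonneg (c₂ x)])
      have h2 : |c₂ x| ≤ 10 * |q x| :=
        abs_le_mul_of_sq_le (by norm_num) (by nlinarith [sq_nonneg (c₁ x)])
      have hn : σ * (|p x| + |q x| + |c₁ x| + |c₂ x|) ≤ 23 / 10000 * |q x| := by
        nlinarith [abs_nonneg (q x)]
      have a1 := (abs_le.1 (abs_mul_le_mul (le_refl |q x|) ((h.eq_le x hx').trans hn))).2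
      have a2 := (abs_le.1 (abs_mul_le_mul h1 ((h.e₁_le x hx').trans hn))).1
      have a3 := (abs_le.1 (abs_mul_le_mul h2 ((h.e₂_le x hx').trans hn))).1
      have a4 : |q x| * |q x| = q x ^ 2 := by rw [← sq, sq_abs]
      nlinarith)
  linarith

/-- If the decaying component dominates, then it decays exponentially and has a constant sign
unless it vanishes identically. -/
theorem decay_of_center_le (h : NearLinearFlow σ S p q c₁ c₂ ep eq e₁ e₂) (hσ0 : 0 ≤ σ)
    (hσ : σ ≤ 1 / 10000) (hp : Tendsto p atTop (𝓝 0))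
    (hle : ∀ s, S ≤ s → c₁ s ^ 2 + c₂ s ^ 2 ≤ q s ^ 2 / 16) :
    (∃ C, ∀ s, S ≤ s → |q s| ≤ C * Real.exp (-s / 2)) ∧
      ((∀ s, S ≤ s → q s = 0) ∨ (∀ s, S ≤ s → 0 < q s) ∨ (∀ s, S ≤ s → q s < 0)) := by
  have bd : ∀ x, S ≤ x → |q x * eq x| ≤ 3 / 10000 * q x ^ 2 := by
    intro x hx
    have hP := h.sq_p_le hσ0 (hσ.trans (by norm_num)) hp hx
    have hQ := hle x hx
    have h0 : |p x| ≤ 1 / 2 * |q x| := abs_le_mul_of_sq_le (by norm_num) (by nlinarith)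
    have h1 : |c₁ x| ≤ 1 / 2 * |q x| := abs_le_mul_of_sq_le (by norm_num) (by nlinarith)
    have h2 : |c₂ x| ≤ 1 / 2 * |q x| := abs_le_mul_of_sq_le (by norm_num) (by nlinarith)
    have hn : σ * (|p x| + |q x| + |c₁ x| + |c₂ x|) ≤ 3 / 10000 * |q x| := by
      nlinarith [abs_nonneg (q x)]
    have a1 := abs_mul_le_mul (le_refl |q x|) ((h.eq_le x hx).trans hn)
    have a4 : |q x| * |q x| = q x ^ 2 := by rw [← sq, sq_abs]
    nlinarith
  -- The logarithmic rate of `q²` is `-2` up to a tiny error, so it lies between `-3` and `-1`. The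
  -- upper rate gives the decay `exp (-s/2)` of `q`; the lower one keeps a nonzero `q` from ever
  -- vanishing.
  have up : ∀ a b, S ≤ a → a ≤ b → q b ^ 2 ≤ q a ^ 2 * Real.exp (-1 * (b - a)) := by
    intro a b ha hab
    exact le_mul_exp_of_hasDerivAt_le (f := fun t => q t ^ 2) hab
      (fun x hx => h.hasDerivAt_sq_q (ha.trans hx.1)) (fun x hx => by
        have := (abs_le.1 (bd x (ha.trans hx.1))).2
        nlinarith [sq_nonneg (q x)])
  have low : ∀ a b, S ≤ a → a ≤ b → q a ^ 2 * Real.exp (-3 * (b - a)) ≤ q b ^ 2 := by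
    intro a b ha hab
    exact mul_exp_le_of_le_hasDerivAt (f := fun t => q t ^ 2) hab
      (fun x hx => h.hasDerivAt_sq_q (ha.trans hx.1)) (fun x hx => by
        have := (abs_le.1 (bd x (ha.trans hx.1))).1
        nlinarith [sq_nonneg (q x)])
  constructor
  · refine ⟨|q S| * Real.exp (S / 2), fun s hs => ?_⟩
    refine abs_le_of_sq_le_sq ?_ (by positivity)
    have := up S s le_rfl hs
    refine this.trans (le_of_eq ?_)
    rw [mul_pow, mul_pow, sq_abs, ← Real.exp_nat_mul, ← Real.exp_nat_mul, mul_assoc,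
      ← Real.exp_add]
    congr 2; push_cast; ring
  · by_cases hz : q S = 0
    · left
      intro s hs
      have := up S s le_rfl hs
      rw [hz] at this
      nlinarith [sq_nonneg (q s)]
    · right
      have hne : ∀ s, S ≤ s → q s ≠ 0 := by
        intro s hs h0
        have := low S s le_rfl hs
        rw [h0] at this
        have h1 : 0 < q S ^ 2 := by positivity
        have h2 := Real.exp_pos (-3 * (s - S))
        nlinarith
      have hc : ContinuousOn q (Ici S) := fun x hx => (h.2 x hx).continuousAt.continuousWithinAt
      rcases lt_or_gt_of_ne hz with hneg | hpos
      · right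
        intro s hs
        by_contra hcon
        obtain ⟨t, ht, h0⟩ := intermediate_value_Icc hs (hc.mono Icc_subset_Ici_self)
          ⟨hneg.le, not_lt.1 hcon⟩
        exact hne t ht.1 h0
      · left
        intro s hs
        by_contra hcon
        obtain ⟨t, ht, h0⟩ := intermediate_value_Icc' hs (hc.mono Icc_subset_Ici_self)
          ⟨not_lt.1 hcon, hpos.le⟩
        exact hne t ht.1 h0

end NearLinearFlow

/-! ### The profile equation in slow variables -/

/-- The right-hand side of the equation for the highest derivative. -/
noncomputable def reducedForce (α β h x₀ x₁ x₂ x₃ : ℝ) : ℝ := (x₀ - α * x₀ * x₃ - β * x₁ * x₂) / h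

/-- The constant of the Lipschitz estimate for `reducedForce`. -/
noncomputable def forceConst (α β : ℝ) : ℝ := 4 * (1 + |α| + |β|)

theorem forceConst_pos (α β : ℝ) : 0 < forceConst α β := by
  unfold forceConst; positivity

/-- At the equilibrium the force linearizes to `x₀`; the rest is quadratic, so its differences gain
a factor `δ`. The splitting below puts the small factors `x₂, x₃` on one state and `y₀, y₁` on the
other, so that bounds on `x₀` and `x₁` are not needed. -/
theorem reducedForce_sub_le {α β δ h x₀ x₁ x₂ x₃ h' y₀ y₁ y₂ y₃ : ℝ} (hδ : δ ≤ 1 / 2)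
    (hh : |h - 1| ≤ δ) (hx₂ : |x₂| ≤ δ) (hx₃ : |x₃| ≤ δ)
    (hh' : |h' - 1| ≤ δ) (hy₀ : |y₀| ≤ δ) (hy₁ : |y₁| ≤ δ) (hy₂ : |y₂| ≤ δ) (hy₃ : |y₃| ≤ δ) :
    |reducedForce α β h x₀ x₁ x₂ x₃ - reducedForce α β h' y₀ y₁ y₂ y₃ - (x₀ - y₀)| ≤
      forceConst α β * δ * (|h - h'| + |x₀ - y₀| + |x₁ - y₁| + |x₂ - y₂| + |x₃ - y₃|) := by
  have hδ0 : 0 ≤ δ := (abs_nonneg _).trans hh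
  have h1 : 1 / 2 ≤ h := by have := (abs_le.1 hh).1; linarith
  have h2 : 1 / 2 ≤ h' := by have := (abs_le.1 hh').1; linarith
  have hi : |h⁻¹| ≤ 2 := by
    rw [abs_of_pos (by positivity)]
    exact inv_le_of_inv_le₀ (by norm_num) (by linarith)
  have hi' : |h'⁻¹| ≤ 2 := by
    rw [abs_of_pos (by positivity)]
    exact inv_le_of_inv_le₀ (by norm_num) (by linarith)
  have e : reducedForce α β h x₀ x₁ x₂ x₃ - reducedForce α β h' y₀ y₁ y₂ y₃ - (x₀ - y₀) =
      ((x₀ - y₀) * (1 - h) - α * ((x₀ - y₀) * x₃ + y₀ * (x₃ - y₃))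
        - β * ((x₁ - y₁) * x₂ + y₁ * (x₂ - y₂))) * h⁻¹
      - (y₀ - α * (y₀ * y₃) - β * (y₁ * y₂)) * (h - h') * (h⁻¹ * h'⁻¹) := by
    unfold reducedForce
    field_simp
    ring
  have hA : |y₀ - α * (y₀ * y₃) - β * (y₁ * y₂)| ≤ (1 + |α| + |β|) * δ := by
    have b1 : |α * (y₀ * y₃)| ≤ |α| * δ := by
      refine abs_mul_le_mul le_rfl ((abs_mul_le_mul hy₀ hy₃).trans ?_)
      nlinarith
    have b2 : |β * (y₁ * y₂)| ≤ |β| * δ := by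
      refine abs_mul_le_mul le_rfl ((abs_mul_le_mul hy₁ hy₂).trans ?_)
      nlinarith
    calc _ ≤ |y₀| + |α * (y₀ * y₃)| + |β * (y₁ * y₂)| :=
          (abs_sub _ _).trans (add_le_add_left (abs_sub _ _) _)
      _ ≤ _ := by linarith
  have hD0 := abs_nonneg (x₀ - y₀)
  have hD1 := abs_nonneg (x₁ - y₁)
  have hD2 := abs_nonneg (x₂ - y₂)
  have hD3 := abs_nonneg (x₃ - y₃)
  have hDh := abs_nonneg (h - h')
  have hα := abs_nonneg α
  have hβ := abs_nonneg β
  set D := |x₀ - y₀| + |x₁ - y₁| + |x₂ - y₂| + |x₃ - y₃| with hD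
  have hB : |(x₀ - y₀) * (1 - h) - α * ((x₀ - y₀) * x₃ + y₀ * (x₃ - y₃))
        - β * ((x₁ - y₁) * x₂ + y₁ * (x₂ - y₂))| ≤ (1 + |α| + |β|) * (δ * D) := by
    have b0 : |(x₀ - y₀) * (1 - h)| ≤ |x₀ - y₀| * δ :=
      abs_mul_le_mul le_rfl (by rwa [abs_sub_comm])
    have b1 : |(x₀ - y₀) * x₃ + y₀ * (x₃ - y₃)| ≤ |x₀ - y₀| * δ + δ * |x₃ - y₃| :=
      (abs_add_le _ _).trans (add_le_add (abs_mul_le_mul le_rfl hx₃) (abs_mul_le_mul hy₀ le_rfl))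
    have b2 : |(x₁ - y₁) * x₂ + y₁ * (x₂ - y₂)| ≤ |x₁ - y₁| * δ + δ * |x₂ - y₂| :=
      (abs_add_le _ _).trans (add_le_add (abs_mul_le_mul le_rfl hx₂) (abs_mul_le_mul hy₁ le_rfl))
    have b1' : |(x₀ - y₀) * x₃ + y₀ * (x₃ - y₃)| ≤ δ * D := b1.trans (by rw [hD]; nlinarith)
    have b2' : |(x₁ - y₁) * x₂ + y₁ * (x₂ - y₂)| ≤ δ * D := b2.trans (by rw [hD]; nlinarith)
    have b0' : |(x₀ - y₀) * (1 - h)| ≤ δ * D := b0.trans (by rw [hD]; nlinarith)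
    have c1 := abs_mul_le_mul (le_refl |α|) b1'
    have c2 := abs_mul_le_mul (le_refl |β|) b2'
    refine ((abs_sub _ _).trans (add_le_add_left (abs_sub _ _) _)).trans ?_
    linarith
  rw [e]
  have t1 := abs_mul_le_mul hB hi
  have t2 := abs_mul_le_mul (abs_mul_le_mul hA (le_refl |h - h'|)) (abs_mul_le_mul hi hi')
  refine (abs_sub _ _).trans ((add_le_add t1 t2).trans ?_)
  have hD' : |h - h'| + |x₀ - y₀| + |x₁ - y₁| + |x₂ - y₂| + |x₃ - y₃| = |h - h'| + D := by
    rw [hD]; ring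
  rw [hD']
  unfold forceConst
  have : 0 ≤ (1 + |α| + |β|) * (δ * D) := by positivity
  linarith

theorem reducedForce_sub_self_le {α β δ h x₀ x₁ x₂ x₃ : ℝ} (hδ : δ ≤ 1 / 2) (hh : |h - 1| ≤ δ)
    (hx₂ : |x₂| ≤ δ) (hx₃ : |x₃| ≤ δ) :
    |reducedForce α β h x₀ x₁ x₂ x₃ - x₀| ≤
      forceConst α β * δ * (|x₀| + |x₁| + |x₂| + |x₃|) := by
  have hδ0 : 0 ≤ δ := (abs_nonneg _).trans hh
  have := reducedForce_sub_le (α := α) (β := β) (x₀ := x₀) (x₁ := x₁) (y₀ := 0) (y₁ := 0)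
    (y₂ := 0) (y₃ := 0) hδ hh hx₂ hx₃ hh (by simpa) (by simpa) (by simpa) (by simpa)
  have e : reducedForce α β h 0 0 0 0 = 0 := by simp [reducedForce]
  simpa [e] using this

/-- The profile equation for `H` near the constant state `1`, in the variable `s ∼ z^{5/4}`. -/
structure ReducedFlow (α β S : ℝ) (H x₀ x₁ x₂ x₃ : ℝ → ℝ) : Prop where
  pos : 0 < S
  hasDerivAt_H : ∀ s, S ≤ s → HasDerivAt H (x₀ s) s
  hasDerivAt_x₀ : ∀ s, S ≤ s → HasDerivAt x₀ (x₁ s - 1 / (5 * s) * x₀ s) s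
  hasDerivAt_x₁ : ∀ s, S ≤ s → HasDerivAt x₁ (x₂ s - 2 * (1 / (5 * s)) * x₁ s) s
  hasDerivAt_x₂ : ∀ s, S ≤ s → HasDerivAt x₂ (x₃ s - 3 * (1 / (5 * s)) * x₂ s) s
  hasDerivAt_x₃ : ∀ s, S ≤ s → HasDerivAt x₃
    (reducedForce α β (H s) (x₀ s) (x₁ s) (x₂ s) (x₃ s) - 4 * (1 / (5 * s)) * x₃ s) s
  tendsto_H : Tendsto H atTop (𝓝 1)
  tendsto_x₀ : Tendsto x₀ atTop (𝓝 0)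
  tendsto_x₁ : Tendsto x₁ atTop (𝓝 0)
  tendsto_x₂ : Tendsto x₂ atTop (𝓝 0)
  tendsto_x₃ : Tendsto x₃ atTop (𝓝 0)

/-- At time `s` the distance to the equilibrium and the damping coefficient are at most `δ`. -/
structure FlowSmall (H x₀ x₁ x₂ x₃ : ℝ → ℝ) (δ s : ℝ) : Prop where
  H_le : |H s - 1| ≤ δ
  x₀_le : |x₀ s| ≤ δ
  x₁_le : |x₁ s| ≤ δ
  x₂_le : |x₂ s| ≤ δ
  x₃_le : |x₃ s| ≤ δ
  damp_le : 1 / (5 * s) ≤ δ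

namespace ReducedFlow

variable {α β S : ℝ} {H x₀ x₁ x₂ x₃ : ℝ → ℝ}

theorem mono (h : ReducedFlow α β S H x₀ x₁ x₂ x₃) {S' : ℝ} (hS : S ≤ S') :
    ReducedFlow α β S' H x₀ x₁ x₂ x₃ :=
  ⟨h.pos.trans_le hS, fun s hs => h.2 s (hS.trans hs), fun s hs => h.3 s (hS.trans hs),
    fun s hs => h.4 s (hS.trans hs), fun s hs => h.5 s (hS.trans hs),
    fun s hs => h.6 s (hS.trans hs), h.7, h.8, h.9, h.10, h.11⟩

theorem eventually_small (h : ReducedFlow α β S H x₀ x₁ x₂ x₃) {δ : ℝ} (hδ : 0 < δ) :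
    ∃ S', S ≤ S' ∧ ∀ s, S' ≤ s → FlowSmall H x₀ x₁ x₂ x₃ δ s := by
  have hb : ∀ {f : ℝ → ℝ} {a : ℝ}, Tendsto f atTop (𝓝 a) → ∀ᶠ s in atTop, |f s - a| ≤ δ := by
    intro f a hf
    filter_upwards [Metric.tendsto_nhds.1 hf δ hδ] with s hs
    rw [Real.dist_eq] at hs
    exact hs.le
  have hν : Tendsto (fun s : ℝ => 1 / (5 * s)) atTop (𝓝 0) := by
    simp_rw [one_div]
    exact (tendsto_id.const_mul_atTop (by norm_num : (0 : ℝ) < 5)).inv_tendsto_atTop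
  obtain ⟨S', hS'⟩ := eventually_atTop.1 ((hb h.tendsto_H).and ((hb h.tendsto_x₀).and
    ((hb h.tendsto_x₁).and ((hb h.tendsto_x₂).and ((hb h.tendsto_x₃).and (hb hν))))))
  refine ⟨max S S', le_max_left _ _, fun s hs => ?_⟩
  obtain ⟨a, b, c, d, e, f⟩ := hS' s ((le_max_right _ _).trans hs)
  rw [sub_zero] at b c d e f
  exact ⟨a, b, c, d, e, (le_abs_self _).trans f⟩

/-- The linear part is the cyclic shift `x₀' = x₁, x₁' = x₂, x₂' = x₃, x₃' = x₀`, with eigenvalues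
the fourth roots of unity; the four combinations are its real eigencoordinates. The number `10 = 1 +
2 + 3 + 4` collects the damping coefficients. -/
theorem nearLinearFlow (h : ReducedFlow α β S H x₀ x₁ x₂ x₃) {δ : ℝ} (hδ : δ ≤ 1 / 2)
    (hs : ∀ s, S ≤ s → FlowSmall H x₀ x₁ x₂ x₃ δ s) :
    NearLinearFlow ((forceConst α β + 10) * δ) S
      (fun s => x₀ s + x₁ s + x₂ s + x₃ s) (fun s => x₀ s - x₁ s + x₂ s - x₃ s)
      (fun s => x₀ s - x₂ s) (fun s => x₁ s - x₃ s)
      (fun s => -(1 / (5 * s)) * x₀ s - 2 * (1 / (5 * s)) * x₁ s - 3 * (1 / (5 * s)) * x₂ s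
        + (reducedForce α β (H s) (x₀ s) (x₁ s) (x₂ s) (x₃ s) - x₀ s - 4 * (1 / (5 * s)) * x₃ s))
      (fun s => -(1 / (5 * s)) * x₀ s + 2 * (1 / (5 * s)) * x₁ s - 3 * (1 / (5 * s)) * x₂ s
        - (reducedForce α β (H s) (x₀ s) (x₁ s) (x₂ s) (x₃ s) - x₀ s - 4 * (1 / (5 * s)) * x₃ s))
      (fun s => -(1 / (5 * s)) * x₀ s + 3 * (1 / (5 * s)) * x₂ s)
      (fun s => -(2 * (1 / (5 * s))) * x₁ s
        - (reducedForce α β (H s) (x₀ s) (x₁ s) (x₂ s) (x₃ s) - x₀ s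
          - 4 * (1 / (5 * s)) * x₃ s)) := by
  have aux : ∀ s, S ≤ s → ∃ ν R n : ℝ, ν = 1 / (5 * s) ∧
      R = reducedForce α β (H s) (x₀ s) (x₁ s) (x₂ s) (x₃ s) - x₀ s ∧
      |ν * x₀ s| ≤ δ * n ∧ |ν * x₁ s| ≤ δ * n ∧ |ν * x₂ s| ≤ δ * n ∧ |ν * x₃ s| ≤ δ * n ∧
      |R| ≤ forceConst α β * δ * n ∧ 0 ≤ δ * n ∧ 
      (forceConst α β + 10) * δ * n ≤ (forceConst α β + 10) * δ *
        (|x₀ s + x₁ s + x₂ s + x₃ s| + |x₀ s - x₁ s + x₂ s - x₃ s| + |x₀ s - x₂ s|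
          + |x₁ s - x₃ s|) ∧ |ν * x₀ s| + |ν * x₁ s| + |ν * x₂ s| + |ν * x₃ s| ≤ δ * n := by
    intro s hs'
    have hsm := hs s hs'
    have hδ0 : 0 ≤ δ := (abs_nonneg _).trans hsm.H_le
    have hν0 : 0 < 1 / (5 * s) := by have := h.pos.trans_le hs'; positivity
    have hν : |1 / (5 * s)| ≤ δ := by rw [abs_of_pos hν0]; exact hsm.damp_le
    refine ⟨_, _, |x₀ s| + |x₁ s| + |x₂ s| + |x₃ s|, rfl, rfl, ?_, ?_, ?_, ?_,
      reducedForce_sub_self_le hδ hsm.H_le hsm.x₂_le hsm.x₃_le, by positivity, ?_, ?_⟩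
    iterate 4
      refine abs_mul_le_mul hν ?_
      linarith [abs_nonneg (x₀ s), abs_nonneg (x₁ s), abs_nonneg (x₂ s), abs_nonneg (x₃ s)]
    · have := forceConst_pos α β
      refine mul_le_mul_of_nonneg_left ?_ (by positivity)
      -- The coordinates are recovered by `a = (p + q)/4 + c₁/2` and its analogues, so the
      -- eigencoordinates control the original ones.
      generalize x₀ s = a
      generalize x₁ s = b
      generalize x₂ s = c
      generalize x₃ s = d
      have hp := abs_le.1 (le_refl |a + b + c + d|)
      have hq := abs_le.1 (le_refl |a - b + c - d|)
      have h1 := abs_le.1 (le_refl |a - c|)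
      have h2 := abs_le.1 (le_refl |b - d|)
      have ha : |a| ≤ (|a + b + c + d| + |a - b + c - d|) / 4 + |a - c| / 2 :=
        abs_le.2 ⟨by linarith, by linarith⟩
      have hb : |b| ≤ (|a + b + c + d| + |a - b + c - d|) / 4 + |b - d| / 2 :=
        abs_le.2 ⟨by linarith, by linarith⟩
      have hc : |c| ≤ (|a + b + c + d| + |a - b + c - d|) / 4 + |a - c| / 2 :=
        abs_le.2 ⟨by linarith, by linarith⟩
      have hd : |d| ≤ (|a + b + c + d| + |a - b + c - d|) / 4 + |b - d| / 2 :=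
        abs_le.2 ⟨by linarith, by linarith⟩
      linarith
    · have b0 := abs_mul_le_mul hν (le_refl |x₀ s|)
      have b1 := abs_mul_le_mul hν (le_refl |x₁ s|)
      have b2 := abs_mul_le_mul hν (le_refl |x₂ s|)
      have b3 := abs_mul_le_mul hν (le_refl |x₃ s|)
      linarith
  refine ⟨fun s hs' => ?_, fun s hs' => ?_, fun s hs' => ?_, fun s hs' => ?_, fun s hs' => ?_,
    fun s hs' => ?_, fun s hs' => ?_, fun s hs' => ?_⟩
  · refine ((((h.3 s hs').add (h.4 s hs')).add (h.5 s hs')).add (h.6 s hs')).congr_deriv ?_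
    ring
  · refine ((((h.3 s hs').sub (h.4 s hs')).add (h.5 s hs')).sub (h.6 s hs')).congr_deriv ?_
    ring
  · refine ((h.3 s hs').sub (h.5 s hs')).congr_deriv ?_
    ring
  · refine ((h.4 s hs').sub (h.6 s hs')).congr_deriv ?_
    ring
  all_goals
    obtain ⟨ν, R, n, hν, hR, a0, a1, a2, a3, aR, an, hn, hsum⟩ := aux s hs'
    refine le_trans ?_ hn
    simp only [← hν, ← hR]
    obtain ⟨b0, b0'⟩ := abs_le.1 a0
    obtain ⟨b1, b1'⟩ := abs_le.1 a1
    obtain ⟨b2, b2'⟩ := abs_le.1 a2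
    obtain ⟨b3, b3'⟩ := abs_le.1 a3
    obtain ⟨bR, bR'⟩ := abs_le.1 aR
    have hK := forceConst_pos α β
    have hKn : 0 ≤ forceConst α β * δ * n := by
      rw [mul_assoc]; positivity
    rw [abs_le]
    constructor <;> linarith

end ReducedFlow

/-! ### Oscillatory flows: dichotomy, amplitude and rotation -/

/-- A flow near the equilibrium in which the oscillatory components dominate. -/
structure OscillatoryFlow (α β S : ℝ) (H x₀ x₁ x₂ x₃ : ℝ → ℝ) : Prop
    extends ReducedFlow α β S H x₀ x₁ x₂ x₃ where
  small : ∀ s, S ≤ s → FlowSmall H x₀ x₁ x₂ x₃ (1 / (100000 * (forceConst α β + 10))) s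
  sq_q_lt : ∀ s, S ≤ s →
    100 * (x₀ s - x₁ s + x₂ s - x₃ s) ^ 2 < (x₀ s - x₂ s) ^ 2 + (x₁ s - x₃ s) ^ 2

/-- With the smallness threshold of `OscillatoryFlow`, the relative error in `nearLinearFlow`
becomes `1 / 100000`. -/
theorem forceConst_add_ten_mul (α β : ℝ) :
    (forceConst α β + 10) * (1 / (100000 * (forceConst α β + 10))) = 1 / 100000 := by
  have := forceConst_pos α β
  field_simp

theorem smallConst_pos (α β : ℝ) : 0 < 1 / (100000 * (forceConst α β + 10)) := by
  have := forceConst_pos α β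
  positivity

theorem smallConst_le (α β : ℝ) : 1 / (100000 * (forceConst α β + 10)) ≤ 1 / 1000000 := by
  have := forceConst_pos α β
  exact one_div_le_one_div_of_le (by norm_num) (by linarith)

namespace ReducedFlow

variable {α β S : ℝ} {H x₀ x₁ x₂ x₃ : ℝ → ℝ}

theorem tendsto_p (h : ReducedFlow α β S H x₀ x₁ x₂ x₃) :
    Tendsto (fun s => x₀ s + x₁ s + x₂ s + x₃ s) atTop (𝓝 0) := by
  simpa using ((h.tendsto_x₀.add h.tendsto_x₁).add h.tendsto_x₂).add h.tendsto_x₃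

/-- Either the flow is eventually dominated by its oscillatory components, or it decays
exponentially and `x₀` has a constant sign or vanishes. -/
theorem dichotomy (h : ReducedFlow α β S H x₀ x₁ x₂ x₃) :
    (∃ S', S ≤ S' ∧ OscillatoryFlow α β S' H x₀ x₁ x₂ x₃) ∨
    (∃ S', S ≤ S' ∧ (∃ C, ∀ s, S' ≤ s → |x₀ s| ≤ C * Real.exp (-s / 2) ∧
        |x₁ s| ≤ C * Real.exp (-s / 2) ∧ |x₂ s| ≤ C * Real.exp (-s / 2) ∧
        |x₃ s| ≤ C * Real.exp (-s / 2)) ∧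
      ((∀ s, S' ≤ s → x₀ s = 0 ∧ x₁ s = 0 ∧ x₂ s = 0 ∧ x₃ s = 0) ∨
        (∀ s, S' ≤ s → 0 < x₀ s) ∨ (∀ s, S' ≤ s → x₀ s < 0))) := by
  obtain ⟨S₁, hS₁, hsm⟩ := h.eventually_small (smallConst_pos α β)
  have h' := h.mono hS₁
  have hn := h'.nearLinearFlow ((smallConst_le α β).trans (by norm_num)) hsm
  rw [forceConst_add_ten_mul] at hn
  -- The cone `100 q² < c₁² + c₂²` is never left once entered. If it is never entered, the centre
  -- part is dominated by `q` at all times.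
  by_cases hq : ∃ s, S₁ ≤ s ∧
      100 * (x₀ s - x₁ s + x₂ s - x₃ s) ^ 2 < (x₀ s - x₂ s) ^ 2 + (x₁ s - x₃ s) ^ 2
  · left
    obtain ⟨a, ha, hlt⟩ := hq
    exact ⟨a, hS₁.trans ha, h'.mono ha, fun s hs => hsm s (ha.trans hs), fun s hs =>
      hn.sq_q_lt_of_sq_q_lt (by norm_num) (by norm_num) h.tendsto_p ha hs hlt⟩
  · right
    push Not at hq
    have hc := fun s hs => hn.center_le_of_forall_le (by norm_num) (by norm_num) h.tendsto_p
      (by simpa using h.tendsto_x₀.sub h.tendsto_x₂)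
      (by simpa using h.tendsto_x₁.sub h.tendsto_x₃) hq (s := s) hs
    have hp := fun s hs => hn.sq_p_le (by norm_num) (by norm_num) h.tendsto_p (s := s) hs
    obtain ⟨⟨C, hC⟩, hsign⟩ := hn.decay_of_center_le (by norm_num) (by norm_num) h.tendsto_p hc
    -- In `x₀ = q/4 + p/4 + c₁/2` the last two terms add up to at most `(1/20 + 1/8) |q| < |q|/4`,
    -- so `x₀` inherits the sign of `q`.
    have hb : ∀ s, S₁ ≤ s → ∃ p q c₁ c₂ : ℝ, q = x₀ s - x₁ s + x₂ s - x₃ s ∧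
        |q| ≤ C * Real.exp (-s / 2) ∧ |p| ≤ 1 / 5 * |q| ∧ |c₁| ≤ 1 / 4 * |q| ∧
        |c₂| ≤ 1 / 4 * |q| ∧
        x₀ s = (p + q) / 4 + c₁ / 2 ∧ x₁ s = (p - q) / 4 + c₂ / 2 ∧
        x₂ s = (p + q) / 4 - c₁ / 2 ∧ x₃ s = (p - q) / 4 - c₂ / 2 := by
      intro s hs
      have h1 := hc s hs
      have h2 := hp s hs
      refine ⟨x₀ s + x₁ s + x₂ s + x₃ s, _, x₀ s - x₂ s, x₁ s - x₃ s, rfl, hC s hs, ?_, ?_, ?_,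
        by ring, by ring, by ring, by ring⟩
      · exact abs_le_mul_of_sq_le (by norm_num)
          (by nlinarith [sq_nonneg (x₀ s - x₁ s + x₂ s - x₃ s)])
      · exact abs_le_mul_of_sq_le (by norm_num) (by nlinarith [sq_nonneg (x₁ s - x₃ s)])
      · exact abs_le_mul_of_sq_le (by norm_num) (by nlinarith [sq_nonneg (x₀ s - x₂ s)])
    refine ⟨S₁, hS₁, ⟨C, fun s hs => ?_⟩, ?_⟩
    · obtain ⟨p, q, c₁, c₂, -, hq', hp', h1, h2, e0, e1, e2, e3⟩ := hb s hs
      have tri : ∀ {a b c : ℝ}, |b| ≤ C * Real.exp (-s / 2) → |a| ≤ 1 / 5 * |b| →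
          |c| ≤ 1 / 4 * |b| → |(a + b) / 4 + c / 2| ≤ C * Real.exp (-s / 2) := by
        intro a b c hb ha hc
        have hb' := abs_le.1 (le_refl |b|)
        have ha' := abs_le.1 ha
        have hc' := abs_le.1 hc
        have h0 := abs_nonneg b
        refine (abs_le.2 ⟨?_, ?_⟩ : _ ≤ |b|).trans hb <;> linarith
      rw [e0, e1, e2, e3]
      refine ⟨tri hq' hp' h1, ?_, ?_, ?_⟩
      · rw [sub_eq_add_neg p q]
        exact tri (by rwa [abs_neg]) (by rwa [abs_neg]) (by rwa [abs_neg])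
      · have := tri hq' hp' (by rwa [abs_neg] : |-c₁| ≤ _)
        rwa [neg_div, ← sub_eq_add_neg] at this
      · have := tri (a := p) (b := -q) (c := -c₂) (by rwa [abs_neg]) (by rwa [abs_neg])
          (by rwa [abs_neg, abs_neg])
        rwa [neg_div, ← sub_eq_add_neg, ← sub_eq_add_neg] at this
    · rcases hsign with hz | hz | hz
      · left
        intro s hs
        obtain ⟨p, q, c₁, c₂, hq0, hq', hp', h1, h2, e0, e1, e2, e3⟩ := hb s hs
        have hq0 : q = 0 := hq0.trans (hz s hs)
        rw [hq0, abs_zero, mul_zero] at hp' h1 h2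
        rw [abs_nonpos_iff] at hp' h1 h2
        rw [e0, e1, e2, e3, hq0, hp', h1, h2]
        simp
      · right; left
        intro s hs
        obtain ⟨p, q, c₁, c₂, hq0, hq', hp', h1, h2, e0, e1, e2, e3⟩ := hb s hs
        have hq0 : 0 < q := hq0 ▸ hz s hs
        rw [abs_of_pos hq0] at hp' h1
        rw [e0]
        linarith [(abs_le.1 hp').1, (abs_le.1 h1).1]
      · right; right
        intro s hs
        obtain ⟨p, q, c₁, c₂, hq0, hq', hp', h1, h2, e0, e1, e2, e3⟩ := hb s hs
        have hq0 : q < 0 := hq0 ▸ hz s hs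
        rw [abs_of_neg hq0] at hp' h1
        rw [e0]
        linarith [(abs_le.1 hp').2, (abs_le.1 h1).2]

end ReducedFlow

/-- The squared amplitude of the oscillatory components. -/
def sqAmp (x₀ x₁ x₂ x₃ : ℝ → ℝ) (s : ℝ) : ℝ := (x₀ s - x₂ s) ^ 2 + (x₁ s - x₃ s) ^ 2

/-- The amplitude of the oscillatory components. -/
noncomputable def amp (x₀ x₁ x₂ x₃ : ℝ → ℝ) (s : ℝ) : ℝ := √(sqAmp x₀ x₁ x₂ x₃ s)

namespace OscillatoryFlow

variable {α β S : ℝ} {H x₀ x₁ x₂ x₃ : ℝ → ℝ}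

theorem mono (h : OscillatoryFlow α β S H x₀ x₁ x₂ x₃) {S' : ℝ} (hS : S ≤ S') :
    OscillatoryFlow α β S' H x₀ x₁ x₂ x₃ :=
  ⟨h.toReducedFlow.mono hS, fun s hs => h.small s (hS.trans hs),
    fun s hs => h.sq_q_lt s (hS.trans hs)⟩

theorem small' (h : OscillatoryFlow α β S H x₀ x₁ x₂ x₃) {s : ℝ} (hs : S ≤ s) :
    FlowSmall H x₀ x₁ x₂ x₃ (1 / 1000000) s := by
  have := h.small s hs
  have hk := smallConst_le α β
  exact ⟨this.1.trans hk, this.2.trans hk, this.3.trans hk, this.4.trans hk, this.5.trans hk,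
    this.6.trans hk⟩

theorem le_time (h : OscillatoryFlow α β S H x₀ x₁ x₂ x₃) : 1000 ≤ S := by
  have := (h.small' le_rfl).damp_le
  have h0 := h.pos
  rw [div_le_div_iff₀ (by positivity) (by norm_num)] at this
  linarith

theorem near (h : OscillatoryFlow α β S H x₀ x₁ x₂ x₃) :
    NearLinearFlow (1 / 100000) S
      (fun s => x₀ s + x₁ s + x₂ s + x₃ s) (fun s => x₀ s - x₁ s + x₂ s - x₃ s)
      (fun s => x₀ s - x₂ s) (fun s => x₁ s - x₃ s)
      (fun s => -(1 / (5 * s)) * x₀ s - 2 * (1 / (5 * s)) * x₁ s - 3 * (1 / (5 * s)) * x₂ s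
        + (reducedForce α β (H s) (x₀ s) (x₁ s) (x₂ s) (x₃ s) - x₀ s - 4 * (1 / (5 * s)) * x₃ s))
      (fun s => -(1 / (5 * s)) * x₀ s + 2 * (1 / (5 * s)) * x₁ s - 3 * (1 / (5 * s)) * x₂ s
        - (reducedForce α β (H s) (x₀ s) (x₁ s) (x₂ s) (x₃ s) - x₀ s - 4 * (1 / (5 * s)) * x₃ s))
      (fun s => -(1 / (5 * s)) * x₀ s + 3 * (1 / (5 * s)) * x₂ s)
      (fun s => -(2 * (1 / (5 * s))) * x₁ s
        - (reducedForce α β (H s) (x₀ s) (x₁ s) (x₂ s) (x₃ s) - x₀ s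
          - 4 * (1 / (5 * s)) * x₃ s)) := by
  have := h.toReducedFlow.nearLinearFlow ((smallConst_le α β).trans (by norm_num)) h.small
  rwa [forceConst_add_ten_mul] at this

theorem sqAmp_pos (h : OscillatoryFlow α β S H x₀ x₁ x₂ x₃) {s : ℝ} (hs : S ≤ s) :
    0 < sqAmp x₀ x₁ x₂ x₃ s :=
  (by positivity : (0 : ℝ) ≤ 100 * (x₀ s - x₁ s + x₂ s - x₃ s) ^ 2).trans_lt (h.sq_q_lt s hs)

theorem amp_pos (h : OscillatoryFlow α β S H x₀ x₁ x₂ x₃) {s : ℝ} (hs : S ≤ s) :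
    0 < amp x₀ x₁ x₂ x₃ s := Real.sqrt_pos.2 (h.sqAmp_pos hs)

theorem sq_amp (h : OscillatoryFlow α β S H x₀ x₁ x₂ x₃) {s : ℝ} (hs : S ≤ s) :
    amp x₀ x₁ x₂ x₃ s ^ 2 = (x₀ s - x₂ s) ^ 2 + (x₁ s - x₃ s) ^ 2 :=
  Real.sq_sqrt (h.sqAmp_pos hs).le

/-- All components are controlled by the amplitude. -/
theorem components_le (h : OscillatoryFlow α β S H x₀ x₁ x₂ x₃) {s : ℝ} (hs : S ≤ s) :
    |x₀ s + x₁ s + x₂ s + x₃ s| ≤ 11 / 100 * amp x₀ x₁ x₂ x₃ s ∧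
    |x₀ s - x₁ s + x₂ s - x₃ s| ≤ 1 / 10 * amp x₀ x₁ x₂ x₃ s ∧
    |x₀ s - x₂ s| ≤ amp x₀ x₁ x₂ x₃ s ∧ |x₁ s - x₃ s| ≤ amp x₀ x₁ x₂ x₃ s := by
  have hr := h.amp_pos hs
  have hr2 := h.sq_amp hs
  have hq := h.sq_q_lt s hs
  have hp := h.near.sq_p_le (by norm_num) (by norm_num) h.tendsto_p hs
  refine ⟨abs_le_of_sq_le_sq ?_ (by positivity), abs_le_of_sq_le_sq ?_ (by positivity),
    abs_le_of_sq_le_sq ?_ hr.le, abs_le_of_sq_le_sq ?_ hr.le⟩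
  · nlinarith
  · nlinarith
  · nlinarith [sq_nonneg (x₁ s - x₃ s)]
  · nlinarith [sq_nonneg (x₀ s - x₂ s)]

theorem x_le (h : OscillatoryFlow α β S H x₀ x₁ x₂ x₃) {s : ℝ} (hs : S ≤ s) :
    |x₀ s| ≤ amp x₀ x₁ x₂ x₃ s ∧ |x₁ s| ≤ amp x₀ x₁ x₂ x₃ s ∧
    |x₂ s| ≤ amp x₀ x₁ x₂ x₃ s ∧ |x₃ s| ≤ amp x₀ x₁ x₂ x₃ s := by
  have hr := h.amp_pos hs
  obtain ⟨hp, hq, h1, h2⟩ := h.components_le hs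
  rw [abs_le] at hp hq h1 h2
  refine ⟨abs_le.2 ⟨?_, ?_⟩, abs_le.2 ⟨?_, ?_⟩, abs_le.2 ⟨?_, ?_⟩, abs_le.2 ⟨?_, ?_⟩⟩ <;> linarith

/-- The total size of the components. -/
theorem total_le (h : OscillatoryFlow α β S H x₀ x₁ x₂ x₃) {s : ℝ} (hs : S ≤ s) :
    1 / 100000 * (|x₀ s + x₁ s + x₂ s + x₃ s| + |x₀ s - x₁ s + x₂ s - x₃ s| + |x₀ s - x₂ s|
      + |x₁ s - x₃ s|) ≤ 3 / 100000 * amp x₀ x₁ x₂ x₃ s := by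
  have hr := h.amp_pos hs
  obtain ⟨hp, hq, h1, h2⟩ := h.components_le hs
  linarith

/-- Rotation leaves the amplitude unchanged, and the errors are a tiny multiple of it; so the
amplitude varies only slowly, in both directions. -/
theorem sqAmp_growth (h : OscillatoryFlow α β S H x₀ x₁ x₂ x₃) {a b : ℝ} (ha : S ≤ a)
    (hab : a ≤ b) :
    sqAmp x₀ x₁ x₂ x₃ b ≤ sqAmp x₀ x₁ x₂ x₃ a * Real.exp (1 / 1000 * (b - a)) ∧
    sqAmp x₀ x₁ x₂ x₃ a * Real.exp (-(1 / 1000) * (b - a)) ≤ sqAmp x₀ x₁ x₂ x₃ b := by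
  have key : ∀ x ∈ Icc a b, ∃ D, HasDerivAt (sqAmp x₀ x₁ x₂ x₃) D x ∧
      |D| ≤ 1 / 1000 * sqAmp x₀ x₁ x₂ x₃ x := by
    intro x hx
    have hx' := ha.trans hx.1
    refine ⟨_, h.near.hasDerivAt_center hx', ?_⟩
    obtain ⟨hp, hq, h1, h2⟩ := h.components_le hx'
    have t1 := abs_mul_le_mul h1 ((h.near.e₁_le x hx').trans (h.total_le hx'))
    have t2 := abs_mul_le_mul h2 ((h.near.e₂_le x hx').trans (h.total_le hx'))
    have e : sqAmp x₀ x₁ x₂ x₃ x = amp x₀ x₁ x₂ x₃ x * amp x₀ x₁ x₂ x₃ x := by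
      rw [← sq, h.sq_amp hx', sqAmp]
    rw [e]
    rw [abs_le] at t1 t2 ⊢
    have := h.amp_pos hx'
    have hpos := mul_pos this this
    constructor <;> linarith
  choose! D hD hDle using key
  exact ⟨le_mul_exp_of_hasDerivAt_le hab hD fun x hx => (abs_le.1 (hDle x hx)).2,
    mul_exp_le_of_le_hasDerivAt hab hD fun x hx => by
      have := (abs_le.1 (hDle x hx)).1; linarith⟩

theorem amp_growth (h : OscillatoryFlow α β S H x₀ x₁ x₂ x₃) {a b : ℝ} (ha : S ≤ a)
    (hab : a ≤ b) :
    amp x₀ x₁ x₂ x₃ b ≤ amp x₀ x₁ x₂ x₃ a * Real.exp (1 / 2000 * (b - a)) ∧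
    amp x₀ x₁ x₂ x₃ a ≤ amp x₀ x₁ x₂ x₃ b * Real.exp (1 / 2000 * (b - a)) := by
  obtain ⟨h1, h2⟩ := h.sqAmp_growth ha hab
  have ra := h.amp_pos ha
  have rb := h.amp_pos (ha.trans hab)
  have ea := h.sq_amp ha
  have eb := h.sq_amp (ha.trans hab)
  have e : Real.exp (1 / 2000 * (b - a)) ^ 2 = Real.exp (1 / 1000 * (b - a)) := by
    rw [← Real.exp_nat_mul]; congr 1; push_cast; ring
  constructor
  · refine le_of_sq_le_sq ?_ (by positivity)
    rw [mul_pow, ea, eb, e]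
    exact h1
  · refine le_of_sq_le_sq ?_ (by positivity)
    rw [mul_pow, ea, eb, e]
    calc _ = sqAmp x₀ x₁ x₂ x₃ a * Real.exp (-(1 / 1000) * (b - a))
            * Real.exp (1 / 1000 * (b - a)) := by
          rw [mul_assoc, ← Real.exp_add, sqAmp]; ring_nf; simp
      _ ≤ sqAmp x₀ x₁ x₂ x₃ b * Real.exp (1 / 1000 * (b - a)) := by gcongr

theorem exp_step_le {y : ℝ} (hy : y ≤ 12) : Real.exp (1 / 2000 * y) ≤ 101 / 100 := by
  calc Real.exp (1 / 2000 * y) ≤ Real.exp (6 / 1000) := Real.exp_le_exp.2 (by linarith)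
    _ ≤ 101 / 100 := by
      have := Real.exp_bound_div_one_sub_of_interval (x := 6 / 1000) (by norm_num) (by norm_num)
      exact this.trans (by norm_num)

/-- Twelve is the largest time step that `exists_step` makes; over such a step the amplitude is
constant up to one percent. -/
theorem amp_step (h : OscillatoryFlow α β S H x₀ x₁ x₂ x₃) {a b : ℝ} (ha : S ≤ a)
    (hab : a ≤ b) (hb : b ≤ a + 12) :
    amp x₀ x₁ x₂ x₃ b ≤ 101 / 100 * amp x₀ x₁ x₂ x₃ a ∧
    amp x₀ x₁ x₂ x₃ a ≤ 101 / 100 * amp x₀ x₁ x₂ x₃ b := by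
  obtain ⟨h1, h2⟩ := h.amp_growth ha hab
  have ra := h.amp_pos ha
  have rb := h.amp_pos (ha.trans hab)
  have := exp_step_le (y := b - a) (by linarith)
  constructor <;> nlinarith

/-- Over a bounded time the oscillatory components rotate rigidly, up to a small error. -/
theorem rotation (h : OscillatoryFlow α β S H x₀ x₁ x₂ x₃) {a y : ℝ} (ha : S ≤ a) (hy : 0 ≤ y)
    (hy' : y ≤ 6) :
    |x₀ (a + y) - x₂ (a + y) - ((x₀ a - x₂ a) * Real.cos y + (x₁ a - x₃ a) * Real.sin y)|
      ≤ 1 / 1000 * amp x₀ x₁ x₂ x₃ a ∧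
    |x₁ (a + y) - x₃ (a + y) - ((x₁ a - x₃ a) * Real.cos y - (x₀ a - x₂ a) * Real.sin y)|
      ≤ 1 / 1000 * amp x₀ x₁ x₂ x₃ a := by
  have ra := h.amp_pos ha
  have hr : ∀ t ∈ Icc (0 : ℝ) y, amp x₀ x₁ x₂ x₃ (a + t) ≤ 101 / 100 * amp x₀ x₁ x₂ x₃ a :=
    fun t ht => (h.amp_step ha (by linarith [ht.1]) (by linarith [ht.2])).1
  have hn := h.near
  set c₁ := fun s => x₀ s - x₂ s with hc₁
  set c₂ := fun s => x₁ s - x₃ s with hc₂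
  obtain ⟨e₁, d1, b1⟩ : ∃ e₁ : ℝ → ℝ, (∀ s, S ≤ s → HasDerivAt c₁ (c₂ s + e₁ s) s) ∧
      ∀ s, S ≤ s → |e₁ s| ≤ 3 / 100000 * amp x₀ x₁ x₂ x₃ s :=
    ⟨_, hn.hasDerivAt_c₁, fun s hs => (hn.e₁_le s hs).trans (h.total_le hs)⟩
  obtain ⟨e₂, d2, b2⟩ : ∃ e₂ : ℝ → ℝ, (∀ s, S ≤ s → HasDerivAt c₂ (-c₁ s + e₂ s) s) ∧
      ∀ s, S ≤ s → |e₂ s| ≤ 3 / 100000 * amp x₀ x₁ x₂ x₃ s :=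
    ⟨_, hn.hasDerivAt_c₂, fun s hs => (hn.e₂_le s hs).trans (h.total_le hs)⟩
  have sh : ∀ t ∈ Icc (0 : ℝ) y, HasDerivAt (fun t => c₁ (a + t)) (c₂ (a + t) + e₁ (a + t)) t ∧
      HasDerivAt (fun t => c₂ (a + t)) (-c₁ (a + t) + e₂ (a + t)) t := by
    intro t ht
    have hat : S ≤ a + t := by linarith [ht.1]
    exact ⟨(d1 _ hat).comp_const_add a t, (d2 _ hat).comp_const_add a t⟩
  -- In the rotating frame, `c₁ cos - c₂ sin` and `c₁ sin + c₂ cos` have only error terms as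
  -- derivatives. Over time at most `6` each drifts by at most `42 / 100000` of the amplitude.
  have u1 := abs_sub_le_of_hasDerivAt hy
    (fun t ht => ((sh t ht).1.mul (Real.hasDerivAt_cos t)).sub
      ((sh t ht).2.mul (Real.hasDerivAt_sin t))) (M := 7 / 100000 * amp x₀ x₁ x₂ x₃ a) (by
    intro t ht
    have hat : S ≤ a + t := by linarith [ht.1]
    have i1 := abs_mul_le_mul ((b1 _ hat).trans (mul_le_mul_of_nonneg_left (hr t ht)
      (by norm_num))) (Real.abs_cos_le_one t)
    have i2 := abs_mul_le_mul ((b2 _ hat).trans (mul_le_mul_of_nonneg_left (hr t ht)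
      (by norm_num))) (Real.abs_sin_le_one t)
    rw [abs_le] at i1 i2 ⊢
    constructor <;> nlinarith)
  have u2 := abs_sub_le_of_hasDerivAt hy
    (fun t ht => ((sh t ht).1.mul (Real.hasDerivAt_sin t)).add
      ((sh t ht).2.mul (Real.hasDerivAt_cos t))) (M := 7 / 100000 * amp x₀ x₁ x₂ x₃ a) (by
    intro t ht
    have hat : S ≤ a + t := by linarith [ht.1]
    have i1 := abs_mul_le_mul ((b1 _ hat).trans (mul_le_mul_of_nonneg_left (hr t ht)
      (by norm_num))) (Real.abs_sin_le_one t)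
    have i2 := abs_mul_le_mul ((b2 _ hat).trans (mul_le_mul_of_nonneg_left (hr t ht)
      (by norm_num))) (Real.abs_cos_le_one t)
    rw [abs_le] at i1 i2 ⊢
    constructor <;> nlinarith)
  simp only [Pi.sub_apply, Pi.add_apply, Pi.mul_apply, add_zero, Real.cos_zero, Real.sin_zero,
    mul_zero, mul_one, sub_zero, zero_add] at u1 u2
  have hcs := Real.sin_sq_add_cos_sq y
  have f1 := abs_mul_le_mul u1 (Real.abs_cos_le_one y)
  have f2 := abs_mul_le_mul u2 (Real.abs_sin_le_one y)
  have f3 := abs_mul_le_mul u1 (Real.abs_sin_le_one y)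
  have f4 := abs_mul_le_mul u2 (Real.abs_cos_le_one y)
  have hM : 7 / 100000 * amp x₀ x₁ x₂ x₃ a * (y - 0) ≤ 42 / 100000 * amp x₀ x₁ x₂ x₃ a := by
    nlinarith
  change |c₁ (a + y) - (c₁ a * Real.cos y + c₂ a * Real.sin y)| ≤ _ ∧
    |c₂ (a + y) - (c₂ a * Real.cos y - c₁ a * Real.sin y)| ≤ _
  have g1 : c₁ (a + y) - (c₁ a * Real.cos y + c₂ a * Real.sin y) =
      (c₁ (a + y) * Real.cos y - c₂ (a + y) * Real.sin y - c₁ a) * Real.cos y +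
      (c₁ (a + y) * Real.sin y + c₂ (a + y) * Real.cos y - c₂ a) * Real.sin y := by
    linear_combination (-c₁ (a + y)) * hcs
  have g2 : c₂ (a + y) - (c₂ a * Real.cos y - c₁ a * Real.sin y) =
      (c₁ (a + y) * Real.sin y + c₂ (a + y) * Real.cos y - c₂ a) * Real.cos y -
      (c₁ (a + y) * Real.cos y - c₂ (a + y) * Real.sin y - c₁ a) * Real.sin y := by
    linear_combination (-c₂ (a + y)) * hcs
  rw [g1, g2]
  rw [abs_le] at f1 f2 f3 f4 ⊢
  rw [abs_le]
  refine ⟨⟨?_, ?_⟩, ⟨?_, ?_⟩⟩ <;> linarith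

/-- The component `x₀ - x₂` vanishes in every time interval of length five. -/
theorem exists_zero (h : OscillatoryFlow α β S H x₀ x₁ x₂ x₃) {a : ℝ} (ha : S ≤ a) :
    ∃ y ∈ Icc (0 : ℝ) 5, x₀ (a + y) - x₂ (a + y) = 0 := by
  have ra := h.amp_pos ha
  have hr2 := h.sq_amp ha
  have hpi := Real.pi_gt_three
  have hpi' := Real.pi_lt_d2
  have hc : ContinuousOn (fun y => x₀ (a + y) - x₂ (a + y)) (Icc 0 5) := fun y hy =>
    ((h.near.hasDerivAt_c₁ (a + y) (by linarith [hy.1])).comp_const_add a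
      y).continuousAt.continuousWithinAt
  have ivt : ∀ u v : ℝ, 0 ≤ u → u ≤ v → v ≤ 5 →
      (x₀ (a + u) - x₂ (a + u)) * (x₀ (a + v) - x₂ (a + v)) ≤ 0 →
      ∃ y ∈ Icc (0 : ℝ) 5, x₀ (a + y) - x₂ (a + y) = 0 := by
    intro u v hu huv hv hle
    have hc' := hc.mono (Icc_subset_Icc hu hv)
    rcases le_total 0 (x₀ (a + u) - x₂ (a + u)) with hp | hp
    · rcases le_total (x₀ (a + v) - x₂ (a + v)) 0 with hp' | hp'
      · obtain ⟨y, hy, h0⟩ := intermediate_value_Icc' huv hc' ⟨hp', hp⟩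
        exact ⟨y, Icc_subset_Icc hu hv hy, h0⟩
      · rcases mul_eq_zero.1 (le_antisymm hle (mul_nonneg hp hp')) with h0 | h0
        · exact ⟨u, ⟨hu, huv.trans hv⟩, h0⟩
        · exact ⟨v, ⟨hu.trans huv, hv⟩, h0⟩
    · rcases le_total 0 (x₀ (a + v) - x₂ (a + v)) with hp' | hp'
      · obtain ⟨y, hy, h0⟩ := intermediate_value_Icc huv hc' ⟨hp, hp'⟩
        exact ⟨y, Icc_subset_Icc hu hv hy, h0⟩
      · rcases mul_eq_zero.1 (le_antisymm hle (mul_nonneg_of_nonpos_of_nonpos hp hp')) with h0 | h0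
        · exact ⟨u, ⟨hu, huv.trans hv⟩, h0⟩
        · exact ⟨v, ⟨hu.trans huv, hv⟩, h0⟩
  have rot := fun y hy hy' => (h.rotation ha (y := y) hy hy').1
  have r1 := rot Real.pi (by linarith) (by linarith)
  have r2 := rot (Real.pi / 2) (by linarith) (by linarith)
  have r3 := rot (3 * Real.pi / 2) (by linarith) (by linarith)
  have e3 : Real.sin (3 * Real.pi / 2) = -1 := by
    rw [show 3 * Real.pi / 2 = Real.pi / 2 + Real.pi by ring, Real.sin_add_pi, Real.sin_pi_div_two]
  have e3' : Real.cos (3 * Real.pi / 2) = 0 := by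
    rw [show 3 * Real.pi / 2 = Real.pi / 2 + Real.pi by ring, Real.cos_add_pi, Real.cos_pi_div_two,
      neg_zero]
  simp only [Real.cos_pi, Real.sin_pi] at r1
  simp only [Real.cos_pi_div_two, Real.sin_pi_div_two] at r2
  simp only [e3, e3'] at r3
  rw [abs_le] at r1 r2 r3
  -- If `x₀ - x₂` carries at least half the amplitude, it changes sign within time `π`. Otherwise
  -- `x₁ - x₃` does, and then `x₀ - x₂` has opposite signs at `π/2` and `3π/2 < 5`.
  by_cases hb : 1 / 2 * amp x₀ x₁ x₂ x₃ a ≤ |x₀ a - x₂ a|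
  · refine ivt 0 Real.pi le_rfl (by linarith) (by linarith) ?_
    rw [add_zero]
    rcases le_abs.1 hb with hb' | hb'
    · exact mul_nonpos_of_nonneg_of_nonpos (by linarith) (by linarith)
    · exact mul_nonpos_of_nonpos_of_nonneg (by linarith) (by linarith)
  · rw [not_le, abs_lt] at hb
    have h2 : 1 / 2 * amp x₀ x₁ x₂ x₃ a ≤ |x₁ a - x₃ a| := by
      refine le_of_sq_le_sq ?_ (abs_nonneg _)
      rw [sq_abs]
      nlinarith
    refine ivt (Real.pi / 2) (3 * Real.pi / 2) (by linarith) (by linarith) (by linarith) ?_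
    rcases le_abs.1 h2 with hb' | hb'
    · exact mul_nonpos_of_nonneg_of_nonpos (by linarith) (by linarith)
    · exact mul_nonpos_of_nonpos_of_nonneg (by linarith) (by linarith)

end OscillatoryFlow

/-! ### Reflection estimates -/

/-- A forced, slightly perturbed linear system with eigenvalues `0, 1, -1, ±i` on `[0, Y]`. The
forcing is bounded by `ρ`, which grows at the rate `1 / 4`. -/
structure ForcedFlow (Y : ℝ) (p q c₁ c₂ d ρ ep eq e₁ e₂ : ℝ → ℝ) : Prop where
  hasDerivAt_p : ∀ y ∈ Icc 0 Y, HasDerivAt p (p y + ep y) y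
  hasDerivAt_q : ∀ y ∈ Icc 0 Y, HasDerivAt q (-q y + eq y) y
  hasDerivAt_c₁ : ∀ y ∈ Icc 0 Y, HasDerivAt c₁ (c₂ y + e₁ y) y
  hasDerivAt_c₂ : ∀ y ∈ Icc 0 Y, HasDerivAt c₂ (-c₁ y + e₂ y) y
  hasDerivAt_d : ∀ y ∈ Icc 0 Y, HasDerivAt d ((p y + q y) / 4 + c₁ y / 2) y
  hasDerivAt_ρ : ∀ y ∈ Icc 0 Y, HasDerivAt ρ (ρ y / 4) y
  ρ_nonneg : ∀ y ∈ Icc 0 Y, 0 ≤ ρ y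
  ep_le : ∀ y ∈ Icc 0 Y, |ep y| ≤ ρ y + 1 / 100000 * (|p y| + |q y| + |c₁ y| + |c₂ y| + |d y|)
  eq_le : ∀ y ∈ Icc 0 Y, |eq y| ≤ ρ y + 1 / 100000 * (|p y| + |q y| + |c₁ y| + |c₂ y| + |d y|)
  e₁_le : ∀ y ∈ Icc 0 Y, |e₁ y| ≤ ρ y + 1 / 100000 * (|p y| + |q y| + |c₁ y| + |c₂ y| + |d y|)
  e₂_le : ∀ y ∈ Icc 0 Y, |e₂ y| ≤ ρ y + 1 / 100000 * (|p y| + |q y| + |c₁ y| + |c₂ y| + |d y|)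

namespace ForcedFlow

variable {Y : ℝ} {p q c₁ c₂ d ρ ep eq e₁ e₂ : ℝ → ℝ}

/-- A growing component that is not controlled by the others and the forcing grows
exponentially. -/
theorem growth (h : ForcedFlow Y p q c₁ c₂ d ρ ep eq e₁ e₂) (hY : 0 ≤ Y)
    (h0 : (q 0 ^ 2 + c₁ 0 ^ 2 + c₂ 0 ^ 2) / 100 + d 0 ^ 2 / 10000 + 16 * ρ 0 ^ 2 < p 0 ^ 2) :
    p 0 ^ 2 * Real.exp (1 * (Y - 0)) ≤ p Y ^ 2 := by
  -- A cone argument as in `sq_p_le`, with the neutral direction `d` and the forcing included in the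
  -- cone. The forcing grows at rate `1/4`, more slowly than `p`, so it cannot catch up; inside the
  -- cone `p²` grows at rate at least one.
  have key : ∀ y ∈ Icc 0 Y,
      0 < p y ^ 2 - (q y ^ 2 + c₁ y ^ 2 + c₂ y ^ 2) / 100 - d y ^ 2 / 10000 - 16 * ρ y ^ 2 →
      1 * p y ^ 2 ≤ 2 * p y * (p y + ep y) ∧
      0 ≤ 2 * p y * (p y + ep y) - (2 * q y * (-q y + eq y) + 2 * c₁ y * (c₂ y + e₁ y)
        + 2 * c₂ y * (-c₁ y + e₂ y)) / 100 - 2 * d y * ((p y + q y) / 4 + c₁ y / 2) / 10000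
        - 16 * (2 * ρ y * (ρ y / 4)) := by
    intro y hy hV
    have hq : |q y| ≤ 10 * |p y| := abs_le_mul_of_sq_le (by norm_num)
      (by linarith [sq_nonneg (c₁ y), sq_nonneg (c₂ y), sq_nonneg (d y), sq_nonneg (ρ y)])
    have h1 : |c₁ y| ≤ 10 * |p y| := abs_le_mul_of_sq_le (by norm_num)
      (by linarith [sq_nonneg (q y), sq_nonneg (c₂ y), sq_nonneg (d y), sq_nonneg (ρ y)])
    have h2 : |c₂ y| ≤ 10 * |p y| := abs_le_mul_of_sq_le (by norm_num)
      (by linarith [sq_nonneg (q y), sq_nonneg (c₁ y), sq_nonneg (d y), sq_nonneg (ρ y)])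
    have hd : |d y| ≤ 100 * |p y| := abs_le_mul_of_sq_le (by norm_num)
      (by linarith [sq_nonneg (q y), sq_nonneg (c₁ y), sq_nonneg (c₂ y), sq_nonneg (ρ y)])
    have hρ : |ρ y| ≤ 1 / 4 * |p y| := abs_le_mul_of_sq_le (by norm_num)
      (by linarith [sq_nonneg (q y), sq_nonneg (c₁ y), sq_nonneg (c₂ y), sq_nonneg (d y)])
    have hn : ρ y + 1 / 100000 * (|p y| + |q y| + |c₁ y| + |c₂ y| + |d y|)
        ≤ 252 / 1000 * |p y| := by
      have := le_abs_self (ρ y)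
      linarith [abs_nonneg (p y)]
    have hx : |(p y + q y) / 4 + c₁ y / 2| ≤ 31 / 4 * |p y| := by
      have t0 := abs_le.1 (le_refl |p y|)
      have t1 := abs_le.1 hq
      have t2 := abs_le.1 h1
      exact abs_le.2 ⟨by linarith, by linarith⟩
    have a4 : |p y| * |p y| = p y ^ 2 := by rw [← sq, sq_abs]
    have aρ : |ρ y| * |ρ y| = ρ y ^ 2 := by rw [← sq, sq_abs]
    have a0 := (abs_le.1 (abs_mul_le_mul (le_refl |p y|) ((h.ep_le y hy).trans hn))).1
    have a1 := (abs_le.1 (abs_mul_le_mul hq ((h.eq_le y hy).trans hn))).2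
    have a2 := (abs_le.1 (abs_mul_le_mul h1 ((h.e₁_le y hy).trans hn))).2
    have a3 := (abs_le.1 (abs_mul_le_mul h2 ((h.e₂_le y hy).trans hn))).2
    have a5 := (abs_le.1 (abs_mul_le_mul hd hx)).2
    have a6 := mul_le_mul hρ hρ (abs_nonneg _) (by positivity)
    have hp2 := sq_nonneg (p y)
    have hq2 := sq_nonneg (q y)
    constructor <;> nlinarith
  have dW : ∀ y ∈ Icc 0 Y, HasDerivAt
      (fun y => p y ^ 2 - (q y ^ 2 + c₁ y ^ 2 + c₂ y ^ 2) / 100 - d y ^ 2 / 10000 - 16 * ρ y ^ 2)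
      (2 * p y * (p y + ep y) - (2 * q y * (-q y + eq y) + 2 * c₁ y * (c₂ y + e₁ y)
        + 2 * c₂ y * (-c₁ y + e₂ y)) / 100 - 2 * d y * ((p y + q y) / 4 + c₁ y / 2) / 10000
        - 16 * (2 * ρ y * (ρ y / 4))) y := by
    intro y hy
    refine (((((h.1 y hy).pow 2).sub (((((h.2 y hy).pow 2).add ((h.3 y hy).pow 2)).add
      ((h.4 y hy).pow 2)).div_const 100)).sub (((h.5 y hy).pow 2).div_const 10000)).sub
      (((h.6 y hy).pow 2).const_mul 16)).congr_deriv ?_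
    push_cast
    ring
  have hpos : ∀ y ∈ Icc 0 Y,
      0 < p y ^ 2 - (q y ^ 2 + c₁ y ^ 2 + c₂ y ^ 2) / 100 - d y ^ 2 / 10000 - 16 * ρ y ^ 2 := by
    intro y hy
    have := le_of_pos_imp_hasDerivAt_nonneg hy.1 (fun x hx => dW x ⟨hx.1, hx.2.trans hy.2⟩)
      (by linarith) (fun x hx hx0 => (key x ⟨hx.1, hx.2.trans hy.2⟩ hx0).2)
    exact lt_of_lt_of_le (by linarith) this
  refine mul_exp_le_of_le_hasDerivAt (f := fun y => p y ^ 2)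
    (f' := fun y => 2 * p y * (p y + ep y)) hY (fun y hy => ?_)
    (fun y hy => (key y hy (hpos y hy)).1)
  refine ((h.1 y hy).pow 2).congr_deriv ?_
  push_cast
  ring

/-- The components grow at most exponentially. -/
theorem bounded (h : ForcedFlow Y p q c₁ c₂ d ρ ep eq e₁ e₂) {y : ℝ} (hy : y ∈ Icc 0 Y) :
    p y ^ 2 + q y ^ 2 + c₁ y ^ 2 + c₂ y ^ 2 + d y ^ 2 + ρ y ^ 2 ≤
      (p 0 ^ 2 + q 0 ^ 2 + c₁ 0 ^ 2 + c₂ 0 ^ 2 + d 0 ^ 2 + ρ 0 ^ 2)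
        * Real.exp (20 * (y - 0)) := by
  refine le_mul_exp_of_hasDerivAt_le (f := fun y => p y ^ 2 + q y ^ 2 + c₁ y ^ 2 + c₂ y ^ 2
    + d y ^ 2 + ρ y ^ 2) (f' := fun y => 2 * p y * (p y + ep y) + 2 * q y * (-q y + eq y)
      + 2 * c₁ y * (c₂ y + e₁ y) + 2 * c₂ y * (-c₁ y + e₂ y)
      + 2 * d y * ((p y + q y) / 4 + c₁ y / 2) + 2 * ρ y * (ρ y / 4)) hy.1
    (fun x hx => ?_) (fun x hx => ?_)
  · have hx' : x ∈ Icc 0 Y := ⟨hx.1, hx.2.trans hy.2⟩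
    refine (((((((h.1 x hx').pow 2).add ((h.2 x hx').pow 2)).add ((h.3 x hx').pow 2)).add
      ((h.4 x hx').pow 2)).add ((h.5 x hx').pow 2)).add ((h.6 x hx').pow 2)).congr_deriv ?_
    push_cast
    ring
  · have hx' : x ∈ Icc 0 Y := ⟨hx.1, hx.2.trans hy.2⟩
    have hρ := h.ρ_nonneg x hx'
    have a0 := abs_mul_le_mul (le_refl |p x|) (h.ep_le x hx')
    have a1 := abs_mul_le_mul (le_refl |q x|) (h.eq_le x hx')
    have a2 := abs_mul_le_mul (le_refl |c₁ x|) (h.e₁_le x hx')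
    have a3 := abs_mul_le_mul (le_refl |c₂ x|) (h.e₂_le x hx')
    set n := ρ x + 1 / 100000 * (|p x| + |q x| + |c₁ x| + |c₂ x| + |d x|) with hn
    have hn2 : n ^ 2 ≤ 2 * (p x ^ 2 + q x ^ 2 + c₁ x ^ 2 + c₂ x ^ 2 + d x ^ 2 + ρ x ^ 2) := by
      have hm : (|p x| + |q x| + |c₁ x| + |c₂ x| + |d x|) ^ 2
          ≤ 5 * (p x ^ 2 + q x ^ 2 + c₁ x ^ 2 + c₂ x ^ 2 + d x ^ 2) := by
        rw [← sq_abs (p x), ← sq_abs (q x), ← sq_abs (c₁ x), ← sq_abs (c₂ x), ← sq_abs (d x)]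
        generalize |p x| = a
        generalize |q x| = b
        generalize |c₁ x| = c
        generalize |c₂ x| = e
        generalize |d x| = f
        linarith [sq_nonneg (a - b), sq_nonneg (a - c), sq_nonneg (a - e), sq_nonneg (a - f),
          sq_nonneg (b - c), sq_nonneg (b - e), sq_nonneg (b - f), sq_nonneg (c - e),
          sq_nonneg (c - f), sq_nonneg (e - f)]
      rw [hn]
      generalize |p x| + |q x| + |c₁ x| + |c₂ x| + |d x| = m at hm
      nlinarith [sq_nonneg (ρ x - 1 / 100000 * m), sq_nonneg m]
    have y0 : ∀ a : ℝ, 2 * (|a| * n) ≤ a ^ 2 + n ^ 2 := by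
      intro a
      rw [← sq_abs a]
      nlinarith [sq_nonneg (|a| - n)]
    have y1 := y0 (p x)
    have y2 := y0 (q x)
    have y3 := y0 (c₁ x)
    have y4 := y0 (c₂ x)
    have b0 := (abs_le.1 a0).2
    have b1 := (abs_le.1 a1).2
    have b2 := (abs_le.1 a2).2
    have b3 := (abs_le.1 a3).2
    linarith [sq_nonneg (d x - p x), sq_nonneg (d x - q x), sq_nonneg (d x - c₁ x),
      sq_nonneg (p x), sq_nonneg (q x), sq_nonneg (c₁ x), sq_nonneg (c₂ x), sq_nonneg (d x),
      sq_nonneg (ρ x)]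

end ForcedFlow

/-- The constant of the reflection estimate. -/
noncomputable def reflConst : ℝ := 64 * Real.exp 60

theorem reflConst_pos : 0 < reflConst := by unfold reflConst; positivity

namespace OscillatoryFlow

variable {α β S : ℝ} {H x₀ x₁ x₂ x₃ : ℝ → ℝ}

/-- Reversibility: under time reflection the odd derivatives `x₀, x₂` of `H` change sign, the even
ones `x₁, x₃` do not, and the force is odd accordingly. Only the damping terms break this symmetry.
-/
theorem reducedForce_reflect (α β h a b c d : ℝ) :
    reducedForce α β h (-a) b (-c) d = -reducedForce α β h a b c d := by
  unfold reducedForce; ring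

/-- The damping coefficient on the time interval `[s₀ / 2, 3 s₀ / 2]`. -/
theorem damp_le {s₀ t : ℝ} (hs₀ : 0 < s₀) (ht : s₀ / 2 ≤ t) :
    |1 / (5 * t)| ≤ 2 / 5 * (1 / s₀) := by
  have : 0 < t := by linarith
  rw [abs_of_pos (by positivity)]
  calc 1 / (5 * t) ≤ 1 / (5 * (s₀ / 2)) := by gcongr
    _ = _ := by field_simp

/-- The difference between an oscillatory flow and its reflection at a zero of `x₀ - x₂`. -/
theorem forcedFlow_reflect (h : OscillatoryFlow α β S H x₀ x₁ x₂ x₃) {s₀ : ℝ}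
    (hs₀ : 2 * S ≤ s₀) :
    ∃ ep eq e₁ e₂ : ℝ → ℝ, ForcedFlow (s₀ / 2)
      (fun y => (x₀ (s₀ + y) + x₀ (s₀ - y)) + (x₁ (s₀ + y) - x₁ (s₀ - y))
        + (x₂ (s₀ + y) + x₂ (s₀ - y)) + (x₃ (s₀ + y) - x₃ (s₀ - y)))
      (fun y => (x₀ (s₀ + y) + x₀ (s₀ - y)) - (x₁ (s₀ + y) - x₁ (s₀ - y))
        + (x₂ (s₀ + y) + x₂ (s₀ - y)) - (x₃ (s₀ + y) - x₃ (s₀ - y)))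
      (fun y => (x₀ (s₀ + y) + x₀ (s₀ - y)) - (x₂ (s₀ + y) + x₂ (s₀ - y)))
      (fun y => (x₁ (s₀ + y) - x₁ (s₀ - y)) - (x₃ (s₀ + y) - x₃ (s₀ - y)))
      (fun y => H (s₀ + y) - H (s₀ - y))
      (fun y => 8 * (amp x₀ x₁ x₂ x₃ s₀ * (1 / s₀)) * Real.exp (1 / 4 * y)) ep eq e₁ e₂ := by
  have hS := h.pos
  have hs0 : 0 < s₀ := by linarith
  have hplus : ∀ {f f' : ℝ → ℝ} {y : ℝ}, HasDerivAt f (f' (s₀ + y)) (s₀ + y) →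
      HasDerivAt (fun y => f (s₀ + y)) (f' (s₀ + y)) y := fun hf => hf.comp_const_add _ _
  have hminus : ∀ {f f' : ℝ → ℝ} {y : ℝ}, HasDerivAt f (f' (s₀ - y)) (s₀ - y) →
      HasDerivAt (fun y => f (s₀ - y)) (-f' (s₀ - y)) y := fun hf => hf.comp_const_sub _ _
  -- By reversibility the sums and differences obey the linearized system again. The damping terms
  -- become the forcing: on this interval `1/(5t)` is at most `2/(5 s₀)`, which gives the size
  -- `amp/s₀`, and the rate `1/4` covers the slow growth of the amplitude on both sides.
  have key : ∀ y ∈ Icc 0 (s₀ / 2), ∃ f₀ f₁ f₂ f₃ : ℝ,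
      HasDerivAt (fun y => x₀ (s₀ + y) + x₀ (s₀ - y)) (x₁ (s₀ + y) - x₁ (s₀ - y) + f₀) y ∧
      HasDerivAt (fun y => x₁ (s₀ + y) - x₁ (s₀ - y)) (x₂ (s₀ + y) + x₂ (s₀ - y) + f₁) y ∧
      HasDerivAt (fun y => x₂ (s₀ + y) + x₂ (s₀ - y)) (x₃ (s₀ + y) - x₃ (s₀ - y) + f₂) y ∧
      HasDerivAt (fun y => x₃ (s₀ + y) - x₃ (s₀ - y)) (x₀ (s₀ + y) + x₀ (s₀ - y) + f₃) y ∧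
      |f₀| + |f₁| + |f₂| + |f₃| ≤ 8 * (amp x₀ x₁ x₂ x₃ s₀ * (1 / s₀)) * Real.exp (1 / 4 * y)
        + 1 / 100000 * (|H (s₀ + y) - H (s₀ - y)| + |x₀ (s₀ + y) + x₀ (s₀ - y)|
          + |x₁ (s₀ + y) - x₁ (s₀ - y)| + |x₂ (s₀ + y) + x₂ (s₀ - y)|
          + |x₃ (s₀ + y) - x₃ (s₀ - y)|) := by
    intro y hy
    have hp : S ≤ s₀ + y := by linarith [hy.1]
    have hm : S ≤ s₀ - y := by linarith [hy.2]
    refine ⟨_, _, _, _,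
      ((hplus (f' := fun s => x₁ s - 1 / (5 * s) * x₀ s) (h.hasDerivAt_x₀ _ hp)).add
        (hminus (f' := fun s => x₁ s - 1 / (5 * s) * x₀ s) (h.hasDerivAt_x₀ _ hm))).congr_deriv
        (show _ = _ + (-(1 / (5 * (s₀ + y)) * x₀ (s₀ + y))
          + 1 / (5 * (s₀ - y)) * x₀ (s₀ - y)) by ring),
      ((hplus (f' := fun s => x₂ s - 2 * (1 / (5 * s)) * x₁ s) (h.hasDerivAt_x₁ _ hp)).sub
        (hminus (f' := fun s => x₂ s - 2 * (1 / (5 * s)) * x₁ s)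
          (h.hasDerivAt_x₁ _ hm))).congr_deriv
        (show _ = _ + (-(2 * (1 / (5 * (s₀ + y)) * x₁ (s₀ + y)))
          - 2 * (1 / (5 * (s₀ - y)) * x₁ (s₀ - y))) by ring),
      ((hplus (f' := fun s => x₃ s - 3 * (1 / (5 * s)) * x₂ s) (h.hasDerivAt_x₂ _ hp)).add
        (hminus (f' := fun s => x₃ s - 3 * (1 / (5 * s)) * x₂ s)
          (h.hasDerivAt_x₂ _ hm))).congr_deriv
        (show _ = _ + (-(3 * (1 / (5 * (s₀ + y)) * x₂ (s₀ + y)))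
          + 3 * (1 / (5 * (s₀ - y)) * x₂ (s₀ - y))) by ring),
      ((hplus (f' := fun s => reducedForce α β (H s) (x₀ s) (x₁ s) (x₂ s) (x₃ s)
          - 4 * (1 / (5 * s)) * x₃ s) (h.hasDerivAt_x₃ _ hp)).sub
        (hminus (f' := fun s => reducedForce α β (H s) (x₀ s) (x₁ s) (x₂ s) (x₃ s)
          - 4 * (1 / (5 * s)) * x₃ s) (h.hasDerivAt_x₃ _ hm))).congr_deriv
        (show _ = _ + ((reducedForce α β (H (s₀ + y)) (x₀ (s₀ + y)) (x₁ (s₀ + y)) (x₂ (s₀ + y))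
            (x₃ (s₀ + y)) - reducedForce α β (H (s₀ - y)) (-x₀ (s₀ - y)) (x₁ (s₀ - y))
            (-x₂ (s₀ - y)) (x₃ (s₀ - y)) - (x₀ (s₀ + y) - -x₀ (s₀ - y)))
          - 4 * (1 / (5 * (s₀ + y)) * x₃ (s₀ + y)) - 4 * (1 / (5 * (s₀ - y)) * x₃ (s₀ - y))) by
          rw [reducedForce_reflect]; ring), ?_⟩
    have sp := h.small _ hp
    have sm := h.small _ hm
    have hR := reducedForce_sub_le (α := α) (β := β) (x₀ := x₀ (s₀ + y)) (x₁ := x₁ (s₀ + y))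
      ((smallConst_le α β).trans (by norm_num)) sp.H_le sp.x₂_le
      sp.x₃_le sm.H_le (y₀ := -x₀ (s₀ - y)) (y₁ := x₁ (s₀ - y)) (y₂ := -x₂ (s₀ - y))
      (by rw [abs_neg]; exact sm.x₀_le) sm.x₁_le (by rw [abs_neg]; exact sm.x₂_le) sm.x₃_le
    rw [sub_neg_eq_add, sub_neg_eq_add] at hR
    rw [sub_neg_eq_add]
    set R := reducedForce α β (H (s₀ + y)) (x₀ (s₀ + y)) (x₁ (s₀ + y)) (x₂ (s₀ + y))
            (x₃ (s₀ + y)) - reducedForce α β (H (s₀ - y)) (-x₀ (s₀ - y)) (x₁ (s₀ - y))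
            (-x₂ (s₀ - y)) (x₃ (s₀ - y)) - (x₀ (s₀ + y) + x₀ (s₀ - y))
    have hK : forceConst α β * (1 / (100000 * (forceConst α β + 10))) ≤ 1 / 100000 := by
      have := forceConst_add_ten_mul α β
      have := smallConst_pos α β
      linarith
    have hR' := hR.trans (mul_le_mul_of_nonneg_right hK (by positivity))
    have hexp : Real.exp (1 / 2000 * y) ≤ Real.exp (1 / 4 * y) :=
      Real.exp_le_exp.2 (by linarith [hy.1])
    have r0 : 0 < amp x₀ x₁ x₂ x₃ s₀ := h.amp_pos (by linarith)
    have rp : amp x₀ x₁ x₂ x₃ (s₀ + y) ≤ amp x₀ x₁ x₂ x₃ s₀ * Real.exp (1 / 4 * y) := by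
      have := (h.amp_growth (a := s₀) (b := s₀ + y) (by linarith) (by linarith [hy.1])).1
      rw [add_sub_cancel_left] at this
      exact this.trans (by gcongr)
    have rm : amp x₀ x₁ x₂ x₃ (s₀ - y) ≤ amp x₀ x₁ x₂ x₃ s₀ * Real.exp (1 / 4 * y) := by
      have := (h.amp_growth (a := s₀ - y) (b := s₀) hm (by linarith [hy.1])).2
      rw [sub_sub_cancel] at this
      exact this.trans (by gcongr)
    have np := damp_le hs0 (t := s₀ + y) (by linarith [hy.1])
    have nm := damp_le hs0 (t := s₀ - y) (by linarith [hy.2])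
    obtain ⟨p0, p1, p2, p3⟩ := h.x_le hp
    obtain ⟨m0, m1, m2, m3⟩ := h.x_le hm
    have P0 := abs_le.1 (abs_mul_le_mul np (p0.trans rp))
    have P1 := abs_le.1 (abs_mul_le_mul np (p1.trans rp))
    have P2 := abs_le.1 (abs_mul_le_mul np (p2.trans rp))
    have P3 := abs_le.1 (abs_mul_le_mul np (p3.trans rp))
    have M0 := abs_le.1 (abs_mul_le_mul nm (m0.trans rm))
    have M1 := abs_le.1 (abs_mul_le_mul nm (m1.trans rm))
    have M2 := abs_le.1 (abs_mul_le_mul nm (m2.trans rm))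
    have M3 := abs_le.1 (abs_mul_le_mul nm (m3.trans rm))
    have hR2 := abs_le.1 (le_refl |R|)
    set A := amp x₀ x₁ x₂ x₃ s₀ * Real.exp (1 / 4 * y) with hA
    have e : 8 * (amp x₀ x₁ x₂ x₃ s₀ * (1 / s₀)) * Real.exp (1 / 4 * y)
        = 20 * (2 / 5 * (1 / s₀) * A) := by rw [hA]; ring
    rw [e]
    generalize 2 / 5 * (1 / s₀) * A = ν at *
    have f0 : |(-(1 / (5 * (s₀ + y)) * x₀ (s₀ + y)) + 1 / (5 * (s₀ - y)) * x₀ (s₀ - y))|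
        ≤ 2 * ν := abs_le.2 ⟨by linarith, by linarith⟩
    have f1 : |(-(2 * (1 / (5 * (s₀ + y)) * x₁ (s₀ + y)))
          - 2 * (1 / (5 * (s₀ - y)) * x₁ (s₀ - y)))|
        ≤ 4 * ν := abs_le.2 ⟨by linarith, by linarith⟩
    have f2 : |(-(3 * (1 / (5 * (s₀ + y)) * x₂ (s₀ + y)))
          + 3 * (1 / (5 * (s₀ - y)) * x₂ (s₀ - y)))|
        ≤ 6 * ν := abs_le.2 ⟨by linarith, by linarith⟩
    have f3 : |R - 4 * (1 / (5 * (s₀ + y)) * x₃ (s₀ + y))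
        - 4 * (1 / (5 * (s₀ - y)) * x₃ (s₀ - y))|
        ≤ |R| + 8 * ν := abs_le.2 ⟨by linarith, by linarith⟩
    linarith
  choose! f₀ f₁ f₂ f₃ d0 d1 d2 d3 hf using key
  refine ⟨fun y => f₀ y + f₁ y + f₂ y + f₃ y, fun y => f₀ y - f₁ y + f₂ y - f₃ y,
    fun y => f₀ y - f₂ y, fun y => f₁ y - f₃ y, ?_⟩
  have hbd : ∀ y ∈ Icc 0 (s₀ / 2), ∀ e : ℝ, |e| ≤ |f₀ y| + |f₁ y| + |f₂ y| + |f₃ y| → |e| ≤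
      8 * (amp x₀ x₁ x₂ x₃ s₀ * (1 / s₀)) * Real.exp (1 / 4 * y) + 1 / 100000 *
      (|(x₀ (s₀ + y) + x₀ (s₀ - y)) + (x₁ (s₀ + y) - x₁ (s₀ - y))
        + (x₂ (s₀ + y) + x₂ (s₀ - y)) + (x₃ (s₀ + y) - x₃ (s₀ - y))|
      + |(x₀ (s₀ + y) + x₀ (s₀ - y)) - (x₁ (s₀ + y) - x₁ (s₀ - y))
        + (x₂ (s₀ + y) + x₂ (s₀ - y)) - (x₃ (s₀ + y) - x₃ (s₀ - y))|
      + |(x₀ (s₀ + y) + x₀ (s₀ - y)) - (x₂ (s₀ + y) + x₂ (s₀ - y))|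
      + |(x₁ (s₀ + y) - x₁ (s₀ - y)) - (x₃ (s₀ + y) - x₃ (s₀ - y))|
      + |H (s₀ + y) - H (s₀ - y)|) := by
    intro y hy e he
    refine he.trans ((hf y hy).trans ?_)
    generalize x₀ (s₀ + y) + x₀ (s₀ - y) = a
    generalize x₁ (s₀ + y) - x₁ (s₀ - y) = b
    generalize x₂ (s₀ + y) + x₂ (s₀ - y) = c
    generalize x₃ (s₀ + y) - x₃ (s₀ - y) = d
    have hp := abs_le.1 (le_refl |a + b + c + d|)
    have hq := abs_le.1 (le_refl |a - b + c - d|)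
    have h1 := abs_le.1 (le_refl |a - c|)
    have h2 := abs_le.1 (le_refl |b - d|)
    have ha : |a| ≤ (|a + b + c + d| + |a - b + c - d|) / 4 + |a - c| / 2 :=
      abs_le.2 ⟨by linarith, by linarith⟩
    have hb : |b| ≤ (|a + b + c + d| + |a - b + c - d|) / 4 + |b - d| / 2 :=
      abs_le.2 ⟨by linarith, by linarith⟩
    have hc : |c| ≤ (|a + b + c + d| + |a - b + c - d|) / 4 + |a - c| / 2 :=
      abs_le.2 ⟨by linarith, by linarith⟩
    have hd : |d| ≤ (|a + b + c + d| + |a - b + c - d|) / 4 + |b - d| / 2 :=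
      abs_le.2 ⟨by linarith, by linarith⟩
    linarith
  have hab : ∀ y, -|f₀ y| ≤ f₀ y ∧ f₀ y ≤ |f₀ y| ∧ -|f₁ y| ≤ f₁ y ∧ f₁ y ≤ |f₁ y| ∧
      -|f₂ y| ≤ f₂ y ∧ f₂ y ≤ |f₂ y| ∧ -|f₃ y| ≤ f₃ y ∧ f₃ y ≤ |f₃ y| := fun y =>
    ⟨neg_abs_le _, le_abs_self _, neg_abs_le _, le_abs_self _, neg_abs_le _, le_abs_self _,
      neg_abs_le _, le_abs_self _⟩
  refine ⟨fun y hy => ?_, fun y hy => ?_, fun y hy => ?_, fun y hy => ?_, fun y hy => ?_,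
    fun y hy => ?_, fun y hy => ?_, fun y hy => hbd y hy _ ?_, fun y hy => hbd y hy _ ?_,
    fun y hy => hbd y hy _ ?_, fun y hy => hbd y hy _ ?_⟩
  · exact ((((d0 y hy).add (d1 y hy)).add (d2 y hy)).add (d3 y hy)).congr_deriv (by ring)
  · exact ((((d0 y hy).sub (d1 y hy)).add (d2 y hy)).sub (d3 y hy)).congr_deriv (by ring)
  · exact ((d0 y hy).sub (d2 y hy)).congr_deriv (by ring)
  · exact ((d1 y hy).sub (d3 y hy)).congr_deriv (by ring)
  · have hp : S ≤ s₀ + y := by linarith [hy.1]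
    have hm : S ≤ s₀ - y := by linarith [hy.2]
    exact ((hplus (h.hasDerivAt_H _ hp)).sub (hminus (h.hasDerivAt_H _ hm))).congr_deriv (by ring)
  · refine ((((hasDerivAt_id y).const_mul (1 / 4)).exp).const_mul
      (8 * (amp x₀ x₁ x₂ x₃ s₀ * (1 / s₀)))).congr_deriv ?_
    simp only [id]
    ring
  · have : 0 ≤ amp x₀ x₁ x₂ x₃ s₀ := Real.sqrt_nonneg _
    positivity
  all_goals
    obtain ⟨i1, i2, i3, i4, i5, i6, i7, i8⟩ := hab y
    have j0 := abs_nonneg (f₀ y)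
    have j1 := abs_nonneg (f₁ y)
    have j2 := abs_nonneg (f₂ y)
    have j3 := abs_nonneg (f₃ y)
    exact abs_le.2 ⟨by linarith, by linarith⟩

/-- The exponent is `s/2 - 2 · s/4000`: the growth of `p²` over a time `s/2`, less the largest
growth of the squared amplitude over that time. -/
theorem sq_le_exp {s : ℝ} (hs : 1000 ≤ s) : s ^ 2 ≤ Real.exp (s * 1998 / 4000) := by
  have h1 : s / 10 ≤ Real.exp (s / 10) := by linarith [Real.add_one_le_exp (s / 10)]
  have h2 : Real.exp (s / 10) ^ 4 ≤ Real.exp (s * 1998 / 4000) := by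
    rw [← Real.exp_nat_mul]; apply Real.exp_le_exp.2; push_cast; linarith
  have h3 : (s / 10) ^ 4 ≤ Real.exp (s / 10) ^ 4 := by gcongr
  have h4 : (100 : ℝ) ^ 2 ≤ s ^ 2 := by gcongr; linarith
  have h5 : s ^ 2 * 100 ^ 2 ≤ s ^ 2 * s ^ 2 := by gcongr
  calc s ^ 2 ≤ (s / 10) ^ 4 := by linarith
    _ ≤ _ := h3.trans h2

/-- Bounds for the components of a vector in terms of its coordinates in the eigenbasis. -/
theorem components_le_of_sq_le {a b c d g t M : ℝ} (hM : 0 ≤ M)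
    (h : (a + b + c + d) ^ 2 + (a - b + c - d) ^ 2 + (a - c) ^ 2 + (b - d) ^ 2 + g ^ 2 + t ^ 2
      ≤ M ^ 2) : |g| ≤ M ∧ |a| ≤ M ∧ |b| ≤ M ∧ |c| ≤ M ∧ |d| ≤ M := by
  have s1 := sq_nonneg (a + b + c + d)
  have s2 := sq_nonneg (a - b + c - d)
  have s3 := sq_nonneg (a - c)
  have s4 := sq_nonneg (b - d)
  have s5 := sq_nonneg g
  have s6 := sq_nonneg t
  have hp : |a + b + c + d| ≤ M := abs_le_of_sq_le_sq (by linarith) hM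
  have hq : |a - b + c - d| ≤ M := abs_le_of_sq_le_sq (by linarith) hM
  have h1 : |a - c| ≤ M := abs_le_of_sq_le_sq (by linarith) hM
  have h2 : |b - d| ≤ M := abs_le_of_sq_le_sq (by linarith) hM
  have hg : |g| ≤ M := abs_le_of_sq_le_sq (by linarith) hM
  rw [abs_le] at hp hq h1 h2
  refine ⟨hg, abs_le.2 ⟨?_, ?_⟩, abs_le.2 ⟨?_, ?_⟩, abs_le.2 ⟨?_, ?_⟩, abs_le.2 ⟨?_, ?_⟩⟩ <;>
    linarith

/-- Near a zero of `x₀ - x₂` the flow is almost reversible. -/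
theorem reflect_le (h : OscillatoryFlow α β S H x₀ x₁ x₂ x₃) {s₀ y : ℝ} (hs₀ : 2 * S ≤ s₀)
    (hz : x₀ s₀ - x₂ s₀ = 0) (hy : 0 ≤ y) (hy' : y ≤ 6) :
    |H (s₀ + y) - H (s₀ - y)| ≤ reflConst * (amp x₀ x₁ x₂ x₃ s₀ * (1 / s₀)) ∧
    |x₀ (s₀ + y) + x₀ (s₀ - y)| ≤ reflConst * (amp x₀ x₁ x₂ x₃ s₀ * (1 / s₀)) ∧
    |x₁ (s₀ + y) - x₁ (s₀ - y)| ≤ reflConst * (amp x₀ x₁ x₂ x₃ s₀ * (1 / s₀)) ∧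
    |x₂ (s₀ + y) + x₂ (s₀ - y)| ≤ reflConst * (amp x₀ x₁ x₂ x₃ s₀ * (1 / s₀)) ∧
    |x₃ (s₀ + y) - x₃ (s₀ - y)| ≤ reflConst * (amp x₀ x₁ x₂ x₃ s₀ * (1 / s₀)) := by
  have hS := h.le_time
  have hs0 : 0 < s₀ := by linarith
  obtain ⟨ep, eq, e₁, e₂, hF⟩ := h.forcedFlow_reflect hs₀
  have r0 : 0 < amp x₀ x₁ x₂ x₃ s₀ := h.amp_pos (by linarith)
  set ρ := amp x₀ x₁ x₂ x₃ s₀ * (1 / s₀) with hρ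
  have hρ0 : 0 < ρ := by positivity
  have hx : x₂ s₀ = x₀ s₀ := by linarith
  -- the initial difference is controlled by the forcing
  have hinit : (4 * x₀ s₀) ^ 2 ≤ 25 * (8 * ρ) ^ 2 := by
    by_contra hcon
    rw [not_le] at hcon
    have hg := hF.growth (by linarith) (by
      simp only [add_zero, sub_zero, mul_zero, Real.exp_zero, hx]
      linarith [pow_pos hρ0 2])
    simp only [add_zero, sub_zero, hx] at hg
    rw [show s₀ + s₀ / 2 = 3 * s₀ / 2 by ring, show s₀ - s₀ / 2 = s₀ / 2 by ring] at hg
    have rp := (h.amp_growth (a := s₀) (b := 3 * s₀ / 2) (by linarith) (by linarith)).1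
    have rm := (h.amp_growth (a := s₀ / 2) (b := s₀) (by linarith) (by linarith)).2
    rw [show 1 / 2000 * (3 * s₀ / 2 - s₀) = s₀ / 4000 by ring] at rp
    rw [show 1 / 2000 * (s₀ - s₀ / 2) = s₀ / 4000 by ring] at rm
    obtain ⟨p0, p1, p2, p3⟩ := h.x_le (s := 3 * s₀ / 2) (by linarith)
    obtain ⟨m0, m1, m2, m3⟩ := h.x_le (s := s₀ / 2) (by linarith)
    rw [abs_le] at p0 p1 p2 p3 m0 m1 m2 m3
    have hP : |x₀ (3 * s₀ / 2) + x₀ (s₀ / 2) + (x₁ (3 * s₀ / 2) - x₁ (s₀ / 2))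
        + (x₂ (3 * s₀ / 2) + x₂ (s₀ / 2)) + (x₃ (3 * s₀ / 2) - x₃ (s₀ / 2))|
        ≤ 8 * (amp x₀ x₁ x₂ x₃ s₀ * Real.exp (s₀ / 4000)) :=
      abs_le.2 ⟨by linarith, by linarith⟩
    have hP2 := pow_le_pow_left₀ (abs_nonneg _) hP 2
    rw [sq_abs] at hP2
    set E := Real.exp (s₀ / 4000) with hE
    have hE0 : 0 < E := Real.exp_pos _
    have hbig : Real.exp (1 * (s₀ / 2)) = E ^ 2 * Real.exp (s₀ * 1998 / 4000) := by
      rw [hE, ← Real.exp_nat_mul, ← Real.exp_add]; congr 1; push_cast; ring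
    have hlow := sq_le_exp (hS.trans (by linarith : S ≤ s₀))
    have hρs : ρ * s₀ = amp x₀ x₁ x₂ x₃ s₀ := by rw [hρ]; field_simp
    have : 25 * (8 * ρ) ^ 2 * (E ^ 2 * s₀ ^ 2) ≤ (8 * (amp x₀ x₁ x₂ x₃ s₀ * E)) ^ 2 := by
      refine le_trans ?_ (hg.trans hP2)
      rw [hbig]
      refine mul_le_mul ?_ (mul_le_mul_of_nonneg_left hlow (by positivity)) (by positivity)
        (by positivity)
      refine hcon.le.trans (le_of_eq ?_)
      ring
    rw [← hρs] at this
    have : 0 < (ρ * E * s₀) ^ 2 := by positivity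
    linarith
  have hb := hF.bounded (y := y) ⟨hy, by linarith⟩
  simp only [add_zero, sub_zero, mul_zero, Real.exp_zero, hx, sub_self] at hb
  have he : Real.exp (20 * y) ≤ (Real.exp 60) ^ 2 := by
    rw [← Real.exp_nat_mul]; apply Real.exp_le_exp.2; push_cast; linarith
  -- The initial squared norm is at most `25 + 25 + 1` times `(8ρ)²`; with `51 · 8² ≤ 64²` and the
  -- factor `exp (20 · 6)` this explains `reflConst`.
  have hU : (x₀ s₀ + x₀ s₀ + (x₀ s₀ + x₀ s₀)) ^ 2
      + (x₀ s₀ + x₀ s₀ + (x₀ s₀ + x₀ s₀)) ^ 2 + 0 ^ 2 + 0 ^ 2 + 0 ^ 2 + (8 * ρ * 1) ^ 2 ≤ 51 * (8 * ρ) ^ 2 := by linarith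
  have hb' := hb.trans (mul_le_mul hU he (by positivity) (by positivity))
  have hC : 51 * (8 * ρ) ^ 2 * Real.exp 60 ^ 2 ≤ (reflConst * ρ) ^ 2 := by
    unfold reflConst
    have : 0 < (ρ * Real.exp 60) ^ 2 := by positivity
    linarith
  exact components_le_of_sq_le (mul_nonneg reflConst_pos.le hρ0.le) (hb'.trans hC)

end OscillatoryFlow

/-! ### The adiabatic invariant -/

/-- The adiabatic invariant: the squared amplitude times `s`, with a lower order correction. -/
noncomputable def adiab (x₀ x₁ x₂ x₃ : ℝ → ℝ) (s : ℝ) : ℝ :=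
  s * ((x₀ s - x₂ s) ^ 2 + (x₁ s - x₃ s) ^ 2)
    + (-(x₀ s * x₁ s) + x₁ s * x₂ s + 3 * (x₂ s * x₃ s) - 3 * (x₃ s * x₀ s)) / 5

/-- The constant in the estimate for the variation of the adiabatic invariant. -/
noncomputable def adiabConst (α β : ℝ) : ℝ := 1000 * (forceConst α β + 1) * (reflConst + 1)

theorem adiabConst_pos (α β : ℝ) : 0 < adiabConst α β := by
  have := forceConst_pos α β
  have := reflConst_pos
  unfold adiabConst
  positivity

namespace OscillatoryFlow

variable {α β S : ℝ} {H x₀ x₁ x₂ x₃ : ℝ → ℝ}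

theorem force_le (h : OscillatoryFlow α β S H x₀ x₁ x₂ x₃) {δ s : ℝ} (hδ : δ ≤ 1 / 2)
    (hs : S ≤ s) (hsm : FlowSmall H x₀ x₁ x₂ x₃ δ s) :
    |reducedForce α β (H s) (x₀ s) (x₁ s) (x₂ s) (x₃ s) - x₀ s| ≤
      4 * (forceConst α β * δ * amp x₀ x₁ x₂ x₃ s) := by
  obtain ⟨b0, b1, b2, b3⟩ := h.x_le hs
  have hK := forceConst_pos α β
  have hδ0 : 0 ≤ δ := (abs_nonneg _).trans hsm.H_le
  refine (reducedForce_sub_self_le hδ hsm.H_le hsm.x₂_le hsm.x₃_le).trans ?_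
  calc _ ≤ forceConst α β * δ * (4 * amp x₀ x₁ x₂ x₃ s) := by gcongr; linarith
    _ = _ := by ring

/-- Differentiating `s (c₁² + c₂²)` leaves quadratic terms of order one, from the factor `s` and
from the damping, where `s · 1/(5s) = 1/5`. The correction in `adiab` is chosen so that its
derivative along the undamped linear flow cancels them exactly. Besides terms of size `δ amp²` there
remains the product of `s` with the nonlinear part of the force, which has to be treated by
symmetry. -/
theorem hasDerivAt_adiab (h : OscillatoryFlow α β S H x₀ x₁ x₂ x₃) {δ s : ℝ} (hδ : δ ≤ 1 / 2)
    (hs : S ≤ s) (hsm : FlowSmall H x₀ x₁ x₂ x₃ δ s) :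
    ∃ e, HasDerivAt (adiab x₀ x₁ x₂ x₃) (-(2 * s * ((x₁ s - x₃ s) *
        (reducedForce α β (H s) (x₀ s) (x₁ s) (x₂ s) (x₃ s) - x₀ s))) + e) s ∧
      |e| ≤ (9 + 5 * forceConst α β) * δ * amp x₀ x₁ x₂ x₃ s ^ 2 := by
  have hs0 : 0 < s := h.pos.trans_le hs
  have hR := h.force_le hδ hs hsm
  have d0 := h.hasDerivAt_x₀ s hs
  have d1 := h.hasDerivAt_x₁ s hs
  have d2 := h.hasDerivAt_x₂ s hs
  have d3 := h.hasDerivAt_x₃ s hs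
  obtain ⟨R, hRe⟩ : ∃ R, R = reducedForce α β (H s) (x₀ s) (x₁ s) (x₂ s) (x₃ s) - x₀ s :=
    ⟨_, rfl⟩
  have hR2 : reducedForce α β (H s) (x₀ s) (x₁ s) (x₂ s) (x₃ s) = x₀ s + R := by rw [hRe]; ring
  rw [← hRe] at hR ⊢
  rw [hR2] at d3
  refine ⟨(1 / (5 * s) * (3 * (x₀ s * x₁ s) - 5 * (x₁ s * x₂ s) - 21 * (x₂ s * x₃ s)
    + 15 * (x₀ s * x₃ s)) - 3 * ((x₀ s - x₂ s) * R)) / 5, ?_, ?_⟩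
  · refine (((hasDerivAt_id s).mul (((d0.sub d2).pow 2).add ((d1.sub d3).pow 2))).add
      ((((((d0.mul d1).neg).add (d1.mul d2)).add ((d2.mul d3).const_mul 3)).sub
        ((d3.mul d0).const_mul 3)).div_const 5)).congr_deriv ?_
    simp only [id, Pi.add_apply, Pi.sub_apply, Pi.pow_apply]
    push_cast
    field_simp
    ring
  · obtain ⟨b0, b1, b2, b3⟩ := h.x_le hs
    have hc := (h.components_le hs).2.2.1
    have hδ0 : 0 ≤ δ := (abs_nonneg _).trans hsm.H_le
    have hν : |1 / (5 * s)| ≤ δ := by rw [abs_of_pos (by positivity)]; exact hsm.damp_le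
    set r := amp x₀ x₁ x₂ x₃ s
    have t1 := abs_le.1 (abs_mul_le_mul b0 b1)
    have t2 := abs_le.1 (abs_mul_le_mul b1 b2)
    have t3 := abs_le.1 (abs_mul_le_mul b2 b3)
    have t4 := abs_le.1 (abs_mul_le_mul b0 b3)
    have t5 := abs_le.1 (abs_mul_le_mul hc hR)
    have t6 : |3 * (x₀ s * x₁ s) - 5 * (x₁ s * x₂ s) - 21 * (x₂ s * x₃ s)
        + 15 * (x₀ s * x₃ s)| ≤ 44 * (r * r) := abs_le.2 ⟨by linarith, by linarith⟩
    have t7 := abs_le.1 (abs_mul_le_mul hν t6)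
    have hK := forceConst_pos α β
    have t8 : 0 ≤ δ * r ^ 2 := by positivity
    have t9 : 0 ≤ forceConst α β * (δ * r ^ 2) := by positivity
    rw [abs_le]
    constructor <;> linarith

theorem adiab_bounds (h : OscillatoryFlow α β S H x₀ x₁ x₂ x₃) {s : ℝ} (hs : S ≤ s) :
    1 / 2 * (s * amp x₀ x₁ x₂ x₃ s ^ 2) ≤ adiab x₀ x₁ x₂ x₃ s ∧
    adiab x₀ x₁ x₂ x₃ s ≤ 2 * (s * amp x₀ x₁ x₂ x₃ s ^ 2) := by
  obtain ⟨b0, b1, b2, b3⟩ := h.x_le hs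
  have hS := h.le_time.trans hs
  have hr := h.sq_amp hs
  unfold adiab
  rw [← hr]
  set r := amp x₀ x₁ x₂ x₃ s
  have t1 := abs_le.1 (abs_mul_le_mul b0 b1)
  have t2 := abs_le.1 (abs_mul_le_mul b1 b2)
  have t3 := abs_le.1 (abs_mul_le_mul b2 b3)
  have t4 := abs_le.1 (abs_mul_le_mul b3 b0)
  have hp : 1000 * r ^ 2 ≤ s * r ^ 2 := by gcongr
  have hr2 := sq_nonneg r
  constructor <;> linarith

/-- The variation of the adiabatic invariant over an interval centred at a zero of `x₀ - x₂`. -/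
theorem adiab_reflect_le (h : OscillatoryFlow α β S H x₀ x₁ x₂ x₃) {s₀ L δ : ℝ}
    (hs₀ : 2 * S ≤ s₀) (hz : x₀ s₀ - x₂ s₀ = 0) (hL : 0 ≤ L) (hL' : L ≤ 6) (hδ : δ ≤ 1 / 2)
    (hsm : ∀ s ∈ Icc (s₀ - L) (s₀ + L), FlowSmall H x₀ x₁ x₂ x₃ δ s) :
    |adiab x₀ x₁ x₂ x₃ (s₀ + L) - adiab x₀ x₁ x₂ x₃ (s₀ - L)| ≤
      9 / 10 * adiabConst α β * δ * amp x₀ x₁ x₂ x₃ s₀ ^ 2 := by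
  have hS := h.le_time
  have hs0 : 0 < s₀ := by linarith
  have hδ0 : 0 ≤ δ := (abs_nonneg _).trans (hsm s₀ ⟨by linarith, by linarith⟩).H_le
  have hr0 := h.amp_pos (s := s₀) (by linarith)
  have hK := forceConst_pos α β
  have hC := reflConst_pos
  -- The derivative of this difference adds the values at `s₀ + y` and `s₀ - y`. There `x₁ - x₃` is
  -- almost even and the nonlinear part of the force almost odd, so the products nearly cancel. By
  -- `reflect_le` the defect is of relative size `1/s₀`, which absorbs the factor `s₀`; the
  -- remaining factor `y` is at most `6`.
  have key : ∀ y ∈ Icc 0 L, ∃ D, HasDerivAt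
      (fun y => adiab x₀ x₁ x₂ x₃ (s₀ + y) - adiab x₀ x₁ x₂ x₃ (s₀ - y)) D y ∧
      |D| ≤ 150 * (forceConst α β + 1) * (reflConst + 1) * δ * amp x₀ x₁ x₂ x₃ s₀ ^ 2 := by
    intro y hy
    have hy0 := hy.1
    have hyL := hy.2
    have hp : S ≤ s₀ + y := by linarith
    have hm : S ≤ s₀ - y := by linarith
    have sp := hsm (s₀ + y) ⟨by linarith, by linarith⟩
    have sm := hsm (s₀ - y) ⟨by linarith, by linarith⟩
    obtain ⟨ep, dp, bp⟩ := h.hasDerivAt_adiab hδ hp sp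
    obtain ⟨em, dm, bm⟩ := h.hasDerivAt_adiab hδ hm sm
    refine ⟨_, (dp.comp_const_add s₀ y).sub (dm.comp_const_sub s₀ y), ?_⟩
    obtain ⟨g, g0, g1, g2, g3⟩ := h.reflect_le hs₀ hz hy0 (hyL.trans hL')
    have rp := (h.amp_step (a := s₀) (b := s₀ + y) (by linarith) (by linarith)
      (by linarith)).1
    have rm := (h.amp_step (a := s₀ - y) (b := s₀) hm (by linarith) (by linarith)).2
    have hRp := h.force_le hδ hp sp
    have hRm := h.force_le hδ hm sm
    have hcp := (h.components_le hp).2.2.2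
    have hcm := (h.components_le hm).2.2.2
    have hR := reducedForce_sub_le (α := α) (β := β) (x₀ := x₀ (s₀ + y)) (x₁ := x₁ (s₀ + y))
      hδ sp.H_le sp.x₂_le
      sp.x₃_le sm.H_le (y₀ := -x₀ (s₀ - y)) (y₁ := x₁ (s₀ - y)) (y₂ := -x₂ (s₀ - y))
      (by rw [abs_neg]; exact sm.x₀_le) sm.x₁_le (by rw [abs_neg]; exact sm.x₂_le) sm.x₃_le
    rw [sub_neg_eq_add, sub_neg_eq_add, reducedForce_reflect] at hR
    set Fp := reducedForce α β (H (s₀ + y)) (x₀ (s₀ + y)) (x₁ (s₀ + y)) (x₂ (s₀ + y))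
      (x₃ (s₀ + y))
    set Fm := reducedForce α β (H (s₀ - y)) (x₀ (s₀ - y)) (x₁ (s₀ - y)) (x₂ (s₀ - y))
      (x₃ (s₀ - y))
    set r := amp x₀ x₁ x₂ x₃ s₀
    set K := forceConst α β
    set C := reflConst
    obtain ⟨ρ, hρ⟩ : ∃ ρ, ρ = C * (r * (1 / s₀)) := ⟨_, rfl⟩
    rw [← hρ] at g g0 g1 g2 g3
    have hρs : s₀ * ρ = C * r := by rw [hρ]; field_simp
    have hKδ : 0 ≤ K * δ := by positivity
    have hR' : |Fp - -Fm - (x₀ (s₀ + y) - -x₀ (s₀ - y))| ≤ K * δ * (5 * ρ) := by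
      rw [sub_neg_eq_add (x₀ (s₀ + y))]
      exact hR.trans (mul_le_mul_of_nonneg_left (by linarith) hKδ)
    have hRp' : |Fp - x₀ (s₀ + y)| ≤ 4 * (K * δ * (101 / 100 * r)) := hRp.trans (by gcongr)
    have hRm' : |Fm - x₀ (s₀ - y)| ≤ 4 * (K * δ * (101 / 100 * r)) := hRm.trans (by gcongr)
    have hcp' := hcp.trans rp
    have hcm' := hcm.trans rm
    have hdc : |(x₁ (s₀ + y) - x₃ (s₀ + y)) - (x₁ (s₀ - y) - x₃ (s₀ - y))| ≤ 2 * ρ := by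
      rw [abs_le] at g1 g3 ⊢
      constructor <;> linarith
    have u1 := abs_mul_le_mul (abs_of_pos hs0).le (abs_mul_le_mul hdc hRp')
    have u2 := abs_mul_le_mul (abs_of_pos hs0).le (abs_mul_le_mul hcm' hR')
    have hyabs : |y| ≤ 6 := by rw [abs_of_nonneg hy0]; linarith
    have u3 := abs_mul_le_mul hyabs (abs_mul_le_mul hcp' hRp')
    have u4 := abs_mul_le_mul hyabs (abs_mul_le_mul hcm' hRm')
    have hap : amp x₀ x₁ x₂ x₃ (s₀ + y) ^ 2 ≤ (101 / 100 * r) ^ 2 := by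
      have := h.amp_pos hp
      gcongr
    have ham : amp x₀ x₁ x₂ x₃ (s₀ - y) ^ 2 ≤ (101 / 100 * r) ^ 2 := by
      have := h.amp_pos hm
      gcongr
    have hKδ' : 0 ≤ (9 + 5 * K) * δ := by positivity
    have v1 := bp.trans (mul_le_mul_of_nonneg_left hap hKδ')
    have v2 := bm.trans (mul_le_mul_of_nonneg_left ham hKδ')
    have e1 : s₀ * (2 * ρ * (4 * (K * δ * (101 / 100 * r)))) = 808 / 100 * (C * (K * (δ * r ^ 2)))
        := by linear_combination (808 / 100 * K * δ * r) * hρs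
    have e2 : s₀ * (101 / 100 * r * (K * δ * (5 * ρ))) = 505 / 100 * (C * (K * (δ * r ^ 2)))
        := by linear_combination (505 / 100 * K * δ * r) * hρs
    rw [e1] at u1
    rw [e2] at u2
    have w0 : 0 ≤ δ * r ^ 2 := by positivity
    have w1 : 0 ≤ K * (δ * r ^ 2) := by positivity
    have w2 : 0 ≤ C * (K * (δ * r ^ 2)) := by positivity
    have w3 : 0 ≤ C * (δ * r ^ 2) := by positivity
    rw [abs_le] at u1 u2 u3 u4 v1 v2 ⊢
    constructor <;> linarith
  choose! D hD hDle using key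
  have := abs_sub_le_of_hasDerivAt hL hD hDle
  simp only [add_zero, sub_zero, sub_self] at this
  refine this.trans ?_
  unfold adiabConst
  have w : 0 ≤ (forceConst α β + 1) * (reflConst + 1) * δ * amp x₀ x₁ x₂ x₃ s₀ ^ 2 := by
    positivity
  nlinarith

/-- From any time there is a later time, at distance between two and twelve, at which the
adiabatic invariant and `H` have hardly changed. -/
theorem exists_step (h : OscillatoryFlow α β S H x₀ x₁ x₂ x₃) {s δ : ℝ} (hs : 2 * S ≤ s)
    (hδ : δ ≤ 1 / 2) (hsm : ∀ t ∈ Icc s (s + 12), FlowSmall H x₀ x₁ x₂ x₃ δ t) :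
    ∃ s', s + 2 ≤ s' ∧ s' ≤ s + 12 ∧
      |adiab x₀ x₁ x₂ x₃ s' - adiab x₀ x₁ x₂ x₃ s| ≤
        2 * adiabConst α β * (δ / s) * adiab x₀ x₁ x₂ x₃ s ∧
      |H s' - H s| ≤ 2 * reflConst * (amp x₀ x₁ x₂ x₃ s / s) := by
  have hS := h.le_time
  have hs0 : 0 < s := by linarith
  have hδ0 : 0 ≤ δ := (abs_nonneg _).trans (hsm s ⟨by linarith, by linarith⟩).H_le
  -- The new time is the mirror image of `s` in a zero of `x₀ - x₂`. Searching from `s + 1` places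
  -- the zero at distance between `1` and `6`, so the step has length between `2` and `12`.
  obtain ⟨y, hy, hz⟩ := h.exists_zero (a := s + 1) (by linarith)
  obtain ⟨hy0, hy5⟩ := hy
  have hsL : s + 1 + y - (1 + y) = s := by ring
  have hG := h.adiab_reflect_le (s₀ := s + 1 + y) (L := 1 + y) (by linarith) hz (by linarith)
    (by linarith) hδ (fun t ht => hsm t ⟨by linarith [ht.1], by linarith [ht.2]⟩)
  have hH := (h.reflect_le (s₀ := s + 1 + y) (y := 1 + y) (by linarith) hz (by linarith)
    (by linarith)).1
  rw [hsL] at hG hH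
  have hr := h.amp_pos (s := s) (by linarith)
  have hr' := h.amp_pos (s := s + 1 + y) (by linarith)
  have hra := (h.amp_step (a := s) (b := s + 1 + y) (by linarith) (by linarith) (by linarith)).1
  have hK := adiabConst_pos α β
  have hC := reflConst_pos
  refine ⟨s + 1 + y + (1 + y), by linarith, by linarith, hG.trans ?_, hH.trans ?_⟩
  · have hb := (h.adiab_bounds (s := s) (by linarith)).1
    have h2 : amp x₀ x₁ x₂ x₃ (s + 1 + y) ^ 2 ≤ (101 / 100 * amp x₀ x₁ x₂ x₃ s) ^ 2 := by gcongr
    have h3 : amp x₀ x₁ x₂ x₃ s ^ 2 ≤ 2 * (adiab x₀ x₁ x₂ x₃ s / s) := by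
      rw [mul_div_assoc', le_div_iff₀ hs0]
      linarith
    calc _ ≤ 9 / 10 * adiabConst α β * δ * (103 / 100 * (2 * (adiab x₀ x₁ x₂ x₃ s / s))) := by
          refine mul_le_mul_of_nonneg_left ?_ (by positivity)
          nlinarith [sq_nonneg (amp x₀ x₁ x₂ x₃ s)]
      _ = 1854 / 1000 * (adiabConst α β * (δ / s) * adiab x₀ x₁ x₂ x₃ s) := by ring
      _ ≤ _ := by
        have : 0 ≤ adiabConst α β * (δ / s) * adiab x₀ x₁ x₂ x₃ s := by
          have : 0 ≤ adiab x₀ x₁ x₂ x₃ s := le_trans (by positivity) hb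
          positivity
        linarith
  · have h1 : 1 / (s + 1 + y) ≤ 1 / s := one_div_le_one_div_of_le hs0 (by linarith)
    calc _ ≤ reflConst * (101 / 100 * amp x₀ x₁ x₂ x₃ s * (1 / s)) := by gcongr
      _ = 101 / 100 * (reflConst * (amp x₀ x₁ x₂ x₃ s / s)) := by ring
      _ ≤ _ := by
        have : 0 ≤ reflConst * (amp x₀ x₁ x₂ x₃ s / s) := by positivity
        linarith

end OscillatoryFlow

/-! ### Decay rates -/

/-- Discrete monotonicity along a sequence of times with bounded gaps. -/
theorem exists_le_of_forall_step {Ψ : ℝ → ℝ} {S : ℝ}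
    (hstep : ∀ s, S ≤ s → ∃ s', s + 2 ≤ s' ∧ s' ≤ s + 12 ∧ Ψ s' ≤ Ψ s) {s : ℝ} (hs : S ≤ s) :
    ∃ t, S ≤ t ∧ t ≤ s ∧ s ≤ t + 12 ∧ Ψ t ≤ Ψ S := by
  have main : ∀ n : ℕ, ∀ S', S ≤ S' → ∀ s, S' ≤ s → s ≤ S' + 2 * n →
      ∃ t, S' ≤ t ∧ t ≤ s ∧ s ≤ t + 12 ∧ Ψ t ≤ Ψ S' := by
    intro n
    induction n with
    | zero =>
      intro S' _ s h1 h2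
      exact ⟨S', le_rfl, h1, by push_cast at h2; linarith, le_rfl⟩
    | succ n ih =>
      intro S' hS' s h1 h2
      by_cases h3 : s ≤ S' + 12
      · exact ⟨S', le_rfl, h1, h3, le_rfl⟩
      obtain ⟨s', a1, a2, a3⟩ := hstep S' hS'
      push_cast at h2
      obtain ⟨t, b1, b2, b3, b4⟩ := ih s' (by linarith) s (by linarith) (by linarith)
      exact ⟨t, by linarith, b2, b3, b4.trans a3⟩
  obtain ⟨n, hn⟩ := exists_nat_ge (s - S)
  exact main n S le_rfl s hs (by have : (0 : ℝ) ≤ n := n.cast_nonneg; linarith)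

/-- A quantity that can only grow along a sequence of times and tends to zero is nonpositive. -/
theorem nonpos_of_forall_step {u : ℝ → ℝ} {S : ℝ} (hu : Tendsto u atTop (𝓝 0))
    (hstep : ∀ s, S ≤ s → ∃ s', s + 2 ≤ s' ∧ u s ≤ u s') {s : ℝ} (hs : S ≤ s) : u s ≤ 0 := by
  have main : ∀ n : ℕ, ∃ s', s + 2 * n ≤ s' ∧ u s ≤ u s' := by
    intro n
    induction n with
    | zero => exact ⟨s, by simp, le_rfl⟩
    | succ n ih =>
      obtain ⟨s', h1, h2⟩ := ih
      have : (0 : ℝ) ≤ n := n.cast_nonneg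
      obtain ⟨s'', h3, h4⟩ := hstep s' (by linarith)
      exact ⟨s'', by push_cast; linarith, h2.trans h4⟩
  choose t ht htu using main
  have htt : Tendsto t atTop atTop := by
    refine tendsto_atTop_mono ht (tendsto_atTop_add_const_left _ _ ?_)
    exact tendsto_natCast_atTop_atTop.const_mul_atTop (by norm_num)
  exact ge_of_tendsto' (hu.comp htt) htu

/-- On `[s, s + 2]` the argument is at most `2s`, which bounds the derivative of `-x^(-a)` below.
The lemma turns sums of `s^(-a-1)` along steps of length at least two into telescoping sums. -/
theorem rpow_neg_sub_rpow_neg_ge {a s : ℝ} (ha : 0 < a) (hs : 2 ≤ s) :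
    2 * a * 2 ^ (-a - 1) * s ^ (-a - 1) ≤ s ^ (-a) - (s + 2) ^ (-a) := by
  have := le_of_hasDerivAt_nonneg (a := s) (b := s + 2)
    (f := fun x => -(x ^ (-a)) - a * 2 ^ (-a - 1) * s ^ (-a - 1) * x)
    (f' := fun x => -(-a * x ^ (-a - 1)) - a * 2 ^ (-a - 1) * s ^ (-a - 1) * 1) (by linarith)
    (fun x hx => ((Real.hasDerivAt_rpow_const (Or.inl (by linarith [hx.1] : x ≠ 0) )).neg).sub
      ((hasDerivAt_id x).const_mul _)) (fun x hx => by
      have h1 : (2 * s) ^ (-a - 1) ≤ x ^ (-a - 1) :=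
        Real.rpow_le_rpow_of_nonpos (by linarith [hx.1]) (by linarith [hx.2]) (by linarith)
      rw [Real.mul_rpow (by norm_num) (by linarith)] at h1
      nlinarith)
  linarith

namespace OscillatoryFlow

variable {α β S : ℝ} {H x₀ x₁ x₂ x₃ : ℝ → ℝ}

theorem adiab_pos (h : OscillatoryFlow α β S H x₀ x₁ x₂ x₃) {s : ℝ} (hs : S ≤ s) :
    0 < adiab x₀ x₁ x₂ x₃ s := by
  have := h.amp_pos hs
  have := h.pos.trans_le hs
  exact lt_of_lt_of_le (by positivity) (h.adiab_bounds hs).1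

/-- With `δ` a small constant, each step changes `adiab` by a factor within `1 ± 1/(8s)` and
lengthens the time by at least `2`. Hence `adiab⁴/s` cannot increase and `adiab⁴ s` cannot decrease
along the steps. Since `adiab` is comparable to `s amp²`, this bounds `amp` between multiples of
`s^(-5/8)` and `s^(-3/8)`. -/
theorem exists_amp_pow_bounds (h : OscillatoryFlow α β S H x₀ x₁ x₂ x₃) :
    ∃ S' C c, S ≤ S' ∧ 0 < c ∧ ∀ s, S' ≤ s → s ^ 3 * amp x₀ x₁ x₂ x₃ s ^ 8 ≤ C ∧
      c ≤ s ^ 5 * amp x₀ x₁ x₂ x₃ s ^ 8 := by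
  have hM := adiabConst_pos α β
  -- The second entry of the minimum makes the relative variation `2 · adiabConst · δ / s` at most
  -- `1/(8s)`.
  obtain ⟨S₁, hS₁, hsm⟩ := h.eventually_small (δ := min (1 / 2) (1 / (16 * adiabConst α β)))
    (by positivity)
  have hS := h.le_time
  set S₂ := max S₁ (2 * S) with hS₂
  have hS₂1 : S₁ ≤ S₂ := le_max_left _ _
  have hS₂2 : 2 * S ≤ S₂ := le_max_right _ _
  have hstep : ∀ s, S₂ ≤ s → ∃ s', s + 2 ≤ s' ∧ s' ≤ s + 12 ∧
      |adiab x₀ x₁ x₂ x₃ s' - adiab x₀ x₁ x₂ x₃ s| ≤ 1 / 8 * (1 / s) * adiab x₀ x₁ x₂ x₃ s := by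
    intro s hs
    obtain ⟨s', a1, a2, a3, -⟩ := h.exists_step (s := s) (hS₂2.trans hs) (min_le_left _ _)
      (fun t ht => hsm t ((hS₂1.trans hs).trans ht.1))
    refine ⟨s', a1, a2, a3.trans ?_⟩
    have hs0 : 0 < s := by linarith
    have hG := h.adiab_pos (s := s) (by linarith)
    refine mul_le_mul_of_nonneg_right ?_ hG.le
    calc 2 * adiabConst α β * (min (1 / 2) (1 / (16 * adiabConst α β)) / s)
        ≤ 2 * adiabConst α β * ((1 / (16 * adiabConst α β)) / s) := by
          gcongr; exact min_le_right _ _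
      _ = _ := by field_simp; norm_num
  have hup : ∀ s, S₂ ≤ s → ∃ s', s + 2 ≤ s' ∧ s' ≤ s + 12 ∧
      adiab x₀ x₁ x₂ x₃ s' ^ 4 / s' ≤ adiab x₀ x₁ x₂ x₃ s ^ 4 / s := by
    intro s hs
    obtain ⟨s', a1, a2, a3⟩ := hstep s hs
    refine ⟨s', a1, a2, ?_⟩
    have hs0 : 1000 ≤ s := by linarith
    have hG := h.adiab_pos (s := s) (by linarith)
    have hG' := h.adiab_pos (s := s') (by linarith)
    have hle : adiab x₀ x₁ x₂ x₃ s' ≤ adiab x₀ x₁ x₂ x₃ s * (1 + 1 / 8 * (1 / s)) := by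
      linarith [(abs_le.1 a3).2]
    rw [div_le_div_iff₀ (by linarith) (by linarith)]
    have hu : 1 / s ≤ 1 := by rw [div_le_one (by linarith)]; linarith
    have hu0 : 0 < 1 / s := by positivity
    have hus : 1 / s * s = 1 := by field_simp
    have hpow : (1 + 1 / 8 * (1 / s)) ^ 4 ≤ 1 + 1 / s := by
      generalize 1 / s = u at hu hu0
      have h2 : u ^ 2 ≤ u := by nlinarith
      have h3 : u ^ 3 ≤ u := by nlinarith
      have h4 : u ^ 4 ≤ u := by nlinarith [sq_nonneg u]
      linarith
    calc adiab x₀ x₁ x₂ x₃ s' ^ 4 * s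
        ≤ (adiab x₀ x₁ x₂ x₃ s * (1 + 1 / 8 * (1 / s))) ^ 4 * s := by gcongr
      _ = adiab x₀ x₁ x₂ x₃ s ^ 4 * ((1 + 1 / 8 * (1 / s)) ^ 4 * s) := by ring
      _ ≤ adiab x₀ x₁ x₂ x₃ s ^ 4 * ((1 + 1 / s) * s) := by gcongr
      _ ≤ adiab x₀ x₁ x₂ x₃ s ^ 4 * s' := by gcongr; linarith
  have hlow : ∀ s, S₂ ≤ s → ∃ s', s + 2 ≤ s' ∧ s' ≤ s + 12 ∧
      -(adiab x₀ x₁ x₂ x₃ s' ^ 4 * s') ≤ -(adiab x₀ x₁ x₂ x₃ s ^ 4 * s) := by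
    intro s hs
    obtain ⟨s', a1, a2, a3⟩ := hstep s hs
    refine ⟨s', a1, a2, neg_le_neg ?_⟩
    have hs0 : 1000 ≤ s := by linarith
    have hG := h.adiab_pos (s := s) (by linarith)
    have hu : 1 / s ≤ 1 := by rw [div_le_one (by linarith)]; linarith
    have hu0 : 0 < 1 / s := by positivity
    have hus : 1 / s * s = 1 := by field_simp
    have hle : adiab x₀ x₁ x₂ x₃ s * (1 - 1 / 8 * (1 / s)) ≤ adiab x₀ x₁ x₂ x₃ s' := by
      linarith [(abs_le.1 a3).1]
    have hpow : 1 - 1 / 2 * (1 / s) ≤ (1 - 1 / 8 * (1 / s)) ^ 4 := by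
      have := one_add_mul_le_pow (a := -(1 / 8 * (1 / s))) (by linarith) 4
      push_cast at this
      rw [← sub_eq_add_neg] at this
      linarith
    have hnn : 0 ≤ adiab x₀ x₁ x₂ x₃ s * (1 - 1 / 8 * (1 / s)) :=
      mul_nonneg hG.le (by linarith)
    calc adiab x₀ x₁ x₂ x₃ s ^ 4 * s
        ≤ adiab x₀ x₁ x₂ x₃ s ^ 4 * ((1 - 1 / 2 * (1 / s)) * (s + 2)) := by
          gcongr; linarith
      _ ≤ adiab x₀ x₁ x₂ x₃ s ^ 4 * ((1 - 1 / 8 * (1 / s)) ^ 4 * (s + 2)) := by gcongr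
      _ = (adiab x₀ x₁ x₂ x₃ s * (1 - 1 / 8 * (1 / s))) ^ 4 * (s + 2) := by ring
      _ ≤ adiab x₀ x₁ x₂ x₃ s' ^ 4 * s' := by gcongr
  have hS₂0 : 0 < S₂ := by linarith
  have hG₂ := h.adiab_pos (s := S₂) (by linarith)
  refine ⟨S₂, 2 ^ 8 * 2 ^ 3 * (2 ^ 4 * (adiab x₀ x₁ x₂ x₃ S₂ ^ 4 / S₂)),
    adiab x₀ x₁ x₂ x₃ S₂ ^ 4 * S₂ / 2 ^ 12, by linarith, by positivity, fun s hs => ⟨?_, ?_⟩⟩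
  · obtain ⟨t, t1, t2, t3, t4⟩ :=
      exists_le_of_forall_step (Ψ := fun s => adiab x₀ x₁ x₂ x₃ s ^ 4 / s) hup hs
    have ht0 : 0 < t := by linarith
    have hs0 : 0 < s := by linarith
    have hr := h.amp_pos (s := t) (by linarith)
    have hrs := h.amp_pos (s := s) (by linarith)
    have hrt : amp x₀ x₁ x₂ x₃ s ≤ 2 * amp x₀ x₁ x₂ x₃ t := by
      have := (h.amp_step (a := t) (b := s) (by linarith) t2 t3).1
      linarith
    have hb := (h.adiab_bounds (s := t) (by linarith)).1
    have hb4 : (1 / 2 * (t * amp x₀ x₁ x₂ x₃ t ^ 2)) ^ 4 ≤ adiab x₀ x₁ x₂ x₃ t ^ 4 := by gcongr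
    have h1 : t ^ 3 * amp x₀ x₁ x₂ x₃ t ^ 8 ≤ 2 ^ 4 * (adiab x₀ x₁ x₂ x₃ t ^ 4 / t) := by
      rw [mul_div_assoc', le_div_iff₀ ht0]
      linarith
    calc s ^ 3 * amp x₀ x₁ x₂ x₃ s ^ 8 ≤ (2 * t) ^ 3 * (2 * amp x₀ x₁ x₂ x₃ t) ^ 8 := by
          gcongr
          linarith
      _ = 2 ^ 8 * 2 ^ 3 * (t ^ 3 * amp x₀ x₁ x₂ x₃ t ^ 8) := by ring
      _ ≤ _ := by
        refine mul_le_mul_of_nonneg_left (h1.trans ?_) (by norm_num)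
        exact mul_le_mul_of_nonneg_left t4 (by norm_num)
  · obtain ⟨t, t1, t2, t3, t4⟩ :=
      exists_le_of_forall_step (Ψ := fun s => -(adiab x₀ x₁ x₂ x₃ s ^ 4 * s)) hlow hs
    have ht0 : 0 < t := by linarith
    have hs0 : 0 < s := by linarith
    have hr := h.amp_pos (s := t) (by linarith)
    have hrs := h.amp_pos (s := s) (by linarith)
    have hrt : amp x₀ x₁ x₂ x₃ t ≤ 2 * amp x₀ x₁ x₂ x₃ s := by
      have := (h.amp_step (a := t) (b := s) (by linarith) t2 t3).2
      linarith
    have hb := (h.adiab_bounds (s := t) (by linarith)).2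
    have hGt := h.adiab_pos (s := t) (by linarith)
    have t4' := neg_le_neg_iff.1 t4
    rw [div_le_iff₀ (by norm_num)]
    calc adiab x₀ x₁ x₂ x₃ S₂ ^ 4 * S₂ ≤ adiab x₀ x₁ x₂ x₃ t ^ 4 * t := t4'
      _ ≤ (2 * (t * amp x₀ x₁ x₂ x₃ t ^ 2)) ^ 4 * t := by gcongr
      _ ≤ (2 * (s * (2 * amp x₀ x₁ x₂ x₃ s) ^ 2)) ^ 4 * s := by gcongr
      _ = _ := by ring

/-- A rate of decay of the amplitude is also a rate of convergence of `H`. -/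
theorem exists_H_le (h : OscillatoryFlow α β S H x₀ x₁ x₂ x₃) {a C : ℝ} (ha : 0 < a)
    (hC : ∀ s, S ≤ s → amp x₀ x₁ x₂ x₃ s ≤ C * s ^ (-a)) :
    ∃ M, ∀ s, 2 * S ≤ s → |H s - 1| ≤ M * s ^ (-a) := by
  have hS := h.le_time
  have hc : 0 < 2 * a * 2 ^ (-a - 1) := by positivity
  set c : ℝ := 2 * a * 2 ^ (-a - 1)
  have hR := reflConst_pos
  have hC0 : 0 ≤ C := by
    have h1 := (h.amp_pos le_rfl).trans_le (hC S le_rfl)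
    have h2 : 0 < S ^ (-a) := Real.rpow_pos_of_pos h.pos _
    exact (pos_of_mul_pos_left h1 h2.le).le
  refine ⟨2 * reflConst * C / c, fun s hs => ?_⟩
  have hlim : Tendsto (fun s => |H s - 1| - 2 * reflConst * C / c * s ^ (-a)) atTop (𝓝 0) := by
    have h1 : Tendsto (fun s => |H s - 1|) atTop (𝓝 0) := by
      simpa using (h.tendsto_H.sub_const 1).abs
    simpa using h1.sub ((tendsto_rpow_neg_atTop ha).const_mul (2 * reflConst * C / c))
  -- Over one step `|H - 1|` loses at most a multiple of `amp/s`, hence of `s^(-a-1)`, and the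
  -- subtracted power drops by at least as much. The difference therefore does not decrease along
  -- the steps, and its limit is zero.
  have := nonpos_of_forall_step hlim (S := 2 * S) (fun s hs => by
    obtain ⟨s', a1, a2, -, a3⟩ := h.exists_step hs (δ := 1 / 1000000) (by norm_num)
      (fun t ht => h.small' (by linarith [ht.1]))
    refine ⟨s', a1, ?_⟩
    have hs0 : 0 < s := by linarith
    have hr := hC s (by linarith)
    have e1 : s ^ (-a - 1) = s ^ (-a) / s := by
      rw [Real.rpow_sub hs0, Real.rpow_one]
    have h1 : 2 * reflConst * (amp x₀ x₁ x₂ x₃ s / s) ≤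
        2 * reflConst * C / c * (c * s ^ (-a - 1)) := by
      have : 2 * reflConst * C / c * (c * s ^ (-a - 1)) = 2 * reflConst * (C * s ^ (-a) / s) := by
        rw [e1]; field_simp
      rw [this]
      gcongr
    have h2 := rpow_neg_sub_rpow_neg_ge ha (s := s) (by linarith)
    have h3 : s' ^ (-a) ≤ (s + 2) ^ (-a) :=
      Real.rpow_le_rpow_of_nonpos (by linarith) a1 (by linarith)
    have h4 : 2 * reflConst * C / c * (c * s ^ (-a - 1)) ≤
        2 * reflConst * C / c * (s ^ (-a) - s' ^ (-a)) := by
      refine mul_le_mul_of_nonneg_left ?_ (by positivity)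
      linarith
    have h5 : |H s - 1| ≤ |H s' - 1| + |H s' - H s| := by
      have : H s - 1 = (H s' - 1) - (H s' - H s) := by ring
      rw [this]
      exact abs_sub _ _
    linarith) hs
  linarith

/-- A bootstrap: the crude bound `amp = O(s^(-3/8))` makes every small quantity of the flow
`O(s^(-3/8))`, so the relative variation of `adiab` per step becomes `O(s^(-11/8))`, which is
summable. Then `adiab` is bounded above, and `amp = O(s^(-1/2))`. -/
theorem exists_decay (h : OscillatoryFlow α β S H x₀ x₁ x₂ x₃) :
    ∃ S' C c, S ≤ S' ∧ 0 < c ∧ ∀ s, S' ≤ s → |H s - 1| ≤ C * s ^ (-(1 / 2) : ℝ) ∧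
      c * s ^ (-(5 / 8) : ℝ) ≤ amp x₀ x₁ x₂ x₃ s := by
  obtain ⟨S₁, C₁, c₁, hS₁, hc₁, hb⟩ := h.exists_amp_pow_bounds
  have hS := h.le_time
  have hlow : ∀ s, S₁ ≤ s → c₁ ^ (1 / 8 : ℝ) * s ^ (-(5 / 8) : ℝ) ≤ amp x₀ x₁ x₂ x₃ s := by
    intro s hs
    have hs0 : 0 < s := by linarith
    have hr := h.amp_pos (hS₁.trans hs)
    have h1 : c₁ ≤ (s ^ (5 / 8 : ℝ) * amp x₀ x₁ x₂ x₃ s) ^ 8 := by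
      rw [mul_pow, ← Real.rpow_natCast (s ^ (5 / 8 : ℝ)), ← Real.rpow_mul hs0.le]
      have := (hb s hs).2
      rw [← Real.rpow_natCast s] at this
      convert this using 3
      norm_num
    have h2 := Real.rpow_le_rpow hc₁.le h1 (by norm_num : (0 : ℝ) ≤ 1 / 8)
    rw [← Real.rpow_natCast, ← Real.rpow_mul (by positivity)] at h2
    norm_num at h2
    rw [Real.rpow_neg hs0.le, ← div_eq_mul_inv, div_le_iff₀ (by positivity)]
    norm_num
    linarith
  have hup : ∀ s, S₁ ≤ s → amp x₀ x₁ x₂ x₃ s ≤ C₁ ^ (1 / 8 : ℝ) * s ^ (-(3 / 8) : ℝ) := by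
    intro s hs
    have hs0 : 0 < s := by linarith
    have hr := h.amp_pos (hS₁.trans hs)
    have h1 : (s ^ (3 / 8 : ℝ) * amp x₀ x₁ x₂ x₃ s) ^ 8 ≤ C₁ := by
      rw [mul_pow, ← Real.rpow_natCast (s ^ (3 / 8 : ℝ)), ← Real.rpow_mul hs0.le]
      have := (hb s hs).1
      rw [← Real.rpow_natCast s] at this
      convert this using 3
      norm_num
    have h2 := Real.rpow_le_rpow (by positivity) h1 (by norm_num : (0 : ℝ) ≤ 1 / 8)
    rw [← Real.rpow_natCast, ← Real.rpow_mul (by positivity)] at h2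
    norm_num at h2
    rw [Real.rpow_neg hs0.le, ← div_eq_mul_inv, le_div_iff₀ (by positivity)]
    norm_num
    linarith
  have h₁ := h.mono hS₁
  obtain ⟨M, hM⟩ := h₁.exists_H_le (by norm_num : (0 : ℝ) < 3 / 8) hup
  -- all small quantities are bounded by a multiple of `s ^ (-3/8)`
  obtain ⟨B, hB, hBC, hBM, hB1⟩ : ∃ B : ℝ, 0 < B ∧ C₁ ^ (1 / 8 : ℝ) ≤ B ∧ M ≤ B ∧ 1 ≤ B :=
    ⟨max (max (C₁ ^ (1 / 8 : ℝ)) M) 1, lt_of_lt_of_le one_pos (le_max_right _ _),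
      (le_max_left _ _).trans (le_max_left _ _), (le_max_right _ _).trans (le_max_left _ _),
      le_max_right _ _⟩
  have hsm : ∀ s, 2 * S₁ ≤ s → FlowSmall H x₀ x₁ x₂ x₃ (B * s ^ (-(3 / 8) : ℝ)) s := by
    intro s hs
    have hs0 : 0 < s := by linarith
    have hp : 0 < s ^ (-(3 / 8) : ℝ) := by positivity
    have hr : amp x₀ x₁ x₂ x₃ s ≤ B * s ^ (-(3 / 8) : ℝ) :=
      (hup s (by linarith)).trans (by gcongr)
    obtain ⟨b0, b1, b2, b3⟩ := h.x_le (s := s) (by linarith)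
    refine ⟨(hM s hs).trans (by gcongr), b0.trans hr, b1.trans hr, b2.trans hr, b3.trans hr, ?_⟩
    calc 1 / (5 * s) ≤ 1 / s := one_div_le_one_div_of_le hs0 (by linarith)
      _ = s ^ (-1 : ℝ) := by rw [Real.rpow_neg_one, one_div]
      _ ≤ s ^ (-(3 / 8) : ℝ) := Real.rpow_le_rpow_of_exponent_le (by linarith) (by norm_num)
      _ ≤ B * s ^ (-(3 / 8) : ℝ) := le_mul_of_one_le_left hp.le hB1
  obtain ⟨S₂, hS₂⟩ : ∃ S₂, ∀ s, S₂ ≤ s → B * s ^ (-(3 / 8) : ℝ) ≤ 1 / 2 := by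
    have h1 : Tendsto (fun s : ℝ => B * s ^ (-(3 / 8) : ℝ)) atTop (𝓝 0) := by
      simpa using (tendsto_rpow_neg_atTop (by norm_num : (0 : ℝ) < 3 / 8)).const_mul B
    exact eventually_atTop.1 (h1.eventually_le_const (by norm_num))
  set S₃ := max S₂ (2 * S₁)
  have hS₃2 : S₂ ≤ S₃ := le_max_left _ _
  have hS₃1 : 2 * S₁ ≤ S₃ := le_max_right _ _
  have hA := adiabConst_pos α β
  set c : ℝ := 2 * (3 / 8) * 2 ^ (-(3 / 8) - 1 : ℝ) with hc
  have hc0 : 0 < c := by positivity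
  set N := 2 * adiabConst α β * B / c with hN
  have hN0 : 0 < N := by positivity
  -- The exponential factor is the sum of the relative variations from `s` onwards; `N` is chosen so
  -- that its decrease over a step compensates the possible growth of `adiab`.
  have hstep : ∀ s, S₃ ≤ s → ∃ s', s + 2 ≤ s' ∧ s' ≤ s + 12 ∧
      adiab x₀ x₁ x₂ x₃ s' * Real.exp (N * s' ^ (-(3 / 8) : ℝ)) ≤
        adiab x₀ x₁ x₂ x₃ s * Real.exp (N * s ^ (-(3 / 8) : ℝ)) := by
    intro s hs
    have hs0 : 0 < s := by linarith
    obtain ⟨s', a1, a2, a3, -⟩ := h.exists_step (s := s) (by linarith) (hS₂ s (hS₃2.trans hs))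
      (fun t ht => by
        have ht' := hsm t (by linarith [ht.1])
        have hle : B * t ^ (-(3 / 8) : ℝ) ≤ B * s ^ (-(3 / 8) : ℝ) :=
          mul_le_mul_of_nonneg_left
            (Real.rpow_le_rpow_of_nonpos hs0 ht.1 (by norm_num)) hB.le
        exact ⟨ht'.1.trans hle, ht'.2.trans hle, ht'.3.trans hle, ht'.4.trans hle,
          ht'.5.trans hle, ht'.6.trans hle⟩)
    refine ⟨s', a1, a2, ?_⟩
    have hG := h.adiab_pos (s := s) (by linarith)
    have e1 : s ^ (-(3 / 8) - 1 : ℝ) = s ^ (-(3 / 8) : ℝ) / s := by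
      rw [Real.rpow_sub hs0, Real.rpow_one]
    have e2 : 2 * adiabConst α β * (B * s ^ (-(3 / 8) : ℝ) / s) =
        N * (c * s ^ (-(3 / 8) - 1 : ℝ)) := by
      rw [e1, hN]; field_simp
    rw [e2] at a3
    have h2 := rpow_neg_sub_rpow_neg_ge (by norm_num : (0 : ℝ) < 3 / 8) (s := s) (by linarith)
    have h3 : s' ^ (-(3 / 8) : ℝ) ≤ (s + 2) ^ (-(3 / 8) : ℝ) :=
      Real.rpow_le_rpow_of_nonpos (by linarith) a1 (by norm_num)
    set w := c * s ^ (-(3 / 8) - 1 : ℝ)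
    have h4 : N * w + N * s' ^ (-(3 / 8) : ℝ) ≤ N * s ^ (-(3 / 8) : ℝ) := by
      rw [← mul_add]
      exact mul_le_mul_of_nonneg_left (by linarith) hN0.le
    calc adiab x₀ x₁ x₂ x₃ s' * Real.exp (N * s' ^ (-(3 / 8) : ℝ))
        ≤ (adiab x₀ x₁ x₂ x₃ s * Real.exp (N * w)) * Real.exp (N * s' ^ (-(3 / 8) : ℝ)) := by
          refine mul_le_mul_of_nonneg_right ?_ (Real.exp_pos _).le
          have := (abs_le.1 a3).2
          have h5 := Real.add_one_le_exp (N * w)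
          nlinarith
      _ = adiab x₀ x₁ x₂ x₃ s * Real.exp (N * w + N * s' ^ (-(3 / 8) : ℝ)) := by
          rw [mul_assoc, ← Real.exp_add]
      _ ≤ _ := by gcongr
  set G := adiab x₀ x₁ x₂ x₃ S₃ * Real.exp (N * S₃ ^ (-(3 / 8) : ℝ))
  have hG0 : 0 < G := mul_pos (h.adiab_pos (by linarith)) (Real.exp_pos _)
  have hup' : ∀ s, S₃ ≤ s → amp x₀ x₁ x₂ x₃ s ≤ √(16 * G) * s ^ (-(1 / 2) : ℝ) := by
    intro s hs
    obtain ⟨t, t1, t2, t3, t4⟩ := exists_le_of_forall_step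
      (Ψ := fun s => adiab x₀ x₁ x₂ x₃ s * Real.exp (N * s ^ (-(3 / 8) : ℝ))) hstep hs
    have ht0 : 0 < t := by linarith
    have hs0 : 0 < s := by linarith
    have hrs := h.amp_pos (s := s) (by linarith)
    have hrt : amp x₀ x₁ x₂ x₃ s ≤ 2 * amp x₀ x₁ x₂ x₃ t := by
      have := (h.amp_step (a := t) (b := s) (by linarith) t2 t3).1
      have := h.amp_pos (s := t) (by linarith)
      linarith
    have hb := (h.adiab_bounds (s := t) (by linarith)).1
    have hGt := h.adiab_pos (s := t) (by linarith)
    have h5 : adiab x₀ x₁ x₂ x₃ t ≤ G := by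
      refine le_trans (le_mul_of_one_le_right hGt.le ?_) t4
      exact Real.one_le_exp (by positivity)
    have h6 : s * amp x₀ x₁ x₂ x₃ s ^ 2 ≤ 16 * G := by
      have : s * amp x₀ x₁ x₂ x₃ s ^ 2 ≤ (2 * t) * (2 * amp x₀ x₁ x₂ x₃ t) ^ 2 := by
        gcongr; linarith
      linarith
    have h7 : amp x₀ x₁ x₂ x₃ s * √s ≤ √(16 * G) := by
      refine Real.le_sqrt_of_sq_le ?_
      rw [mul_pow, Real.sq_sqrt hs0.le]
      linarith
    rw [Real.rpow_neg hs0.le, ← Real.sqrt_eq_rpow, ← div_eq_mul_inv,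
      le_div_iff₀ (Real.sqrt_pos.2 hs0)]
    exact h7
  obtain ⟨M', hM'⟩ := (h.mono (by linarith : S ≤ S₃)).exists_H_le (by norm_num : (0 : ℝ) < 1 / 2)
    hup'
  exact ⟨2 * S₃, M', c₁ ^ (1 / 8 : ℝ), by linarith, by positivity, fun s hs =>
    ⟨hM' s hs, hlow s (by linarith)⟩⟩

/-- The amplitude is controlled by the oscillation of `H` over a bounded time. -/
theorem amp_le_sum (h : OscillatoryFlow α β S H x₀ x₁ x₂ x₃) {s : ℝ} (hs : S ≤ s) :
    amp x₀ x₁ x₂ x₃ s ≤ 2 * (|H s - 1| + |H (s + Real.pi / 2) - 1| + |H (s + Real.pi) - 1|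
      + |H (s + Real.pi / 2 + Real.pi) - 1|) := by
  have hpi := Real.pi_gt_three
  have hpi' := Real.pi_lt_d2
  -- Since `H' = x₀ = (p + q)/4 + c₁/2`, the rotation cancels in the derivative of `H + c₂/2`,
  -- leaving only small terms. Over a half period `c₂` changes sign, so the change of `H` is
  -- approximately `c₂(a)`. A shift by `π/2` gives control of `c₁` too.
  have half : ∀ a, S ≤ a → |x₁ a - x₃ a| ≤ |H a - 1| + |H (a + Real.pi) - 1|
      + 173 / 1000 * amp x₀ x₁ x₂ x₃ a := by
    intro a ha
    have hra := h.amp_pos ha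
    have := abs_sub_le_of_hasDerivAt (a := 0) (b := Real.pi) (by linarith)
      (M := 54 / 1000 * amp x₀ x₁ x₂ x₃ a)
      (fun t ht => ((h.hasDerivAt_H (a + t) (by linarith [ht.1])).comp_const_add a t).add
        (((h.near.hasDerivAt_c₂ (a + t) (by linarith [ht.1])).comp_const_add a t).div_const 2))
      (fun t ht => by
        have hat : S ≤ a + t := by linarith [ht.1]
        have hr := (h.amp_step (b := a + t) ha (by linarith [ht.1]) (by linarith [ht.2])).1
        obtain ⟨hp, hq, -, -⟩ := h.components_le hat
        have he := (h.near.e₂_le _ hat).trans (h.total_le hat)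
        generalize (-(2 * (1 / (5 * (a + t)))) * x₁ (a + t)
          - (reducedForce α β (H (a + t)) (x₀ (a + t)) (x₁ (a + t)) (x₂ (a + t)) (x₃ (a + t))
            - x₀ (a + t) - 4 * (1 / (5 * (a + t))) * x₃ (a + t))) = e at he
        rw [abs_le] at hp hq he ⊢
        constructor <;> linarith)
    simp only [Pi.add_apply, add_zero, sub_zero] at this
    have rot := (h.rotation ha (y := Real.pi) (by linarith) (by linarith)).2
    rw [Real.cos_pi, Real.sin_pi] at rot
    have hM : 54 / 1000 * amp x₀ x₁ x₂ x₃ a * Real.pi ≤ 1702 / 10000 * amp x₀ x₁ x₂ x₃ a := by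
      nlinarith
    have hH1 := abs_le.1 (le_refl |H a - 1|)
    have hH2 := abs_le.1 (le_refl |H (a + Real.pi) - 1|)
    rw [abs_le] at this rot ⊢
    constructor <;> linarith
  have hr := h.amp_pos hs
  have h1 := half s hs
  have h2 := half (s + Real.pi / 2) (by linarith)
  have hr' := (h.amp_step (b := s + Real.pi / 2) hs (by linarith) (by linarith)).1
  have rot := (h.rotation hs (y := Real.pi / 2) (by linarith) (by linarith)).2
  rw [Real.cos_pi_div_two, Real.sin_pi_div_two] at rot
  have h3 : |x₀ s - x₂ s| ≤ |x₁ (s + Real.pi / 2) - x₃ (s + Real.pi / 2)|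
      + 1 / 1000 * amp x₀ x₁ x₂ x₃ s := by
    have := abs_le.1 (le_refl |x₁ (s + Real.pi / 2) - x₃ (s + Real.pi / 2)|)
    rw [abs_le] at rot ⊢
    constructor <;> linarith
  have h4 : amp x₀ x₁ x₂ x₃ s ≤ |x₀ s - x₂ s| + |x₁ s - x₃ s| := by
    refine le_of_sq_le_sq ?_ (by positivity)
    rw [h.sq_amp hs, ← sq_abs (x₀ s - x₂ s), ← sq_abs (x₁ s - x₃ s)]
    nlinarith [abs_nonneg (x₀ s - x₂ s), abs_nonneg (x₁ s - x₃ s)]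
  linarith

end OscillatoryFlow

/-! ### One half of a shock profile -/

/-- A solution of the profile equation on `ℝ`, normalized so that it tends to `1` at `+∞`. -/
structure IsHalfProfile (m k : ℕ) (h : ℝ → ℝ) : Prop where
  add_eq : m + k = 5
  one_le : 1 ≤ m
  contDiff : ContDiff ℝ 5 h
  ode : ∀ z : ℝ, iteratedDeriv k (fun y => h y * iteratedDeriv m h y) z = z / 5 * deriv h z
  tendsto : Tendsto h atTop (𝓝 1)
  zero : h 0 = 0
  second_zero : iteratedDeriv 2 h 0 = 0

theorem IsShockProfile.neg_isHalfProfile {m k : ℕ} {g : ℝ → ℝ} (hm : 1 ≤ m) (hmk : m + k = 5)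
    (hg : IsShockProfile m k g) : IsHalfProfile m k (-g) where
  add_eq := hmk
  one_le := hm
  contDiff := hg.contDiff.neg
  ode z := by
    have e : (fun y => (-g) y * iteratedDeriv m (-g) y) = fun y => g y * iteratedDeriv m g y := by
      ext y
      rw [iteratedDeriv_neg, Pi.neg_apply, neg_mul_neg]
    rw [e, hg.ode, deriv.neg]
    ring
  tendsto := by
    have := hg.tendsto_atTop.neg
    rw [neg_neg] at this
    exact this
  zero := by simp [hg.zero]
  second_zero := by rw [iteratedDeriv_neg, hg.second_zero, neg_zero]

/-- The five derivatives together contribute `(-1)⁵` under reflection, which agrees with the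
right-hand side up to the sign required by the normalization. -/
theorem IsShockProfile.comp_neg_isHalfProfile {m k : ℕ} {g : ℝ → ℝ} (hm : 1 ≤ m)
    (hmk : m + k = 5) (hg : IsShockProfile m k g) : IsHalfProfile m k (fun z => g (-z)) where
  add_eq := hmk
  one_le := hm
  contDiff := hg.contDiff.comp contDiff_neg
  ode z := by
    have e : (fun y => g (-y) * iteratedDeriv m (fun z => g (-z)) y) =
        fun y => (-1) ^ m * (fun w => g w * iteratedDeriv m g w) (-y) := by
      ext y
      rw [iteratedDeriv_comp_neg, smul_eq_mul]
      ring
    rw [e, iteratedDeriv_const_mul_field,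
      iteratedDeriv_comp_neg k (fun w => g w * iteratedDeriv m g w) z, hg.ode, deriv_comp_neg,
      smul_eq_mul, ← mul_assoc, ← pow_add, hmk]
    ring
  tendsto := hg.tendsto_atBot.comp tendsto_neg_atTop_atBot
  zero := by simp [hg.zero]
  second_zero := by rw [iteratedDeriv_comp_neg, neg_zero, hg.second_zero, smul_zero]

namespace IsHalfProfile

variable {m k : ℕ} {h : ℝ → ℝ}

theorem hasDerivAt (hp : IsHalfProfile m k h) {j : ℕ} (hj : j < 5) (z : ℝ) :
    HasDerivAt (iteratedDeriv j h) (iteratedDeriv (j + 1) h z) z := by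
  rw [iteratedDeriv_succ]
  exact (hp.contDiff.differentiable_iteratedDeriv j (by exact_mod_cast hj) z).hasDerivAt

theorem contDiff_flux (hp : IsHalfProfile m k h) :
    ContDiff ℝ k (fun y => h y * iteratedDeriv m h y) := by
  have h5 := hp.contDiff
  have e : ((5 : ℕ) : WithTop ℕ∞) = 5 := rfl
  refine (h5.of_le ?_).mul ?_
  · rw [← e, ← hp.add_eq]; exact_mod_cast Nat.le_add_left k m
  · rw [iteratedDeriv_eq_iterate]
    apply ContDiff.iterate_deriv'
    rw [add_comm k m, hp.add_eq]
    exact h5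

theorem hasDerivAt_flux (hp : IsHalfProfile m k h) {i : ℕ} (hi : i < k) (z : ℝ) :
    HasDerivAt (iteratedDeriv i fun y => h y * iteratedDeriv m h y)
      (iteratedDeriv (i + 1) (fun y => h y * iteratedDeriv m h y) z) z := by
  rw [iteratedDeriv_succ]
  exact (hp.contDiff_flux.differentiable_iteratedDeriv i (by exact_mod_cast hi) z).hasDerivAt

theorem flux_leibniz (hp : IsHalfProfile m k h) {i : ℕ} (hi : i ≤ k) (z : ℝ) :
    iteratedDeriv i (fun y => h y * iteratedDeriv m h y) z =
      ∑ l ∈ Finset.range (i + 1),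
        i.choose l * iteratedDeriv l h z * iteratedDeriv (m + i - l) h z := by
  have h5 := hp.contDiff
  have e : ((5 : ℕ) : WithTop ℕ∞) = 5 := rfl
  rw [iteratedDeriv_fun_mul]
  · refine Finset.sum_congr rfl fun l hl => ?_
    have hl' : l ≤ i := Nat.lt_succ_iff.1 (Finset.mem_range.1 hl)
    rw [iteratedDeriv_eq_iterate (n := i - l), iteratedDeriv_eq_iterate (n := m),
      ← Function.iterate_add_apply, ← iteratedDeriv_eq_iterate (n := i - l + m)]
    congr 3
    omega
  · refine (h5.of_le ?_).contDiffAt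
    rw [← e, ← hp.add_eq]; exact_mod_cast hi.trans (Nat.le_add_left k m)
  · rw [iteratedDeriv_eq_iterate]
    apply ContDiff.contDiffAt
    apply ContDiff.iterate_deriv'
    refine h5.of_le ?_
    rw [← e, ← hp.add_eq]; exact_mod_cast (by omega : i + m ≤ m + k)

/-- The profile equation in non-divergence form. -/
theorem exists_expanded (hp : IsHalfProfile m k h) : ∃ α β : ℝ, ∀ z,
    h z * iteratedDeriv 5 h z + α * (iteratedDeriv 1 h z * iteratedDeriv 4 h z)
      + β * (iteratedDeriv 2 h z * iteratedDeriv 3 h z) = z / 5 * iteratedDeriv 1 h z := by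
  have key : ∀ z, z / 5 * iteratedDeriv 1 h z = ∑ l ∈ Finset.range (k + 1),
        k.choose l * iteratedDeriv l h z * iteratedDeriv (m + k - l) h z := fun z => by
    rw [← hp.flux_leibniz le_rfl, hp.ode, iteratedDeriv_one]
  have h1 := hp.one_le
  have h2 := hp.add_eq
  rw [h2] at key
  have hk : k ≤ 4 := by omega
  interval_cases k
  · exact ⟨0, 0, fun z => by rw [key z]; simp⟩
  · exact ⟨1, 0, fun z => by rw [key z]; simp [Finset.sum_range_succ]⟩
  · exact ⟨2, 1, fun z => by rw [key z]; simp [Finset.sum_range_succ]; ring⟩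
  · refine ⟨3, 4, fun z => ?_⟩
    rw [key z]
    simp [Finset.sum_range_succ, Nat.choose]
    ring
  · refine ⟨5, 10, fun z => ?_⟩
    rw [key z]
    simp [Finset.sum_range_succ, Nat.choose]
    ring

end IsHalfProfile

/-! ### Families of functions on `[-1, 1]` that tend to zero uniformly -/

/-- The family `u ω` tends to zero uniformly on `[-1, 1]` as `ω → ∞`. -/
def UnifSmall (u : ℝ → ℝ → ℝ) : Prop :=
  ∀ ε > 0, ∀ᶠ ω in atTop, ∀ y ∈ Icc (-1 : ℝ) 1, |u ω y| ≤ ε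

/-- The family `u ω` is uniformly bounded on `[-1, 1]` for large `ω`. -/
def UnifBdd (u : ℝ → ℝ → ℝ) : Prop :=
  ∃ C > 0, ∀ᶠ ω in atTop, ∀ y ∈ Icc (-1 : ℝ) 1, |u ω y| ≤ C

/-- Every subinterval of `[-1, 1]` of length `ℓ` contains points where `u ω` is small. -/
def SmallPts (ℓ : ℝ) (u : ℝ → ℝ → ℝ) : Prop :=
  ∀ ε > 0, ∀ᶠ ω in atTop, ∀ a b, -1 ≤ a → b ≤ 1 → a + ℓ ≤ b → ∃ c ∈ Icc a b, |u ω c| ≤ ε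

/-- `v ω` is the derivative of `u ω` on `[-1, 1]` for large `ω`. -/
def UnifDeriv (u v : ℝ → ℝ → ℝ) : Prop :=
  ∀ᶠ ω in atTop, ∀ y ∈ Icc (-1 : ℝ) 1, HasDerivAt (u ω) (v ω y) y

theorem UnifSmall.bdd {u : ℝ → ℝ → ℝ} (hu : UnifSmall u) : UnifBdd u :=
  ⟨1, one_pos, hu 1 one_pos⟩

theorem UnifSmall.congr {u v : ℝ → ℝ → ℝ} (hu : UnifSmall u)
    (h : ∀ᶠ ω in atTop, ∀ y ∈ Icc (-1 : ℝ) 1, v ω y = u ω y) : UnifSmall v := by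
  intro ε hε
  filter_upwards [hu ε hε, h] with ω h1 h2 y hy
  rw [h2 y hy]
  exact h1 y hy

theorem SmallPts.congr {u v : ℝ → ℝ → ℝ} {ℓ : ℝ} (hu : SmallPts ℓ u)
    (h : ∀ᶠ ω in atTop, ∀ y ∈ Icc (-1 : ℝ) 1, v ω y = u ω y) : SmallPts ℓ v := by
  intro ε hε
  filter_upwards [hu ε hε, h] with ω h1 h2 a b ha hb hab
  obtain ⟨c, hc, hc'⟩ := h1 a b ha hb hab
  exact ⟨c, hc, by rwa [h2 c ⟨ha.trans hc.1, hc.2.trans hb⟩]⟩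

theorem UnifSmall.add {u v : ℝ → ℝ → ℝ} (hu : UnifSmall u) (hv : UnifSmall v) :
    UnifSmall (fun ω y => u ω y + v ω y) := by
  intro ε hε
  filter_upwards [hu (ε / 2) (half_pos hε), hv (ε / 2) (half_pos hε)] with ω h1 h2 y hy
  exact (abs_add_le _ _).trans (by linarith [h1 y hy, h2 y hy])

theorem UnifSmall.neg {u : ℝ → ℝ → ℝ} (hu : UnifSmall u) : UnifSmall (fun ω y => -u ω y) := by
  intro ε hε
  filter_upwards [hu ε hε] with ω h1 y hy
  rw [abs_neg]
  exact h1 y hy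

theorem UnifSmall.sub {u v : ℝ → ℝ → ℝ} (hu : UnifSmall u) (hv : UnifSmall v) :
    UnifSmall (fun ω y => u ω y - v ω y) := by
  simp_rw [sub_eq_add_neg]
  exact hu.add hv.neg

theorem UnifSmall.sum {ι : Type*} {s : Finset ι} {u : ι → ℝ → ℝ → ℝ}
    (hu : ∀ i ∈ s, UnifSmall (u i)) : UnifSmall (fun ω y => ∑ i ∈ s, u i ω y) := by
  classical
  induction s using Finset.induction_on with
  | empty =>
    intro ε hε
    filter_upwards with ω y _
    simpa using hε.le
  | insert a s ha ih =>
    simp_rw [Finset.sum_insert ha]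
    exact (hu a (Finset.mem_insert_self a s)).add
      (ih fun i hi => hu i (Finset.mem_insert_of_mem hi))

theorem UnifSmall.mul_bdd {u v : ℝ → ℝ → ℝ} (hu : UnifSmall u) (hv : UnifBdd v) :
    UnifSmall (fun ω y => u ω y * v ω y) := by
  intro ε hε
  obtain ⟨C, hC, hv⟩ := hv
  filter_upwards [hu (ε / C) (by positivity), hv] with ω h1 h2 y hy
  have := abs_mul_le_mul (h1 y hy) (h2 y hy)
  rwa [div_mul_cancel₀ _ hC.ne'] at this

theorem SmallPts.mul_bdd {u v : ℝ → ℝ → ℝ} {ℓ : ℝ} (hu : SmallPts ℓ u) (hv : UnifBdd v) :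
    SmallPts ℓ (fun ω y => u ω y * v ω y) := by
  intro ε hε
  obtain ⟨C, hC, hv⟩ := hv
  filter_upwards [hu (ε / C) (by positivity), hv] with ω h1 h2 a b ha hb hab
  obtain ⟨c, hc, hc'⟩ := h1 a b ha hb hab
  have := abs_mul_le_mul hc' (h2 c ⟨ha.trans hc.1, hc.2.trans hb⟩)
  rw [div_mul_cancel₀ _ hC.ne'] at this
  exact ⟨c, hc, this⟩

theorem UnifSmall.smallPts {u : ℝ → ℝ → ℝ} {ℓ : ℝ} (hℓ : 0 ≤ ℓ) (hu : UnifSmall u) :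
    SmallPts ℓ u := by
  intro ε hε
  filter_upwards [hu ε hε] with ω h1 a b ha hb hab
  exact ⟨a, ⟨le_rfl, by linarith⟩, h1 a ⟨ha, by linarith⟩⟩

theorem SmallPts.sub_unifSmall {u v : ℝ → ℝ → ℝ} {ℓ : ℝ} (hu : SmallPts ℓ u) (hv : UnifSmall v) :
    SmallPts ℓ (fun ω y => u ω y - v ω y) := by
  intro ε hε
  filter_upwards [hu (ε / 2) (half_pos hε), hv (ε / 2) (half_pos hε)] with ω h1 h2 a b ha hb hab
  obtain ⟨c, hc, hc'⟩ := h1 a b ha hb hab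
  exact ⟨c, hc, (abs_sub _ _).trans (by linarith [h2 c ⟨ha.trans hc.1, hc.2.trans hb⟩])⟩

/-- Small values on many subintervals force small values of the derivative, by the mean value
theorem. -/
theorem SmallPts.deriv {u v : ℝ → ℝ → ℝ} {ℓ : ℝ} (hℓ : 0 < ℓ) (hu : SmallPts ℓ u)
    (hd : UnifDeriv u v) : SmallPts (3 * ℓ) v := by
  intro ε hε
  filter_upwards [hu (ε * ℓ / 2) (by positivity), hd] with ω h1 h2 a b ha hb hab
  obtain ⟨c, hc, hc'⟩ := h1 a (a + ℓ) ha (by linarith) le_rfl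
  obtain ⟨d, hd, hd'⟩ := h1 (b - ℓ) b (by linarith) hb (by linarith)
  have hcd : c < d := by linarith [hc.2, hd.1]
  have hder : ∀ x ∈ Icc c d, HasDerivAt (u ω) (v ω x) x := fun x hx =>
    h2 x ⟨by linarith [hx.1, hc.1], by linarith [hx.2, hd.2]⟩
  obtain ⟨x, hx, hxe⟩ := exists_hasDerivAt_eq_slope (u ω) (v ω) hcd
    (fun x hx => (hder x hx).continuousAt.continuousWithinAt)
    (fun x hx => hder x (Ioo_subset_Icc_self hx))
  refine ⟨x, ⟨by linarith [hx.1, hc.1], by linarith [hx.2, hd.2]⟩, ?_⟩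
  rw [hxe, abs_div, abs_of_pos (by linarith : 0 < d - c), div_le_iff₀ (by linarith)]
  calc |u ω d - u ω c| ≤ |u ω d| + |u ω c| := abs_sub _ _
    _ ≤ ε * ℓ := by linarith
    _ ≤ ε * (d - c) := by
      apply mul_le_mul_of_nonneg_left _ hε.le
      linarith [hc.2, hd.1]

/-- One small value is enough when the derivative is small; the bound on `ℓ` ensures that `[-1, 1]`
contains such a point. -/
theorem UnifSmall.of_deriv {u v : ℝ → ℝ → ℝ} {ℓ : ℝ} (hℓ : ℓ ≤ 2) (hv : UnifSmall v)
    (hu : SmallPts ℓ u) (hd : UnifDeriv u v) : UnifSmall u := by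
  intro ε hε
  filter_upwards [hu (ε / 2) (by positivity), hv (ε / 4) (by positivity), hd] with ω h1 h2 h3 y hy
  obtain ⟨c, hc, hc'⟩ := h1 (-1) 1 le_rfl le_rfl (by linarith)
  have h4 : |u ω y - u ω c| ≤ ε / 4 * |y - c| := by
    rcases le_total c y with h | h
    · have := abs_sub_le_of_hasDerivAt h
        (fun x hx => h3 x ⟨hc.1.trans hx.1, hx.2.trans hy.2⟩)
        (fun x hx => h2 x ⟨hc.1.trans hx.1, hx.2.trans hy.2⟩)
      rwa [abs_of_nonneg (by linarith : 0 ≤ y - c)]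
    · have := abs_sub_le_of_hasDerivAt h
        (fun x hx => h3 x ⟨hy.1.trans hx.1, hx.2.trans hc.2⟩)
        (fun x hx => h2 x ⟨hy.1.trans hx.1, hx.2.trans hc.2⟩)
      rwa [abs_sub_comm, abs_sub_comm y c, abs_of_nonneg (by linarith : 0 ≤ c - y)]
  have h5 : |y - c| ≤ 2 := abs_le.2 ⟨by linarith [hy.1, hc.2], by linarith [hy.2, hc.1]⟩
  calc |u ω y| = |(u ω y - u ω c) + u ω c| := by ring_nf
    _ ≤ |u ω y - u ω c| + |u ω c| := abs_add_le _ _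
    _ ≤ ε := by nlinarith

/-! ### A priori smallness of the rescaled derivatives -/

/-- The function `f`, with weight `ω ^ j`, seen near the point `5 ω ^ 4` on the scale `1 / ω`. -/
noncomputable def rescale (f : ℝ → ℝ) (j : ℕ) (ω y : ℝ) : ℝ := f (5 * ω ^ 4 + y / ω) / ω ^ j

theorem rescale_unifDeriv {f f' : ℝ → ℝ} (hf : ∀ z, HasDerivAt f (f' z) z) (j : ℕ) :
    UnifDeriv (rescale f j) (rescale f' (j + 1)) := by
  filter_upwards [eventually_gt_atTop 0] with ω hω y _
  have h1 : HasDerivAt (fun y => 5 * ω ^ 4 + y / ω) (1 / ω) y :=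
    ((hasDerivAt_id y).div_const ω).const_add _
  have h2 := ((hf (5 * ω ^ 4 + y / ω)).comp y h1).div_const (ω ^ j)
  refine h2.congr_deriv ?_
  unfold rescale
  field_simp
  ring

theorem rescale_unifSmall {f : ℝ → ℝ} (hf : Tendsto f atTop (𝓝 0)) :
    UnifSmall (rescale f 0) := by
  intro ε hε
  have h1 : ∀ᶠ z in atTop, |f z| ≤ ε := by
    filter_upwards [(tendsto_zero_iff_abs_tendsto_zero f).1 hf |>.eventually (ge_mem_nhds hε)]
      with z hz using hz
  obtain ⟨Z, hZ⟩ := eventually_atTop.1 h1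
  filter_upwards [eventually_ge_atTop (max 1 Z)] with ω hω y hy
  have hω1 : 1 ≤ ω := (le_max_left _ _).trans hω
  have hωZ : Z ≤ ω := (le_max_right _ _).trans hω
  have h2 : |y / ω| ≤ 1 := by
    rw [abs_div, abs_of_pos (by linarith : 0 < ω), div_le_one (by linarith)]
    exact (abs_le.2 ⟨by linarith [hy.1], by linarith [hy.2]⟩ : |y| ≤ 1).trans hω1
  have h3 : ω ≤ ω ^ 4 := le_self_pow₀ hω1 (by norm_num)
  have := hZ (5 * ω ^ 4 + y / ω) (by linarith [(abs_le.1 h2).1])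
  simpa [rescale] using this

theorem UnifDeriv.sub {u u' v v' : ℝ → ℝ → ℝ} (hu : UnifDeriv u u') (hv : UnifDeriv v v') :
    UnifDeriv (fun ω y => u ω y - v ω y) (fun ω y => u' ω y - v' ω y) := by
  filter_upwards [hu, hv] with ω h1 h2 y hy
  exact (h1 y hy).sub (h2 y hy)

theorem UnifDeriv.congr_deriv {u u' v : ℝ → ℝ → ℝ} (hu : UnifDeriv u u')
    (h : ∀ᶠ ω in atTop, ∀ y ∈ Icc (-1 : ℝ) 1, u' ω y = v ω y) : UnifDeriv u v := by
  filter_upwards [hu, h] with ω h1 h2 y hy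
  exact (h1 y hy).congr_deriv (h2 y hy)

/-- The weight `z / 5`, rescaled by `ω ^ 4`. -/
noncomputable def rescaledWeight (ω y : ℝ) : ℝ := 1 + 1 / (5 * ω ^ 5) * y

theorem inv_five_mul_pow_bdd : UnifBdd (fun ω _ => 1 / (5 * ω ^ 5)) := by
  refine ⟨1, one_pos, ?_⟩
  filter_upwards [eventually_ge_atTop 1] with ω hω y _
  have : 1 ≤ ω ^ 5 := one_le_pow₀ hω
  rw [abs_of_nonneg (by positivity), div_le_one (by positivity)]
  linarith

theorem rescaledWeight_bdd : UnifBdd rescaledWeight := by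
  refine ⟨2, two_pos, ?_⟩
  filter_upwards [eventually_ge_atTop 1] with ω hω y hy
  have : 1 ≤ ω ^ 5 := one_le_pow₀ hω
  have h1 : 1 / (5 * ω ^ 5) ≤ 1 := by
    rw [div_le_one (by positivity)]
    linarith
  have h2 := abs_mul_le_mul (a := 1 / (5 * ω ^ 5)) (b := y) (A := 1) (B := 1)
    (by rw [abs_of_nonneg (by positivity)]; exact h1)
    (abs_le.2 ⟨by linarith [hy.1], hy.2⟩)
  unfold rescaledWeight
  exact (abs_add_le _ _).trans (by rw [abs_one]; linarith)

theorem rescaledWeight_mul_unifDeriv {u v : ℝ → ℝ → ℝ} (hu : UnifDeriv u v) :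
    UnifDeriv (fun ω y => u ω y * rescaledWeight ω y)
      (fun ω y => v ω y * rescaledWeight ω y + u ω y * (1 / (5 * ω ^ 5))) := by
  filter_upwards [hu] with ω h1 y hy
  have h2 : HasDerivAt (rescaledWeight ω) (1 / (5 * ω ^ 5)) y := by
    have := ((hasDerivAt_id y).const_mul (1 / (5 * ω ^ 5))).const_add 1
    exact this.congr_deriv (by simp)
  exact (h1 y hy).mul h2

/-- Integration of `u' = v' θ`, where `θ` is the slowly varying weight and `v` is small. -/
theorem UnifSmall.of_deriv_weight {u u' v v' : ℝ → ℝ → ℝ} {ℓ : ℝ} (hℓ : ℓ ≤ 2)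
    (hu : SmallPts ℓ u) (hv : UnifSmall v) (hu' : UnifDeriv u u') (hv' : UnifDeriv v v')
    (h : ∀ᶠ ω in atTop, ∀ y ∈ Icc (-1 : ℝ) 1, u' ω y = v' ω y * rescaledWeight ω y) :
    UnifSmall u := by
  have h1 : UnifSmall (fun ω y => v ω y * rescaledWeight ω y) := hv.mul_bdd rescaledWeight_bdd
  -- Integration by parts: `u - vθ` has derivative `-vθ'`, which is small without any bound on `v'`.
  have h2 : UnifDeriv (fun ω y => u ω y - v ω y * rescaledWeight ω y)
      (fun ω y => -(v ω y * (1 / (5 * ω ^ 5)))) := by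
    refine (hu'.sub (rescaledWeight_mul_unifDeriv hv')).congr_deriv ?_
    filter_upwards [h] with ω h1 y hy
    rw [h1 y hy]
    ring
  have h3 := UnifSmall.of_deriv hℓ (hv.mul_bdd inv_five_mul_pow_bdd).neg
    (hu.sub_unifSmall h1) h2
  refine (h3.add h1).congr ?_
  filter_upwards with ω y _
  ring

namespace IsHalfProfile

variable {m k : ℕ} {h : ℝ → ℝ}

theorem rescale_sub_one_unifSmall (hp : IsHalfProfile m k h) :
    UnifSmall (rescale (fun z => h z - 1) 0) :=
  rescale_unifSmall (by simpa using hp.tendsto.sub_const 1)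

theorem rescale_deriv_unifDeriv (hp : IsHalfProfile m k h) {j : ℕ} (hj : j < 5) :
    UnifDeriv (rescale (iteratedDeriv j h) j) (rescale (iteratedDeriv (j + 1) h) (j + 1)) :=
  rescale_unifDeriv (hp.hasDerivAt hj) j

theorem rescale_sub_one_unifDeriv (hp : IsHalfProfile m k h) :
    UnifDeriv (rescale (fun z => h z - 1) 0) (rescale (iteratedDeriv 1 h) 1) :=
  rescale_unifDeriv (fun z => by
    have := hp.hasDerivAt (j := 0) (by norm_num) z
    rw [iteratedDeriv_zero] at this
    exact this.sub_const 1) 0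

/-- Each use of the mean value theorem triples the length of the intervals; starting from `1/81`,
the fourth derivative is reached with length one, still inside `[-1, 1]`. -/
theorem rescale_smallPts (hp : IsHalfProfile m k h) {j : ℕ} (hj : j < 5) :
    SmallPts (3 ^ (j + 1) / 81) (rescale (iteratedDeriv (j + 1) h) (j + 1)) := by
  induction j with
  | zero =>
    have := (hp.rescale_sub_one_unifSmall.smallPts (ℓ := 1 / 81) (by norm_num)).deriv
      (by norm_num) hp.rescale_sub_one_unifDeriv
    convert this using 1
    norm_num
  | succ j ih =>
    have := (ih (by omega)).deriv (by positivity) (hp.rescale_deriv_unifDeriv hj)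
    convert this using 1
    ring

theorem rescale_bdd (hp : IsHalfProfile m k h) : UnifBdd (rescale h 0) := by
  refine ⟨2, two_pos, ?_⟩
  filter_upwards [hp.rescale_sub_one_unifSmall 1 one_pos] with ω h1 y hy
  have := h1 y hy
  simp only [rescale, pow_zero, div_one] at this ⊢
  rw [abs_le] at this ⊢
  constructor <;> linarith

theorem eventually_half_le_rescale (hp : IsHalfProfile m k h) :
    ∀ᶠ ω in atTop, ∀ y ∈ Icc (-1 : ℝ) 1, 1 / 2 ≤ rescale h 0 ω y := by
  filter_upwards [hp.rescale_sub_one_unifSmall (1 / 2) (by norm_num)] with ω h1 y hy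
  have := (abs_le.1 (h1 y hy)).1
  simp only [rescale, pow_zero, div_one] at this ⊢
  linarith

theorem rescale_inv_bdd (hp : IsHalfProfile m k h) : UnifBdd (fun ω y => (rescale h 0 ω y)⁻¹) := by
  refine ⟨2, two_pos, ?_⟩
  filter_upwards [hp.eventually_half_le_rescale] with ω h1 y hy
  have := h1 y hy
  rw [abs_inv, abs_of_pos (by linarith), inv_le_comm₀ (by linarith) two_pos]
  linarith

/-- The derivatives of order at least one and less than `n` are small if the one of order `n` is. -/
theorem rescale_unifSmall_of_le (hp : IsHalfProfile m k h) {n : ℕ} (hn : n ≤ 4)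
    (hs : UnifSmall (rescale (iteratedDeriv n h) n)) {j : ℕ} (hj : 1 ≤ j) (hjn : j ≤ n) :
    UnifSmall (rescale (iteratedDeriv j h) j) := by
  induction hjn using Nat.decreasingInduction with
  | self => exact hs
  | of_succ i hi ih =>
    obtain ⟨i, rfl⟩ := Nat.exists_eq_succ_of_ne_zero (by omega : i ≠ 0)
    refine UnifSmall.of_deriv (ℓ := 3 ^ (i + 1) / 81) ?_ (ih (by omega))
      (hp.rescale_smallPts (by omega)) (hp.rescale_deriv_unifDeriv (by omega))
    have : (3 : ℝ) ^ (i + 1) ≤ 3 ^ 4 := pow_le_pow_right₀ (by norm_num) (by omega)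
    linarith

/-- Divided by `h`, the equation reads `h⁽⁵⁾ = (z/5) (log h)'`, and `log h → 0`. So the fourth
derivative is small by integration with a slowly varying weight. -/
theorem rescale_unifSmall_four_of_eq_zero (hp : IsHalfProfile m 0 h) :
    UnifSmall (rescale (iteratedDeriv 4 h) 4) := by
  have hm : m = 5 := by simpa using hp.add_eq
  subst hm
  obtain ⟨Z, hZ⟩ := eventually_atTop.1 (hp.tendsto.eventually (lt_mem_nhds (zero_lt_one' ℝ)))
  have hpos : ∀ᶠ ω in atTop, ∀ y ∈ Icc (-1 : ℝ) 1, 0 < rescale h 0 ω y := by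
    filter_upwards [hp.eventually_half_le_rescale] with ω h1 y hy
    linarith [h1 y hy]
  have hlog : UnifSmall (rescale (fun z => Real.log (h z)) 0) := by
    apply rescale_unifSmall
    have := (Real.continuousAt_log one_ne_zero).tendsto.comp hp.tendsto
    rwa [Real.log_one] at this
  have hlog' : UnifDeriv (rescale (fun z => Real.log (h z)) 0)
      (fun ω y => rescale (iteratedDeriv 1 h) 1 ω y / rescale h 0 ω y) := by
    have hd := hp.rescale_deriv_unifDeriv (j := 0) (by norm_num)
    rw [iteratedDeriv_zero] at hd
    filter_upwards [hd, hpos] with ω h1 h2 y hy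
    have := (h1 y hy).log (h2 y hy).ne'
    refine (this.congr_of_eventuallyEq ?_)
    filter_upwards with x
    simp [rescale]
  refine UnifSmall.of_deriv_weight (ℓ := 1) (by norm_num) ?_ hlog
    (hp.rescale_deriv_unifDeriv (j := 4) (by norm_num)) hlog' ?_
  · convert hp.rescale_smallPts (j := 3) (by norm_num) using 1
    norm_num
  · filter_upwards [hpos, eventually_gt_atTop 0] with ω h1 hω y hy
    have h2 := hp.ode (5 * ω ^ 4 + y / ω)
    rw [iteratedDeriv_zero, ← iteratedDeriv_one] at h2
    have h3 := h1 y hy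
    rw [div_mul_eq_mul_div, eq_div_iff h3.ne']
    simp only [rescale, rescaledWeight, pow_zero, div_one] at h3 ⊢
    rw [div_mul_eq_mul_div, mul_comm, h2]
    field_simp
    ring

theorem flux_rescale_unifDeriv (hp : IsHalfProfile m k h) {i : ℕ} (hi : i < k) :
    UnifDeriv (rescale (iteratedDeriv i fun y => h y * iteratedDeriv m h y) (m + i))
      (rescale (iteratedDeriv (i + 1) fun y => h y * iteratedDeriv m h y) (m + (i + 1))) :=
  rescale_unifDeriv (hp.hasDerivAt_flux hi) (m + i)

theorem flux_rescale_smallPts (hp : IsHalfProfile m k h) {i : ℕ} (hi : i < k) :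
    SmallPts (3 ^ (m + i) / 81)
      (rescale (iteratedDeriv i fun y => h y * iteratedDeriv m h y) (m + i)) := by
  induction i with
  | zero =>
    obtain ⟨j, rfl⟩ := Nat.exists_eq_succ_of_ne_zero (by linarith [hp.one_le] : m ≠ 0)
    have h5 := hp.add_eq
    refine ((hp.rescale_smallPts (j := j) (by omega)).mul_bdd hp.rescale_bdd).congr ?_
    filter_upwards with ω y _
    simp [rescale]
    ring
  | succ i ih =>
    have := (ih (by omega)).deriv (by positivity) (hp.flux_rescale_unifDeriv (i := i) (by omega))
    convert this using 1
    ring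

/-- The top derivative of the flux is `(z/5)(h - 1)'`, a slowly varying weight times the derivative
of a small function. One weighted integration and then plain ones make all lower derivatives of the
flux small. -/
theorem flux_rescale_unifSmall (hp : IsHalfProfile m (k + 1) h) {i : ℕ} (hi : i ≤ k) :
    UnifSmall (rescale (iteratedDeriv i fun y => h y * iteratedDeriv m h y) (m + i)) := by
  have h5 := hp.add_eq
  have hl : ∀ i, i ≤ k → (3 : ℝ) ^ (m + i) / 81 ≤ 2 := fun i hi => by
    have : (3 : ℝ) ^ (m + i) ≤ 3 ^ 4 := pow_le_pow_right₀ (by norm_num) (by omega)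
    linarith
  induction hi using Nat.decreasingInduction with
  | self =>
    refine UnifSmall.of_deriv_weight (hl k le_rfl)
      (hp.flux_rescale_smallPts (Nat.lt_succ_self k)) hp.rescale_sub_one_unifSmall
      (hp.flux_rescale_unifDeriv (Nat.lt_succ_self k)) hp.rescale_sub_one_unifDeriv ?_
    filter_upwards [eventually_gt_atTop 0] with ω hω y hy
    simp only [rescale, rescaledWeight]
    rw [hp.ode, h5, ← iteratedDeriv_one]
    field_simp
  | of_succ i hi ih =>
    exact UnifSmall.of_deriv (hl i hi.le) ih (hp.flux_rescale_smallPts (by omega))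
      (hp.flux_rescale_unifDeriv (by omega))

/-- The derivative of order `m` is the flux divided by `h`; lower orders follow by integration. For
higher orders the Leibniz formula is solved for its top term, all other terms being products of
derivatives already known to be small. -/
theorem rescale_unifSmall_of_succ (hp : IsHalfProfile m (k + 1) h) :
    ∀ j, 1 ≤ j → j ≤ m + k → UnifSmall (rescale (iteratedDeriv j h) j) := by
  have h5 := hp.add_eq
  have hm1 := hp.one_le
  have hm : UnifSmall (rescale (iteratedDeriv m h) m) := by
    refine ((hp.flux_rescale_unifSmall (Nat.zero_le k)).mul_bdd hp.rescale_inv_bdd).congr ?_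
    filter_upwards [hp.eventually_half_le_rescale] with ω h1 y hy
    have h2 := h1 y hy
    have h3 : rescale h 0 ω y ≠ 0 := by linarith
    rw [eq_mul_inv_iff_mul_eq₀ h3]
    simp only [rescale, iteratedDeriv_zero, pow_zero, div_one, add_zero]
    ring
  intro j
  induction j using Nat.strong_induction_on with
  | _ j ih =>
  intro hj1 hj2
  rcases le_total j m with hjm | hjm
  · exact hp.rescale_unifSmall_of_le (by omega) hm hj1 hjm
  obtain ⟨i, rfl⟩ := Nat.exists_eq_add_of_le hjm
  have hi : i ≤ k := by omega
  rcases Nat.eq_zero_or_pos i with rfl | hi0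
  · exact hm
  have hsum : UnifSmall (fun ω y => ∑ l ∈ Finset.range i,
      rescale (iteratedDeriv (l + 1) h) (l + 1) ω y *
        (i.choose (l + 1) * rescale (iteratedDeriv (m + i - (l + 1)) h) (m + i - (l + 1)) ω y)) := by
    refine UnifSmall.sum fun l hl => ?_
    have hl' := Finset.mem_range.1 hl
    refine (ih (l + 1) (by omega) (by omega) (by omega)).mul_bdd ?_
    have hs := ih (m + i - (l + 1)) (by omega) (by omega) (by omega)
    obtain ⟨C, hC, hb⟩ := hs.bdd
    refine ⟨(i.choose (l + 1) : ℝ) * C + 1, by positivity, ?_⟩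
    filter_upwards [hb] with ω h1 y hy
    rw [abs_mul, Nat.abs_cast]
    have := mul_le_mul_of_nonneg_left (h1 y hy) (Nat.cast_nonneg (α := ℝ) (i.choose (l + 1)))
    linarith
  refine (((hp.flux_rescale_unifSmall hi).sub hsum).mul_bdd hp.rescale_inv_bdd).congr ?_
  filter_upwards [hp.eventually_half_le_rescale, eventually_gt_atTop 0] with ω h1 hω y hy
  have h2 := h1 y hy
  have h3 : rescale h 0 ω y ≠ 0 := by linarith
  rw [eq_mul_inv_iff_mul_eq₀ h3, eq_sub_iff_add_eq]
  conv_rhs => rw [rescale, hp.flux_leibniz (by omega), Finset.sum_div, Finset.sum_range_succ']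
  rw [add_comm]
  congr 1
  · refine Finset.sum_congr rfl fun l hl => ?_
    have hl' := Finset.mem_range.1 hl
    have e : ω ^ (m + i) = ω ^ (l + 1) * ω ^ (m + i - (l + 1)) := by
      rw [← pow_add]; congr 1; omega
    rw [e]
    simp only [rescale]
    field_simp
  · simp [rescale]
    ring

theorem rescale_deriv_unifSmall (hp : IsHalfProfile m k h) {j : ℕ} (hj1 : 1 ≤ j) (hj4 : j ≤ 4) :
    UnifSmall (rescale (iteratedDeriv j h) j) := by
  cases k with
  | zero => exact hp.rescale_unifSmall_of_le le_rfl hp.rescale_unifSmall_four_of_eq_zero hj1 hj4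
  | succ k =>
    have := hp.add_eq
    exact hp.rescale_unifSmall_of_succ j hj1 (by omega)

theorem tendsto_deriv_div_pow (hp : IsHalfProfile m k h) {j : ℕ} (hj1 : 1 ≤ j) (hj4 : j ≤ 4) :
    Tendsto (fun ω => iteratedDeriv j h (5 * ω ^ 4) / ω ^ j) atTop (𝓝 0) := by
  rw [Metric.tendsto_nhds]
  intro ε hε
  filter_upwards [hp.rescale_deriv_unifSmall hj1 hj4 (ε / 2) (half_pos hε)] with ω h1
  have := h1 0 ⟨by norm_num, by norm_num⟩
  simp only [rescale, zero_div, add_zero] at this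
  rw [Real.dist_eq, sub_zero]
  linarith

end IsHalfProfile

/-! ### The reduced flow of a half profile -/

/-- The local wave number, as a function of the phase `s`. -/
noncomputable def waveNumber (s : ℝ) : ℝ := (s / 4) ^ (1 / 5 : ℝ)

theorem waveNumber_pos {s : ℝ} (hs : 0 < s) : 0 < waveNumber s :=
  Real.rpow_pos_of_pos (by positivity) _

theorem waveNumber_pow {s : ℝ} (hs : 0 ≤ s) : waveNumber s ^ 5 = s / 4 := by
  rw [waveNumber, ← Real.rpow_natCast, ← Real.rpow_mul (by positivity)]
  norm_num

theorem waveNumber_four_mul_pow {ω : ℝ} (hω : 0 ≤ ω) : waveNumber (4 * ω ^ 5) = ω := by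
  rw [waveNumber, mul_div_cancel_left₀ _ (by norm_num : (4 : ℝ) ≠ 0), ← Real.rpow_natCast,
    ← Real.rpow_mul hω]
  norm_num

theorem hasDerivAt_waveNumber {s : ℝ} (hs : 0 < s) :
    HasDerivAt waveNumber (1 / (5 * s) * waveNumber s) s := by
  have h1 := ((hasDerivAt_id s).div_const 4).rpow_const (p := 1 / 5)
    (Or.inl (by simpa using hs.ne'))
  refine h1.congr_deriv ?_
  simp only [id]
  rw [Real.rpow_sub_one (by positivity)]
  unfold waveNumber
  field_simp

theorem tendsto_waveNumber : Tendsto waveNumber atTop atTop :=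
  (tendsto_rpow_atTop (by norm_num : (0 : ℝ) < 1 / 5)).comp
    (tendsto_id.atTop_div_const (by norm_num))

/-- The phase accumulated at position `z`. -/
noncomputable def phase (z : ℝ) : ℝ := 4 * ((z / 5) ^ (1 / 4 : ℝ)) ^ 5

theorem tendsto_phase : Tendsto phase atTop atTop := by
  refine Tendsto.const_mul_atTop (by norm_num) ((tendsto_pow_atTop (by norm_num)).comp ?_)
  exact (tendsto_rpow_atTop (by norm_num : (0 : ℝ) < 1 / 4)).comp
    (tendsto_id.atTop_div_const (by norm_num))

theorem waveNumber_phase {z : ℝ} (hz : 0 ≤ z) : 5 * waveNumber (phase z) ^ 4 = z := by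
  rw [phase, waveNumber_four_mul_pow (by positivity), ← Real.rpow_natCast,
    ← Real.rpow_mul (by positivity)]
  norm_num
  ring

/-- The rescaled derivative of order `j` of `f` at the point of phase `s`. -/
noncomputable def phaseDeriv (h : ℝ → ℝ) (j : ℕ) (s : ℝ) : ℝ :=
  iteratedDeriv j h (5 * waveNumber s ^ 4) / waveNumber s ^ j

theorem iteratedDeriv_eq_phaseDeriv (h : ℝ → ℝ) (j : ℕ) {z : ℝ} (hz : 0 < z) :
    iteratedDeriv j h z = phaseDeriv h j (phase z) * waveNumber (phase z) ^ j := by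
  have : 0 < waveNumber (phase z) := waveNumber_pos (by unfold phase; positivity)
  rw [phaseDeriv, waveNumber_phase hz.le, div_mul_cancel₀ _ (by positivity)]

namespace IsHalfProfile

variable {m k : ℕ} {h : ℝ → ℝ}

/-- Along the phase, `dz/ds = 1/ω` raises the order of the derivative together with its weight, and
`ω' = ω/(5s)` applied to `ω^(-j)` produces the damping. -/
theorem hasDerivAt_phaseDeriv (hp : IsHalfProfile m k h) {j : ℕ} (hj : j < 5) {s : ℝ}
    (hs : 0 < s) : HasDerivAt (phaseDeriv h j)
      (phaseDeriv h (j + 1) s - j * (1 / (5 * s)) * phaseDeriv h j s) s := by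
  have hω := waveNumber_pos hs
  have hd := hasDerivAt_waveNumber hs
  have h1 := (hp.hasDerivAt hj (5 * waveNumber s ^ 4)).comp s ((hd.fun_pow 4).const_mul 5)
  have h2 := h1.div (hd.fun_pow j) (by positivity)
  refine h2.congr_deriv ?_
  have e : s = 4 * waveNumber s ^ 5 := by rw [waveNumber_pow hs.le]; ring
  simp only [phaseDeriv, Function.comp]
  generalize waveNumber s = ω at *
  subst e
  rcases j with _ | j
  · simp
    field_simp
  · simp
    field_simp
    ring

theorem exists_reducedFlow (hp : IsHalfProfile m k h) : ∃ α β S : ℝ,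
    ReducedFlow α β S (phaseDeriv h 0) (phaseDeriv h 1) (phaseDeriv h 2) (phaseDeriv h 3)
      (phaseDeriv h 4) := by
  obtain ⟨α, β, hαβ⟩ := hp.exists_expanded
  have hz : Tendsto (fun s => 5 * waveNumber s ^ 4) atTop atTop :=
    Tendsto.const_mul_atTop (by norm_num)
      ((tendsto_pow_atTop (by norm_num)).comp tendsto_waveNumber)
  have ht : ∀ j, 1 ≤ j → j ≤ 4 → Tendsto (phaseDeriv h j) atTop (𝓝 0) := fun j h1 h4 =>
    (hp.tendsto_deriv_div_pow h1 h4).comp tendsto_waveNumber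
  have hH : Tendsto (phaseDeriv h 0) atTop (𝓝 1) := by
    refine (hp.tendsto.comp hz).congr fun s => ?_
    simp [phaseDeriv]
  obtain ⟨S, hS⟩ := eventually_atTop.1
    ((hH.eventually (lt_mem_nhds one_pos)).and (eventually_gt_atTop 0))
  have hpos : ∀ s, S ≤ s → 0 < s := fun s hs => (hS s hs).2
  refine ⟨α, β, S, ⟨hpos S le_rfl, fun s hs => ?_, fun s hs => ?_, fun s hs => ?_,
    fun s hs => ?_, fun s hs => ?_, hH, ht 1 le_rfl (by norm_num), ht 2 (by norm_num) (by norm_num),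
    ht 3 (by norm_num) (by norm_num), ht 4 (by norm_num) le_rfl⟩⟩
  · exact (hp.hasDerivAt_phaseDeriv (j := 0) (by norm_num) (hpos s hs)).congr_deriv (by simp)
  · exact (hp.hasDerivAt_phaseDeriv (j := 1) (by norm_num) (hpos s hs)).congr_deriv (by simp)
  · exact (hp.hasDerivAt_phaseDeriv (j := 2) (by norm_num) (hpos s hs)).congr_deriv (by simp)
  · exact (hp.hasDerivAt_phaseDeriv (j := 3) (by norm_num) (hpos s hs)).congr_deriv (by simp)
  · refine (hp.hasDerivAt_phaseDeriv (j := 4) (by norm_num) (hpos s hs)).congr_deriv ?_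
    have hω := waveNumber_pos (hpos s hs)
    have h0 := (hS s hs).1
    have h1 := hαβ (5 * waveNumber s ^ 4)
    simp only [phaseDeriv, pow_zero, div_one, iteratedDeriv_zero, reducedForce] at h0 ⊢
    push_cast
    congr 1
    generalize waveNumber s = ω at *
    rw [eq_div_iff h0.ne', div_mul_eq_mul_div, mul_comm (iteratedDeriv (4 + 1) h _),
      eq_sub_of_add_eq (eq_sub_of_add_eq h1)]
    field_simp
    ring

/-! ### Exclusion of decaying solutions -/

theorem exists_last_zero (hp : IsHalfProfile m k h) : ∃ a, h a = 0 ∧ ∀ z, a < z → 0 < h z := by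
  obtain ⟨Z, hZ⟩ := eventually_atTop.1
    ((hp.tendsto.eventually (lt_mem_nhds (zero_lt_one' ℝ))).and (eventually_ge_atTop 0))
  have hc := hp.contDiff.continuous
  have hK : IsCompact (Icc 0 Z ∩ {z | h z ≤ 0}) :=
    isCompact_Icc.inter_right (isClosed_le hc continuous_const)
  obtain ⟨a, ⟨ha, ha0⟩, hmax⟩ := hK.exists_isGreatest
    ⟨0, ⟨le_rfl, (hZ Z le_rfl).2⟩, hp.zero.le⟩
  have hpos : ∀ z, a < z → 0 < h z := fun z hz => by
    by_contra hn
    rcases le_total z Z with hzZ | hzZ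
    · exact absurd (hmax ⟨⟨ha.1.trans hz.le, hzZ⟩, not_lt.1 hn⟩) (not_le.2 hz)
    · exact hn (hZ z hzZ).1
  refine ⟨a, le_antisymm ha0 ?_, hpos⟩
  refine ge_of_tendsto (x := 𝓝[>] a) (hc.continuousWithinAt) ?_
  filter_upwards [self_mem_nhdsWithin] with z hz using (hpos z hz).le

/-- A half profile is not eventually constant. -/
theorem not_eventually_const (hp : IsHalfProfile m k h) (Z : ℝ)
    (h1 : iteratedDeriv 1 h Z = 0) (h2 : iteratedDeriv 2 h Z = 0)
    (h3 : iteratedDeriv 3 h Z = 0) (h4 : iteratedDeriv 4 h Z = 0)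
    (hZ1 : h Z = 1) (hZ : ∀ z, Z ≤ z → 0 < h z) : False := by
  obtain ⟨a, ha0, ha⟩ := hp.exists_last_zero
  have haZ : a < Z := by
    by_contra hn
    exact (hZ a (not_lt.1 hn)).ne' ha0
  obtain ⟨α, β, hαβ⟩ := hp.exists_expanded
  have hc : ∀ j ≤ 5, Continuous (iteratedDeriv j h) := fun j hj =>
    hp.contDiff.continuous_iteratedDeriv j (by exact_mod_cast hj)
  -- Backward uniqueness. To the right of the last zero `a` of `h`, the equation can be divided by
  -- `h` and is linear in the derivatives of orders one to four with bounded coefficients. Their sum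
  -- of squares vanishes at `Z`, hence by Grönwall on all of `(a, Z]`, which forbids the passage of
  -- `h` from `0` to `1`.
  have hzero : ∀ b, a < b → b ≤ Z → iteratedDeriv 1 h b = 0 := by
    intro b hab hbZ
    have hne : ∀ z ∈ Icc b Z, h z ≠ 0 := fun z hz => (ha z (hab.trans_le hz.1)).ne'
    have hch : ContinuousOn h (Icc b Z) := hp.contDiff.continuous.continuousOn
    obtain ⟨M, hM⟩ := isCompact_Icc.exists_bound_of_continuousOn (s := Icc b Z)
      (f := fun z => (z / 5 - α * iteratedDeriv 4 h z) / h z)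
      (ContinuousOn.div (((continuous_id.div_const 5).sub
        (continuous_const.mul (hc 4 (by norm_num)))).continuousOn) hch hne)
    obtain ⟨N, hN⟩ := isCompact_Icc.exists_bound_of_continuousOn (s := Icc b Z)
      (f := fun z => (β * iteratedDeriv 3 h z) / h z)
      (ContinuousOn.div ((continuous_const.mul (hc 3 (by norm_num))).continuousOn) hch hne)
    have hM0 : 0 ≤ M := (norm_nonneg _).trans (hM b ⟨le_rfl, hbZ⟩)
    have hN0 : 0 ≤ N := (norm_nonneg _).trans (hN b ⟨le_rfl, hbZ⟩)
    set E : ℝ → ℝ := fun z => iteratedDeriv 1 h z ^ 2 + iteratedDeriv 2 h z ^ 2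
      + iteratedDeriv 3 h z ^ 2 + iteratedDeriv 4 h z ^ 2 with hE
    have hdE : ∀ z, HasDerivAt E (2 * (iteratedDeriv 1 h z * iteratedDeriv 2 h z)
        + 2 * (iteratedDeriv 2 h z * iteratedDeriv 3 h z)
        + 2 * (iteratedDeriv 3 h z * iteratedDeriv 4 h z)
        + 2 * (iteratedDeriv 4 h z * iteratedDeriv 5 h z)) z := fun z => by
      refine (((((hp.hasDerivAt (j := 1) (by norm_num) z).fun_pow 2).add
        ((hp.hasDerivAt (j := 2) (by norm_num) z).fun_pow 2)).add
        ((hp.hasDerivAt (j := 3) (by norm_num) z).fun_pow 2)).add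
        ((hp.hasDerivAt (j := 4) (by norm_num) z).fun_pow 2)).congr_deriv ?_
      push_cast
      ring
    have hlow : ∀ z ∈ Icc b Z, -(2 + M + N) * E z ≤
        2 * (iteratedDeriv 1 h z * iteratedDeriv 2 h z)
        + 2 * (iteratedDeriv 2 h z * iteratedDeriv 3 h z)
        + 2 * (iteratedDeriv 3 h z * iteratedDeriv 4 h z)
        + 2 * (iteratedDeriv 4 h z * iteratedDeriv 5 h z) := fun z hz => by
      have e5 : iteratedDeriv 5 h z = (z / 5 - α * iteratedDeriv 4 h z) / h z * iteratedDeriv 1 h z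
          - (β * iteratedDeriv 3 h z) / h z * iteratedDeriv 2 h z := by
        rw [div_mul_eq_mul_div, div_mul_eq_mul_div, ← sub_div, eq_div_iff (hne z hz)]
        linarith [hαβ z]
      have hA := hM z hz
      have hB := hN z hz
      rw [Real.norm_eq_abs] at hA hB
      rw [e5]
      generalize (z / 5 - α * iteratedDeriv 4 h z) / h z = A at hA
      generalize (β * iteratedDeriv 3 h z) / h z = B at hB
      simp only [hE]
      generalize iteratedDeriv 1 h z = d1
      generalize iteratedDeriv 2 h z = d2
      generalize iteratedDeriv 3 h z = d3
      generalize iteratedDeriv 4 h z = d4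
      have key : ∀ x y : ℝ, |x * y| ≤ (x ^ 2 + y ^ 2) / 2 := fun x y =>
        abs_le.2 ⟨by nlinarith [sq_nonneg (x + y)], by nlinarith [sq_nonneg (x - y)]⟩
      have k1 := abs_mul_le_mul hA (key d4 d1)
      have k2 := abs_mul_le_mul hB (key d4 d2)
      have k3 : M * ((d4 ^ 2 + d1 ^ 2) / 2) ≤ M * (d1 ^ 2 + d2 ^ 2 + d3 ^ 2 + d4 ^ 2) / 2 := by
        nlinarith [mul_nonneg hM0 (sq_nonneg d2), mul_nonneg hM0 (sq_nonneg d3)]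
      have k4 : N * ((d4 ^ 2 + d2 ^ 2) / 2) ≤ N * (d1 ^ 2 + d2 ^ 2 + d3 ^ 2 + d4 ^ 2) / 2 := by
        nlinarith [mul_nonneg hN0 (sq_nonneg d1), mul_nonneg hN0 (sq_nonneg d3)]
      have l1 := (abs_le.1 (key d1 d2)).1
      have l2 := (abs_le.1 (key d2 d3)).1
      have l3 := (abs_le.1 (key d3 d4)).1
      have l4 := (abs_le.1 k1).1
      have l5 := (abs_le.1 k2).2
      linarith [sq_nonneg d1, sq_nonneg d4]
    have := mul_exp_le_of_le_hasDerivAt hbZ (fun z _ => hdE z) hlow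
    have hEZ : E Z = 0 := by simp only [hE, h1, h2, h3, h4]; norm_num
    rw [hEZ] at this
    have hEb : E b ≤ 0 := by
      by_contra hn
      exact absurd this (not_le.2 (mul_pos (not_le.1 hn) (Real.exp_pos _)))
    have : iteratedDeriv 1 h b ^ 2 ≤ 0 := by
      simp only [hE] at hEb
      linarith [sq_nonneg (iteratedDeriv 2 h b), sq_nonneg (iteratedDeriv 3 h b),
        sq_nonneg (iteratedDeriv 4 h b)]
    exact pow_eq_zero_iff two_ne_zero |>.1 (le_antisymm this (sq_nonneg _))
  have hder : ∀ z, HasDerivAt h (iteratedDeriv 1 h z) z := fun z => by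
    simpa using hp.hasDerivAt (j := 0) (by norm_num) z
  obtain ⟨c, hc1, hc2⟩ := exists_hasDerivAt_eq_slope h (iteratedDeriv 1 h) haZ
    hp.contDiff.continuous.continuousOn (fun z _ => hder z)
  rw [hzero c hc1.1 hc1.2.le, ha0, hZ1, sub_zero] at hc2
  exact absurd hc2.symm (one_div_pos.2 (by linarith)).ne'

end IsHalfProfile

/-- A function strictly increasing to zero is negative. Strictness holds at the endpoint `a` as
well, where the later contradictions arise. -/
theorem neg_mul_pos_of_tendsto_zero {f f' : ℝ → ℝ} {a c : ℝ} (hd : ∀ z, HasDerivAt f (f' z) z)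
    (ht : Tendsto f atTop (𝓝 0)) (h : ∀ z, a < z → 0 < c * f' z) {z : ℝ} (hz : a ≤ z) :
    0 < -c * f z := by
  have hmono : StrictMonoOn (fun z => c * f z) (Ici a) := by
    apply strictMonoOn_of_deriv_pos (convex_Ici a)
    · exact fun x _ => (((hd x).const_mul c).continuousAt).continuousWithinAt
    · intro x hx
      rw [interior_Ici] at hx
      rw [((hd x).const_mul c).deriv]
      exact h x hx
  have h1 : c * f z < c * f (z + 1) := hmono hz (by simp; linarith) (by linarith)
  have h2 : Tendsto (fun z => c * f z) atTop (𝓝 0) := by simpa using ht.const_mul c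
  have h3 : c * f (z + 1) ≤ 0 := by
    refine ge_of_tendsto h2 ?_
    filter_upwards [eventually_ge_atTop (z + 1)] with y hy
    exact hmono.monotoneOn (by simp; linarith) (by simp; linarith) hy
  linarith

namespace IsHalfProfile

variable {m k : ℕ} {h : ℝ → ℝ}

theorem tendsto_flux (hp : IsHalfProfile m k h)
    (ht : ∀ j, 1 ≤ j → j ≤ 4 → Tendsto (iteratedDeriv j h) atTop (𝓝 0)) {i : ℕ} (hi : i < k) :
    Tendsto (iteratedDeriv i fun y => h y * iteratedDeriv m h y) atTop (𝓝 0) := by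
  have h5 := hp.add_eq
  have h1 := hp.one_le
  rw [show (iteratedDeriv i fun y => h y * iteratedDeriv m h y) = fun z =>
    ∑ l ∈ Finset.range (i + 1), i.choose l * iteratedDeriv l h z * iteratedDeriv (m + i - l) h z
    from funext fun z => hp.flux_leibniz hi.le z]
  have e : (0 : ℝ) = ∑ l ∈ Finset.range (i + 1), (0 : ℝ) := by simp
  rw [e]
  refine tendsto_finsetSum _ fun l hl => ?_
  have hl' := Finset.mem_range.1 hl
  have h2 := ht (m + i - l) (by omega) (by omega)
  rcases Nat.eq_zero_or_pos l with rfl | hl0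
  · have := (hp.tendsto.const_mul ((i.choose 0 : ℕ) : ℝ)).mul h2
    simpa using this
  · have := ((ht l hl0 (by omega)).const_mul ((i.choose l : ℕ) : ℝ)).mul h2
    simpa using this

/-- Signs of the derivatives of the flux, on a half line where `σ h' > 0`. -/
theorem flux_sign (hp : IsHalfProfile m k h)
    (ht : ∀ j, 1 ≤ j → j ≤ 4 → Tendsto (iteratedDeriv j h) atTop (𝓝 0)) {σ a : ℝ} (ha : 0 ≤ a)
    (hσ : ∀ z, a < z → 0 < σ * iteratedDeriv 1 h z) {i : ℕ} (hi : i ≤ k) :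
    (∀ z, a < z → 0 < (-1) ^ (k - i) * σ *
      iteratedDeriv i (fun y => h y * iteratedDeriv m h y) z) ∧
    (i < k → 0 < (-1) ^ (k - i) * σ *
      iteratedDeriv i (fun y => h y * iteratedDeriv m h y) a) := by
  induction hi using Nat.decreasingInduction with
  | self =>
    refine ⟨fun z hz => ?_, fun h => absurd h (lt_irrefl _)⟩
    rw [hp.ode, ← iteratedDeriv_one, Nat.sub_self, pow_zero, one_mul]
    have := mul_pos (by linarith : 0 < z / 5) (hσ z hz)
    linarith
  | of_succ i hi ih =>
    have e : (-1 : ℝ) ^ (k - i) * σ = -((-1) ^ (k - (i + 1)) * σ) := by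
      rw [show k - i = k - (i + 1) + 1 by omega, pow_succ]
      ring
    rw [e]
    have key := fun z (hz : a ≤ z) => neg_mul_pos_of_tendsto_zero
      (hp.hasDerivAt_flux (i := i) (by omega)) (hp.tendsto_flux ht (by omega)) ih.1 hz
    exact ⟨fun z hz => key z hz.le, fun _ => key a le_rfl⟩

/-- Signs of the derivatives, on a half line where that of the derivative of order `m` is known. -/
theorem deriv_sign (hp : IsHalfProfile m k h)
    (ht : ∀ j, 1 ≤ j → j ≤ 4 → Tendsto (iteratedDeriv j h) atTop (𝓝 0)) {c a : ℝ}
    (hc : ∀ z, a < z → 0 < c * iteratedDeriv m h z) {j : ℕ} (hj1 : 1 ≤ j) (hj : j ≤ m) :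
    (∀ z, a < z → 0 < (-1) ^ (m - j) * c * iteratedDeriv j h z) ∧
    (j < m → 0 < (-1) ^ (m - j) * c * iteratedDeriv j h a) := by
  have h5 := hp.add_eq
  induction hj using Nat.decreasingInduction with
  | self => simpa using hc
  | of_succ i hi ih =>
    have e : (-1 : ℝ) ^ (m - i) * c = -((-1) ^ (m - (i + 1)) * c) := by
      rw [show m - i = m - (i + 1) + 1 by omega, pow_succ]
      ring
    rw [e]
    have key := fun z (hz : a ≤ z) => neg_mul_pos_of_tendsto_zero
      (hp.hasDerivAt (j := i) (by omega)) (ht i hj1 (by omega)) (ih (by omega)).1 hz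
    exact ⟨fun z hz => key z hz.le, fun _ => key a le_rfl⟩

/-- The derivatives of a half profile do not all tend to zero with `h'` of constant sign. -/
theorem not_eventually_sign (hp : IsHalfProfile m k h)
    (ht : ∀ j, 1 ≤ j → j ≤ 4 → Tendsto (iteratedDeriv j h) atTop (𝓝 0)) (σ : ℝ)
    (hσ : ∀ᶠ z in atTop, 0 < σ * iteratedDeriv 1 h z) : False := by
  have h5 := hp.add_eq
  have h1 := hp.one_le
  obtain ⟨Z, hZ⟩ := eventually_atTop.1
    (((hp.tendsto.eventually (lt_mem_nhds (zero_lt_one' ℝ))).and hσ).and (eventually_ge_atTop 0))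
  have hc := hp.contDiff.continuous
  have hc1 : Continuous (iteratedDeriv 1 h) :=
    hp.contDiff.continuous_iteratedDeriv 1 (by norm_num)
  -- Let `a` be the last point at which `h` or `σ h'` fails to be positive; it exists because `h 0 =
  -- 0`. To its right all signs can be traced back from infinity, and the aim is to show that
  -- neither fails at `a`.
  have hK : IsCompact (Icc 0 Z ∩ ({z | h z ≤ 0} ∪ {z | σ * iteratedDeriv 1 h z ≤ 0})) :=
    isCompact_Icc.inter_right ((isClosed_le hc continuous_const).union
      (isClosed_le (continuous_const.mul hc1) continuous_const))
  obtain ⟨a, ⟨ha, ha0⟩, hmax⟩ := hK.exists_isGreatest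
    ⟨0, ⟨le_rfl, (hZ Z le_rfl).2⟩, Or.inl hp.zero.le⟩
  have hpos : ∀ z, a < z → 0 < h z ∧ 0 < σ * iteratedDeriv 1 h z := fun z hz => by
    rcases le_total z Z with hzZ | hzZ
    · by_contra hn
      refine absurd (hmax ⟨⟨ha.1.trans hz.le, hzZ⟩, ?_⟩) (not_le.2 hz)
      rwa [not_and_or, not_lt, not_lt] at hn
    · exact (hZ z hzZ).1
  have hha : 0 ≤ h a := by
    refine ge_of_tendsto (x := 𝓝[>] a) hc.continuousWithinAt ?_
    filter_upwards [self_mem_nhdsWithin] with z hz using (hpos z hz).1.le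
  have hflux := hp.flux_sign ht ha.1 (fun z hz => (hpos z hz).2) (Nat.zero_le k)
  rw [Nat.sub_zero, iteratedDeriv_zero] at hflux
  have hm : ∀ z, a < z → 0 < (-1) ^ k * σ * iteratedDeriv m h z := fun z hz => by
    have e := hflux.1 z hz
    have : 0 < h z * ((-1) ^ k * σ * iteratedDeriv m h z) := by linarith
    exact (pos_iff_pos_of_mul_pos this).1 (hpos z hz).1
  -- The sign alternates `k` times through the flux and `m - 1` times through the derivatives, four
  -- times in all, so it returns to that of `σ`.
  have hsgn : ∀ x, (-1 : ℝ) ^ (m - 1) * ((-1) ^ k * σ) * x = σ * x := fun x => by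
    rw [← mul_assoc, ← pow_add, show m - 1 + k = 4 by omega]
    norm_num
  have hder := hp.deriv_sign ht hm le_rfl h1
  -- For `k = 0` no integration of the flux gives strictness at `a`, so `h a = 0` is not excluded;
  -- the equation then forces `a = 0`, and the strict sign of `h''` there contradicts `h''(0) = 0`.
  -- For `k > 0` the flux is nonzero at `a`, so both `h a` and `σ h'(a)` are positive.
  rcases Nat.eq_zero_or_pos k with rfl | hk
  · have hm5 : m = 5 := by omega
    subst hm5
    have h2 := hder.2 (by norm_num)
    rw [hsgn] at h2
    have hle : h a ≤ 0 := ha0.resolve_right (not_le.2 h2)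
    have hode := hp.ode a
    rw [iteratedDeriv_zero, ← iteratedDeriv_one, le_antisymm hle hha, zero_mul] at hode
    have h3 : iteratedDeriv 1 h a ≠ 0 := fun h => by rw [h, mul_zero] at h2; exact h2.false
    have ha' : a = 0 := by
      have := (mul_eq_zero.1 hode.symm).resolve_right h3
      linarith
    have h4 := (hp.deriv_sign ht hm (j := 2) (by norm_num) (by norm_num)).2 (by norm_num)
    rw [ha', hp.second_zero, mul_zero] at h4
    exact h4.false
  · have h2 := hflux.2 hk
    have h3 : 0 < h a * ((-1) ^ k * σ * iteratedDeriv m h a) := by linarith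
    have hha' : 0 < h a := lt_of_le_of_ne hha fun e => by
      rw [← e, zero_mul] at h3
      exact h3.false
    have h4 := (pos_iff_pos_of_mul_pos h3).1 hha'
    have h5' : 0 < σ * iteratedDeriv 1 h a := by
      rcases h1.eq_or_lt with rfl | h1'
      · have := hsgn (iteratedDeriv 1 h a)
        rw [Nat.sub_self, pow_zero, one_mul] at this
        rwa [← this]
      · have := hder.2 h1'
        rwa [hsgn] at this
    rcases ha0 with h | h
    · exact absurd h (not_le.2 hha')
    · exact absurd h (not_le.2 h5')

theorem tendsto_of_phaseDeriv_le {S C : ℝ} {j : ℕ} (hj : j ≤ 4)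
    (hb : ∀ s, S ≤ s → |phaseDeriv h j s| ≤ C * Real.exp (-s / 2)) :
    Tendsto (iteratedDeriv j h) atTop (𝓝 0) := by
  have h1 : Tendsto (fun s => phaseDeriv h j s * waveNumber s ^ j) atTop (𝓝 0) := by
    have h2 : Tendsto (fun s : ℝ => C * (s ^ 1 * Real.exp (-(1 / 2) * s))) atTop (𝓝 0) := by
      have := (Real.tendsto_pow_mul_exp_neg_atTop_nhds_zero 1).comp
        (tendsto_id.const_mul_atTop (by norm_num : (0 : ℝ) < 1 / 2))
      have := this.const_mul (C * 2)
      rw [mul_zero] at this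
      refine this.congr fun s => ?_
      simp only [Function.comp, id]
      ring_nf
    refine squeeze_zero_norm' ?_ h2
    filter_upwards [eventually_ge_atTop S, eventually_ge_atTop 4] with s hs hs4
    have hω0 : 0 < waveNumber s := waveNumber_pos (by linarith)
    have hω5 := waveNumber_pow (by linarith : 0 ≤ s)
    have hω1 : 1 ≤ waveNumber s := by
      by_contra hn
      have := pow_lt_one₀ hω0.le (not_le.1 hn) (n := 5) (by norm_num)
      linarith
    have h3 : waveNumber s ^ j ≤ s := by
      have := pow_le_pow_right₀ hω1 (show j ≤ 5 by omega)
      linarith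
    rw [Real.norm_eq_abs]
    have := abs_mul_le_mul (hb s hs)
      (show |waveNumber s ^ j| ≤ s by rwa [abs_of_nonneg (by positivity)])
    calc _ ≤ _ := this
      _ = _ := by ring_nf
  refine (h1.comp tendsto_phase).congr' ?_
  filter_upwards [eventually_gt_atTop 0] with z hz
  exact (iteratedDeriv_eq_phaseDeriv h j hz).symm

/-- A half profile oscillates. -/
theorem exists_oscillatoryFlow (hp : IsHalfProfile m k h) : ∃ α β S : ℝ,
    OscillatoryFlow α β S (phaseDeriv h 0) (phaseDeriv h 1) (phaseDeriv h 2) (phaseDeriv h 3)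
      (phaseDeriv h 4) := by
  obtain ⟨α, β, S, hflow⟩ := hp.exists_reducedFlow
  rcases hflow.dichotomy with ⟨S', -, hS'⟩ | ⟨S', -, ⟨C, hC⟩, hsign⟩
  · exact ⟨α, β, S', hS'⟩
  exfalso
  have ht : ∀ j, 1 ≤ j → j ≤ 4 → Tendsto (iteratedDeriv j h) atTop (𝓝 0) := by
    intro j h1 h4
    apply tendsto_of_phaseDeriv_le h4 (S := S') (C := C)
    intro s hs
    obtain ⟨c1, c2, c3, c4⟩ := hC s hs
    interval_cases j <;> assumption
  have hev : ∀ {p : ℝ → Prop}, (∀ s, S' ≤ s → p s) → ∀ᶠ z in atTop, p (phase z) := fun hps =>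
    (tendsto_phase.eventually (eventually_ge_atTop S')).mono fun z hz => hps _ hz
  have hω : ∀ z : ℝ, 0 < z → 0 < waveNumber (phase z) := fun z hz =>
    waveNumber_pos (by unfold phase; positivity)
  rcases hsign with h0 | h0 | h0
  · obtain ⟨Z, hZ⟩ := eventually_atTop.1 (((hev h0).and (eventually_gt_atTop 0)).and
      (hp.tendsto.eventually (lt_mem_nhds (zero_lt_one' ℝ))))
    have hd0 : ∀ z, Z ≤ z → iteratedDeriv 1 h z = 0 ∧ iteratedDeriv 2 h z = 0 ∧
        iteratedDeriv 3 h z = 0 ∧ iteratedDeriv 4 h z = 0 := fun z hz => by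
      obtain ⟨⟨⟨a1, a2, a3, a4⟩, hz0⟩, -⟩ := hZ z hz
      simp only [iteratedDeriv_eq_phaseDeriv h _ hz0, a1, a2, a3, a4, zero_mul, and_self]
    obtain ⟨e1, e2, e3, e4⟩ := hd0 Z le_rfl
    refine hp.not_eventually_const Z e1 e2 e3 e4 ?_ fun z hz => (hZ z hz).2
    refine tendsto_nhds_unique (tendsto_const_nhds.congr' ?_) hp.tendsto
    filter_upwards [eventually_ge_atTop Z] with z hz
    have := abs_sub_le_of_hasDerivAt (f := h) (f' := iteratedDeriv 1 h) (M := 0) hz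
      (fun x _ => by simpa using hp.hasDerivAt (j := 0) (by norm_num) x)
      (fun x hx => by rw [(hd0 x hx.1).1, abs_zero])
    rw [zero_mul, abs_nonpos_iff, sub_eq_zero] at this
    exact this.symm
  · refine hp.not_eventually_sign ht 1 ?_
    filter_upwards [hev h0, eventually_gt_atTop 0] with z hz hz0
    rw [one_mul, iteratedDeriv_eq_phaseDeriv h 1 hz0]
    exact mul_pos hz (pow_pos (hω z hz0) 1)
  · refine hp.not_eventually_sign ht (-1) ?_
    filter_upwards [hev h0, eventually_gt_atTop 0] with z hz hz0
    rw [iteratedDeriv_eq_phaseDeriv h 1 hz0, neg_one_mul, neg_pos]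
    exact mul_neg_of_neg_of_pos hz (pow_pos (hω z hz0) 1)

end IsHalfProfile

/-! ### Decay and non-integrability of a half profile -/

theorem integrableOn_Ioi_comp_add {f : ℝ → ℝ} {T τ : ℝ} (hf : IntegrableOn f (Ioi T)) (hτ : 0 ≤ τ) :
    IntegrableOn (fun s => f (s + τ)) (Ioi T) := by
  have h1 := ((measurePreserving_add_right volume τ).integrableOn_comp_preimage
    (measurableEmbedding_addRight τ)).2 hf
  exact h1.mono_set fun s hs => by
    simp only [mem_preimage, mem_Ioi] at hs ⊢
    linarith

theorem half_mul_rpow_le {s τ : ℝ} (hs : 0 < s) (hτ0 : 0 ≤ τ) (hτ : τ ≤ s) :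
    1 / 2 * s ^ (-(1 / 5) : ℝ) ≤ (s + τ) ^ (-(1 / 5) : ℝ) := by
  have h1 : (2 * s) ^ (-(1 / 5) : ℝ) ≤ (s + τ) ^ (-(1 / 5) : ℝ) :=
    Real.rpow_le_rpow_of_nonpos (by linarith) (by linarith) (by norm_num)
  rw [Real.mul_rpow (by norm_num) hs.le] at h1
  have h2 : (1 / 2 : ℝ) ≤ 2 ^ (-(1 / 5) : ℝ) := by
    rw [one_div, ← Real.rpow_neg_one]
    exact Real.rpow_le_rpow_of_exponent_le (by norm_num) (by norm_num)
  exact (mul_le_mul_of_nonneg_right h2 (Real.rpow_nonneg hs.le _)).trans h1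

theorem phase_eq {z : ℝ} (hz : 0 ≤ z) : phase z = 4 * (z / 5) ^ (5 / 4 : ℝ) := by
  rw [phase, ← Real.rpow_natCast, ← Real.rpow_mul (by positivity)]
  norm_num

theorem waveNumber_pow_four {s : ℝ} (hs : 0 ≤ s) : waveNumber s ^ 4 = (s / 4) ^ (4 / 5 : ℝ) := by
  rw [waveNumber, ← Real.rpow_natCast, ← Real.rpow_mul (by positivity)]
  norm_num

namespace OscillatoryFlow

variable {α β S : ℝ} {H x₀ x₁ x₂ x₃ : ℝ → ℝ}

/-- With the weight that stems from the change of variables, the oscillation of `H` about `1` is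
not integrable. -/
theorem not_integrableOn (h : OscillatoryFlow α β S H x₀ x₁ x₂ x₃) (T : ℝ) :
    ¬ IntegrableOn (fun s => s ^ (-(1 / 5) : ℝ) * (H s - 1)) (Ioi T) := by
  intro hint
  obtain ⟨S', C, c, hS', hc, hdec⟩ := h.exists_decay
  set R := max S' T with hR
  have hR1000 : 1000 ≤ R := h.le_time.trans (hS'.trans (le_max_left _ _))
  have hint' : IntegrableOn (fun s => s ^ (-(1 / 5) : ℝ) * (H s - 1)) (Ioi R) :=
    hint.mono_set (Ioi_subset_Ioi (le_max_right _ _))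
  have hπ := Real.pi_pos
  have hπ4 := Real.pi_le_four
  have hA := (((integrableOn_Ioi_comp_add hint' le_rfl).norm.add
    (integrableOn_Ioi_comp_add hint' (by positivity : 0 ≤ Real.pi / 2)).norm).add
    (integrableOn_Ioi_comp_add hint' hπ.le).norm).add
    (integrableOn_Ioi_comp_add hint' (by positivity : 0 ≤ Real.pi / 2 + Real.pi)).norm
  -- The amplitude is controlled by four shifted values of `|H - 1|`, and a bounded shift changes
  -- the weight by at most a factor two. The lower bound `c s^(-5/8)` for the amplitude would thus
  -- make `s^(-1/5 - 5/8)` integrable.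
  have hB : IntegrableOn (fun s : ℝ => s ^ (-(33 / 40) : ℝ)) (Ioi R) := by
    refine Integrable.mono' (hA.const_mul (4 / c)) (Measurable.aestronglyMeasurable (by fun_prop)) ?_
    refine (ae_restrict_iff' measurableSet_Ioi).2 (Eventually.of_forall fun s hs => ?_)
    have hs' : R < s := hs
    have hs0 : 0 < s := by linarith
    have hsS : S' ≤ s := (le_max_left _ _).trans hs'.le
    have h1 := (hdec s hsS).2
    have h2 := h.amp_le_sum (hS'.trans hsS)
    have hw : ∀ τ, 0 ≤ τ → τ ≤ s →
        s ^ (-(1 / 5) : ℝ) * |H (s + τ) - 1| ≤ 2 * ‖(s + τ) ^ (-(1 / 5) : ℝ) * (H (s + τ) - 1)‖ := by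
      intro τ hτ0 hτ
      rw [norm_mul, Real.norm_eq_abs, Real.norm_eq_abs,
        abs_of_nonneg (a := (s + τ) ^ (-(1 / 5) : ℝ)) (by positivity)]
      have := mul_le_mul_of_nonneg_right (half_mul_rpow_le hs0 hτ0 hτ) (abs_nonneg (H (s + τ) - 1))
      linarith
    have w0 := hw 0 le_rfl hs0.le
    have w1 := hw (Real.pi / 2) (by positivity) (by linarith)
    have w2 := hw Real.pi (by positivity) (by linarith)
    have w3 := hw (Real.pi / 2 + Real.pi) (by positivity) (by linarith)
    have e : s ^ (-(33 / 40) : ℝ) = s ^ (-(1 / 5) : ℝ) * s ^ (-(5 / 8) : ℝ) := by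
      rw [← Real.rpow_add hs0]
      norm_num
    have h3 := mul_le_mul_of_nonneg_left (h1.trans h2) (Real.rpow_nonneg hs0.le (-(1 / 5)))
    rw [Real.norm_eq_abs, abs_of_nonneg (by positivity), div_mul_eq_mul_div, le_div_iff₀ hc, e]
    simp only [Pi.add_apply, ← add_assoc] at w3 ⊢
    rw [add_zero] at w0 ⊢
    linarith
  rw [integrableOn_Ioi_rpow_iff (by linarith)] at hB
  norm_num at hB

end OscillatoryFlow

namespace IsHalfProfile

variable {m k : ℕ} {h : ℝ → ℝ}

/-- The phase is proportional to `z^(5/4)`, so the rate `s^(-1/2)` becomes `z^(-5/8)`. On a bounded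
interval continuity suffices, since `z^(-5/8)` is bounded below there. -/
theorem exists_abs_sub_one_le (hp : IsHalfProfile m k h) :
    ∃ C, 0 ≤ C ∧ ∀ z, 0 < z → |h z - 1| ≤ C * z ^ (-(5 / 8) : ℝ) := by
  obtain ⟨α, β, S, hosc⟩ := hp.exists_oscillatoryFlow
  obtain ⟨S', C, c, -, -, hdec⟩ := hosc.exists_decay
  obtain ⟨Z, hZ⟩ := eventually_atTop.1
    ((tendsto_phase.eventually (eventually_ge_atTop S')).and (eventually_gt_atTop 0))
  have hZ0 : 0 < Z := (hZ Z le_rfl).2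
  obtain ⟨M, hM⟩ := isCompact_Icc.exists_bound_of_continuousOn (s := Icc 0 Z)
    (f := fun z => h z - 1) (hp.contDiff.continuous.sub continuous_const).continuousOn
  have hM0 : 0 ≤ M := (norm_nonneg _).trans (hM 0 ⟨le_rfl, hZ0.le⟩)
  set D := C * (4 ^ (-(1 / 2) : ℝ) * (1 / 5) ^ (-(5 / 8) : ℝ)) with hD
  refine ⟨max D (M * Z ^ (5 / 8 : ℝ)), le_max_of_le_right (by positivity), fun z hz => ?_⟩
  have hz' : 0 ≤ z ^ (-(5 / 8) : ℝ) := by positivity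
  rcases le_total Z z with hZz | hzZ
  · refine le_trans ?_ (mul_le_mul_of_nonneg_right (le_max_left _ _) hz')
    have h1 := (hdec (phase z) (hZ z hZz).1).1
    rw [phaseDeriv, pow_zero, div_one, waveNumber_phase hz.le, iteratedDeriv_zero] at h1
    refine h1.trans_eq ?_
    rw [phase_eq hz.le, Real.mul_rpow (by norm_num) (by positivity),
      ← Real.rpow_mul (by positivity), div_eq_mul_one_div z 5,
      Real.mul_rpow hz.le (by norm_num), hD]
    norm_num
    ring
  · refine le_trans ?_ (mul_le_mul_of_nonneg_right (le_max_right _ _) hz')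
    have h1 := hM z ⟨hz.le, hzZ⟩
    rw [Real.norm_eq_abs] at h1
    have h2 : Z ^ (-(5 / 8) : ℝ) ≤ z ^ (-(5 / 8) : ℝ) :=
      Real.rpow_le_rpow_of_nonpos hz hzZ (by norm_num)
    have h3 : Z ^ (5 / 8 : ℝ) * Z ^ (-(5 / 8) : ℝ) = 1 := by
      rw [← Real.rpow_add hZ0]
      norm_num
    have h4 : M * Z ^ (5 / 8 : ℝ) * Z ^ (-(5 / 8) : ℝ) = M := by rw [mul_assoc, h3, mul_one]
    have h5 : 0 ≤ M * Z ^ (5 / 8 : ℝ) := by positivity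
    linarith [mul_le_mul_of_nonneg_left h2 h5]

/-- The substitution `z = 5 (s/4)^(4/5)` turns `dz` into a multiple of `s^(-1/5) ds`, the weight in
`OscillatoryFlow.not_integrableOn`. -/
theorem not_integrableOn_sub_one (hp : IsHalfProfile m k h) :
    ¬ IntegrableOn (fun z => h z - 1) (Ioi 0) := by
  intro hint
  obtain ⟨α, β, S, hosc⟩ := hp.exists_oscillatoryFlow
  have h1 := (integrableOn_Ioi_comp_mul_left_iff (fun z => h z - 1) 0
    (by norm_num : (0 : ℝ) < 5)).2 (by rwa [mul_zero])
  have h2 := (integrableOn_Ioi_comp_rpow_iff' (fun z => h (5 * z) - 1)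
    (by norm_num : (4 / 5 : ℝ) ≠ 0)).2 h1
  have h3 := (integrableOn_Ioi_comp_mul_left_iff _ 0
    (by norm_num : (0 : ℝ) < 1 / 4)).2 (by rwa [mul_zero])
  refine hosc.not_integrableOn 0 (IntegrableOn.congr_fun
    (h3.const_mul ((1 / 4) ^ (1 / 5 : ℝ))) ?_ measurableSet_Ioi)
  intro s hs
  have hs0 : 0 < s := hs
  have e : (4 / 5 - 1 : ℝ) = -(1 / 5) := by norm_num
  have e' : (1 / 4 * s : ℝ) = s / 4 := by ring
  simp only [phaseDeriv, pow_zero, div_one, iteratedDeriv_zero, smul_eq_mul,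
    waveNumber_pow_four hs0.le, e]
  rw [Real.mul_rpow (by norm_num : (0 : ℝ) ≤ 1 / 4) hs0.le, e', ← mul_assoc, ← mul_assoc,
    ← Real.rpow_add (by norm_num)]
  norm_num

end IsHalfProfile

/-! ### The `L¹` error of the similarity solution -/

theorem measurable_shockMinus : Measurable shockMinus := by
  unfold shockMinus Real.sign
  exact (Measurable.ite measurableSet_Iio measurable_const
    (Measurable.ite measurableSet_Ioi measurable_const measurable_const)).neg

theorem integrableOn_abs_rpow (l : ℝ) {r : ℝ} (hr : -1 < r) :
    IntegrableOn (fun x : ℝ => |x| ^ r) (Ioo (-l) l) := by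
  have h1 : IntegrableOn (fun x : ℝ => |x| ^ r) (Ioc 0 l) := by
    refine IntegrableOn.congr_fun
      (intervalIntegral.intervalIntegrable_rpow' (a := 0) (b := l) hr).1 (fun x hx => ?_)
      measurableSet_Ioc
    simp only [abs_of_pos hx.1]
  have h2 : IntegrableOn (fun x : ℝ => |x| ^ r) (Ico (-l) 0) := by
    have := ((Measure.measurePreserving_neg volume).integrableOn_comp_preimage
      (MeasurableEquiv.neg ℝ).measurableEmbedding).2 h1
    simpa [Function.comp_def] using this
  have h3 : IntegrableOn (fun x : ℝ => |x| ^ r) {0} := by simp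
  refine ((h1.union h2).union h3).mono_set fun x hx => ?_
  rcases lt_trichotomy x 0 with h | h | h
  · exact Or.inl (Or.inr ⟨hx.1.le, h⟩)
  · exact Or.inr h
  · exact Or.inl (Or.inl ⟨h, hx.2.le⟩)

namespace IsShockProfile

variable {m k : ℕ} {g : ℝ → ℝ}

/-- For fixed `t` the solution is a dilation of the profile, so its deviation from the shock is
already non-integrable on the positive half line. -/
theorem l1Error_univ_eq_top (hg : IsShockProfile m k g) (hm : 1 ≤ m) (hmk : m + k = 5) {t : ℝ}
    (ht : t < 0) : l1Error g univ t = ∞ := by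
  by_contra hne
  have hb : 0 < (-t) ^ (1 / 5 : ℝ) := Real.rpow_pos_of_pos (by linarith) _
  have hmeas : Measurable fun x => uMinus g x t - shockMinus x := by
    unfold uMinus
    exact ((hg.contDiff.continuous.comp (continuous_id.div_const _)).measurable).sub
      measurable_shockMinus
  have hint : Integrable (fun x => uMinus g x t - shockMinus x) := by
    rw [← memLp_one_iff_integrable]
    refine ⟨hmeas.aestronglyMeasurable, ?_⟩
    rw [l1Error, Measure.restrict_univ] at hne
    exact lt_top_iff_ne_top.2 hne
  refine (hg.neg_isHalfProfile hm hmk).not_integrableOn_sub_one ?_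
  have h1 : IntegrableOn (fun x => (-g) (((-t) ^ (1 / 5 : ℝ))⁻¹ * x) - 1) (Ioi 0) := by
    refine IntegrableOn.congr_fun (hint.neg.integrableOn (s := Ioi 0)) (fun x hx => ?_)
      measurableSet_Ioi
    have e : shockMinus x = -1 := by rw [shockMinus, Real.sign_of_pos hx]
    simp only [Pi.neg_apply, e, uMinus, div_eq_inv_mul]
    ring
  have h2 := (integrableOn_Ioi_comp_mul_left_iff (fun x => (-g) x - 1) 0 (inv_pos.2 hb)).1 h1
  rwa [mul_zero] at h2

theorem exists_abs_sub_shockMinus_le (hg : IsShockProfile m k g) (hm : 1 ≤ m) (hmk : m + k = 5) :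
    ∃ C, 0 ≤ C ∧ ∀ z, z ≠ 0 → |g z - shockMinus z| ≤ C * |z| ^ (-(5 / 8) : ℝ) := by
  obtain ⟨C, hC, h1⟩ := (hg.neg_isHalfProfile hm hmk).exists_abs_sub_one_le
  obtain ⟨D, hD, h2⟩ := (hg.comp_neg_isHalfProfile hm hmk).exists_abs_sub_one_le
  refine ⟨max C D, le_max_of_le_left hC, fun z hz => ?_⟩
  have hr : 0 ≤ |z| ^ (-(5 / 8) : ℝ) := Real.rpow_nonneg (abs_nonneg z) _
  rcases lt_or_gt_of_ne hz with h | h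
  · have := h2 (-z) (by linarith)
    rw [neg_neg, ← abs_of_neg h] at this
    rw [shockMinus, Real.sign_of_neg h, neg_neg]
    exact this.trans (mul_le_mul_of_nonneg_right (le_max_right _ _) hr)
  · have := h1 z h
    rw [shockMinus, Real.sign_of_pos h, ← abs_neg, abs_of_pos h]
    rw [Pi.neg_apply] at this
    rw [abs_of_pos h] at hr
    refine le_trans (le_of_eq ?_) (this.trans (mul_le_mul_of_nonneg_right (le_max_left _ _) hr))
    congr 1
    ring

/-- The shock is invariant under dilations, so the pointwise bound at `x/(-t)^(1/5)` reads `C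
|x|^(-5/8) (-t)^(1/8)`, with `1/8 = (1/5)(5/8)`; the power of `|x|` is locally integrable. -/
theorem exists_l1Error_Ioo_le (hg : IsShockProfile m k g) (hm : 1 ≤ m) (hmk : m + k = 5) (l : ℝ) :
    ∃ C, ∀ t < 0, l1Error g (Ioo (-l) l) t ≤ ENNReal.ofReal (C * (-t) ^ (1 / 8 : ℝ)) := by
  obtain ⟨C, hC, hb⟩ := hg.exists_abs_sub_shockMinus_le hm hmk
  have hint := integrableOn_abs_rpow l (r := -(5 / 8)) (by norm_num)
  refine ⟨C * ∫ x in Ioo (-l) l, |x| ^ (-(5 / 8) : ℝ), fun t ht => ?_⟩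
  have ht8 : 0 ≤ (-t) ^ (1 / 8 : ℝ) := Real.rpow_nonneg (by linarith) _
  have hle : ∀ x : ℝ, x ≠ 0 → ‖uMinus g x t - shockMinus x‖ₑ ≤
      ENNReal.ofReal (C * (-t) ^ (1 / 8 : ℝ) * |x| ^ (-(5 / 8) : ℝ)) := fun x hx => by
    have hb0 : 0 < (-t) ^ (1 / 5 : ℝ) := Real.rpow_pos_of_pos (by linarith) _
    rw [Real.enorm_eq_ofReal_abs]
    refine ENNReal.ofReal_le_ofReal ?_
    have e : shockMinus x = shockMinus (x / (-t) ^ (1 / 5 : ℝ)) := by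
      unfold shockMinus
      rcases lt_or_gt_of_ne hx with h | h
      · rw [Real.sign_of_neg h, Real.sign_of_neg (div_neg_of_neg_of_pos h hb0)]
      · rw [Real.sign_of_pos h, Real.sign_of_pos (div_pos h hb0)]
    rw [uMinus, e]
    refine (hb _ (div_ne_zero hx hb0.ne')).trans_eq ?_
    rw [abs_div, abs_of_pos hb0, Real.div_rpow (abs_nonneg x) hb0.le,
      ← Real.rpow_mul (by linarith), mul_assoc, div_eq_mul_inv, ← Real.rpow_neg (by linarith),
      mul_comm (|x| ^ _)]
    norm_num
  have h0 : ∀ᵐ x : ℝ ∂(volume.restrict (Ioo (-l) l)), x ≠ 0 :=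
    ae_restrict_of_ae (Measure.ae_ne volume 0)
  calc l1Error g (Ioo (-l) l) t
      = ∫⁻ x in Ioo (-l) l, ‖uMinus g x t - shockMinus x‖ₑ := eLpNorm_one_eq_lintegral_enorm
    _ ≤ ∫⁻ x in Ioo (-l) l, ENNReal.ofReal (C * (-t) ^ (1 / 8 : ℝ) * |x| ^ (-(5 / 8) : ℝ)) :=
      lintegral_mono_ae (h0.mono hle)
    _ = ENNReal.ofReal (∫ x in Ioo (-l) l, C * (-t) ^ (1 / 8 : ℝ) * |x| ^ (-(5 / 8) : ℝ)) :=
      (ofReal_integral_eq_lintegral_ofReal (hint.const_mul _)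
        (Eventually.of_forall fun x => by positivity)).symm
    _ = _ := by
      rw [integral_const_mul]
      congr 1
      ring

end IsShockProfile

theorem proposition2p1 (m k : ℕ) (hm : 1 ≤ m) (hmk : m + k = 5) (g : ℝ → ℝ)
    (hg : IsShockProfile m k g) :
    -- no convergence in `L¹(ℝ)`
    (¬ Tendsto (fun t => l1Error g univ t) (𝓝[<] 0) (𝓝 0)) ∧
    -- convergence in `L¹_loc(ℝ)`
    (∀ K : Set ℝ, IsCompact K → Tendsto (fun t => l1Error g K t) (𝓝[<] 0) (𝓝 0)) ∧
    -- with a rate on every bounded interval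
    (∀ l : ℝ, 0 < l → ∃ C : ℝ, ∀ᶠ t in 𝓝[<] (0 : ℝ),
      l1Error g (Ioo (-l) l) t ≤ ENNReal.ofReal (C * (-t) ^ (1 / 8 : ℝ))) := by
  refine ⟨fun hlim => ?_, fun K hK => ?_, fun l _ => ?_⟩
  · obtain ⟨t, ht, ht0⟩ := ((hlim.eventually (gt_mem_nhds one_pos)).and self_mem_nhdsWithin).exists
    rw [hg.l1Error_univ_eq_top hm hmk ht0] at ht
    exact absurd ht (by simp)
  · obtain ⟨r, hr⟩ := hK.isBounded.subset_ball 0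
    rw [Real.ball_eq_Ioo, zero_sub, zero_add] at hr
    obtain ⟨C, hC⟩ := hg.exists_l1Error_Ioo_le hm hmk r
    have hlim : Tendsto (fun t : ℝ => ENNReal.ofReal (C * (-t) ^ (1 / 8 : ℝ))) (𝓝[<] 0) (𝓝 0) := by
      have hc : Continuous fun t : ℝ => ENNReal.ofReal (C * (-t) ^ (1 / 8 : ℝ)) :=
        ENNReal.continuous_ofReal.comp
          (continuous_const.mul (continuous_neg.rpow_const fun _ => Or.inr (by norm_num)))
      have := hc.tendsto 0
      simp only [neg_zero, Real.zero_rpow (by norm_num : (1 / 8 : ℝ) ≠ 0), mul_zero,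
        ENNReal.ofReal_zero] at this
      exact this.mono_left nhdsWithin_le_nhds
    refine tendsto_of_tendsto_of_tendsto_of_le_of_le' tendsto_const_nhds hlim
      (Eventually.of_forall fun _ => zero_le) ?_
    filter_upwards [self_mem_nhdsWithin] with t ht
    exact (eLpNorm_mono_measure _ (Measure.restrict_mono hr le_rfl)).trans (hC t ht)
  · obtain ⟨C, hC⟩ := hg.exists_l1Error_Ioo_le hm hmk l
    refine ⟨C, ?_⟩
    filter_upwards [self_mem_nhdsWithin] with t ht using hC t ht
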